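/- Let $k=\mathbf F_8$. A smooth projective absolutely irreducible curve $C$ over $k$ is described by its function field $F$, an algebraic function field of one variable over $k$ in which $k$ is algebraically closed. The closed points of $C$ are the discrete valuation rings of $F$ containing $k$, $C(k)$ is the set of closed points with residue field $k$, and $g(C)=\max_D\,(\deg D-\dim_k L(D)+1)$ over all divisors $D$ of $C$ is the genus, where $L(D)=\{f\in F:\ f=0\text{ or } \operatorname{ord}_P(f)\ge -D(P)\text{ for all closed points }P\}$. A tower $\cdots\to C_1\to C_0$ of covers of such curves is called asymptotically good if $g(C_i)>1$ for some $i$ and $\lim_{i\to\infty}\#C_i(k)/g(C_i)$ exists and is positive. **Theorem.** There are elements $x_0,x_1,x_2,\dots$ of an algebraic closure of the rational function field $k(t)$ such that $x_0$ is transcendental over $k$ and $$x_i^2+x_i=x_{i-1}+1+\frac1{x_{i-1}}\qquad(i\ge 1).$$ For every sequence $(x_i)_{i\ge0}$ of this kind in any extension field of $k$, the fields $F_i=k(x_0,\dots,x_i)$ are the function fields of smooth projective absolutely irreducible curves $C_i$ over $k$ with $[F_{i+1}:F_i]=2$ for all $i\ge 0$; the tower $$\cdots\to C_i\to C_{i-1}\to\cdots\to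 C_1\to C_0=\mathbb P^1$$ is asymptotically good, and $$\lim_{i\to\infty}\frac{\#C_i(\mathbf F_8)}{g(C_i)}=\frac32 .$$ -/

import Mathlib

open Filter Topology

noncomputable section

/-- A place of `F` over the constant field `k`: a discrete valuation ring of `F` that contains `k`.
For an algebraic function field `F` of one variable over `k` these are the closed points of the
smooth projective curve over `k` with function field `F`. -/
structure Place (k F : Type*) [Field k] [Field F] [Algebra k F] where
  /-- the local ring at the place -/
  ring : ValuationSubring F
  isDVR : IsDiscreteValuationRing ring
  algebraMap_mem : ∀ c : k, algebraMap k F c ∈ ring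

namespace Place

variable {k F : Type*} [Field k] [Field F] [Algebra k F] (P : Place k F)

instance : IsDiscreteValuationRing P.ring := P.isDVR

instance : Algebra k P.ring :=
  ((algebraMap k F).codRestrict P.ring.toSubring P.algebraMap_mem).toAlgebra

/-- The residue field of the place. -/
abbrev residueField : Type _ := IsLocalRing.ResidueField P.ring

/-- The degree of a place, `[κ(P) : k]`. -/
def degree : ℕ := Module.finrank k P.residueField

/-- The normalized discrete valuation of the place, written multiplicatively:
`P.valuation f = exp (-ord_P f)`, and `P.valuation 0 = 0`. -/
def valuation : Valuation F (WithZero (Multiplicative ℤ)) :=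
  (IsDiscreteValuationRing.maximalIdeal P.ring).valuation F

lemma valuation_algebraMap_le_one (c : k) : P.valuation (algebraMap k F c) ≤ 1 :=
  (IsDiscreteValuationRing.maximalIdeal P.ring).valuation_le_one
    (⟨algebraMap k F c, P.algebraMap_mem c⟩ : P.ring)

end Place

section FunctionField

variable (k F : Type*) [Field k] [Field F] [Algebra k F]

/-- `F` is an algebraic function field of one variable over `k`, and `k` is algebraically closed
in `F`. Over a perfect field `k` this says that `F` is the function field of a smooth projective
absolutely irreducible curve over `k`. -/
structure IsCurveFunctionField : Prop where
  exists_finite : ∃ x : F, Transcendental k x ∧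
    FiniteDimensional (IntermediateField.adjoin k {x}) F
  exact_constants : ∀ a : F, IsAlgebraic k a → a ∈ (algebraMap k F).range

/-- Divisors: the free abelian group on the places. -/
abbrev CurveDivisor : Type _ := Place k F →₀ ℤ

variable {k F}

/-- The degree of a divisor. -/
def CurveDivisor.deg (D : CurveDivisor k F) : ℤ := D.sum fun P n => n * (P.degree : ℤ)

/-- The Riemann-Roch space `L(D)` of all `f` with `ord_P f ≥ - D(P)` for every place `P`
(and `f = 0`). -/
def riemannRochSpace (D : CurveDivisor k F) : Submodule k F where
  carrier := {f | ∀ P : Place k F, P.valuation f ≤ WithZero.exp (D P)}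
  zero_mem' P := by simp
  add_mem' hf hg P := (P.valuation.map_add _ _).trans (max_le (hf P) (hg P))
  smul_mem' c f hf P := by
    rw [Algebra.smul_def, map_mul]
    exact (mul_le_of_le_one_left' (P.valuation_algebraMap_le_one c)).trans (hf P)

variable (k F)

/-- The genus: the maximum of `deg D - dim L(D) + 1` over all divisors `D`. -/
def genus : ℤ :=
  sSup (Set.range fun D : CurveDivisor k F =>
    D.deg - (Module.finrank k (riemannRochSpace D) : ℤ) + 1)

/-- The number of `k`-rational points: the number of places of degree one. -/
def numRationalPoints : ℕ := Nat.card {P : Place k F // P.degree = 1}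

end FunctionField

section Tower

variable (k : Type*) {L : Type*} [Field k] [Field L] [Algebra k L]

/-- The ratio of the number of rational points and the genus at each level. -/
def pointGenusRatio (F : ℕ → IntermediateField k L) (i : ℕ) : ℝ :=
  (numRationalPoints k (F i) : ℝ) / (genus k (F i) : ℝ)

/-- A tower of covers of curves over `k`, given by the increasing sequence of the function fields,
is asymptotically good: some genus exceeds one, and the number of rational points divided by the
genus has a positive limit. -/
structure IsAsymptoticallyGoodTower (F : ℕ → IntermediateField k L) : Prop where
  curve : ∀ i, IsCurveFunctionField k (F i)
  mono : Monotone F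
  one_lt_genus : ∃ i, 1 < genus k (F i)
  limit_pos : ∃ l : ℝ, 0 < l ∧ Tendsto (pointGenusRatio k F) atTop (𝓝 l)

/-- `x₀` is transcendental over `k`, and `xᵢ² + xᵢ = xᵢ₋₁ + 1 + 1 / xᵢ₋₁` for `i ≥ 1`. -/
structure IsTowerSequence (x : ℕ → L) : Prop where
  transcendental : Transcendental k (x 0)
  recursion : ∀ i, x (i + 1) ^ 2 + x (i + 1) = x i + 1 + 1 / x i

/-- The function field `k(x₀, …, xᵢ)` of the `i`-th curve. -/
def towerField (x : ℕ → L) (i : ℕ) : IntermediateField k L :=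
  IntermediateField.adjoin k (x '' Set.Iic i)

end Tower

end

open Filter Topology
noncomputable section
open WithZero IsDedekindDomain

/-! ### Places, valuations and primes of Dedekind domains -/

namespace Place

section Basic

variable {k F : Type*} [Field k] [Field F] [Algebra k F]

/-! Follow the value of `x = xₙ` at a place. Under `y² + y = x + 1 + 1/x` the set `{∞, 0, 1, ω,
ω²}`, with `ω² + ω + 1 = 0`, is stable in both directions: `∞` and `0` go to `∞`, `1` goes to `ω,
ω²`, and `ω, ω²` go to `0` or `1`. Call places with such values bad. All ramification is at bad
places. The other values in `𝐅₈` are the six elements different from `0` and `1`; for them the right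
side has trace zero, so every good rational place splits completely and level `n` has exactly `6 ·
2ⁿ` of them.

Suppose each step has Artin-Schreier class with at most simple poles locally (`weakOn`). Then
Riemann-Hurwitz (`IsArtinSchreier.hasGenus`) reads `g' = 2g - 1 + r`, with `r` the total degree of
the ramified places, while the total degree `s` of the bad places satisfies `s' = 2s - r`
(`sum_degree_fiber`). So `g + s - 1` doubles at each step. It starts at `0 + 5 - 1 = 4`, hence `g =
4 · 2ⁿ + 1 - s`, and the number of rational points is `6 · 2ⁿ + m` with `0 ≤ m ≤ s`. The limit `6/4`
follows once `s = o(2ⁿ)`.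

For that, each bad place gets a weight at least `1` depending on how closely `x` approaches its bad
value; the total weight grows by a factor of at most `19/10` per level (`sum_weight_le`).

The simple-pole property is the delicate point. Locally, two classes with at most simple poles keep
this property after adjoining a root of one of them (`weakAt_algebraMap`). Globally, the tower is
also read downwards: adjoining `x₀` to `k(x₁, …, xₙ₊₁)` is again an Artin-Schreier step, with class
`1/(x₁² + x₁ + 1)`, so the induction can use the shifted sequence.

The genus is handled through Riemann's theorem alone: `deg D - dim L(D) + 1` becomes constant for
large `D`, which is equivalent to an approximation property that holds for `k(x)` by partial
fractions. -/

theorem ext_ring {P Q : Place k F} (h : P.ring = Q.ring) : P = Q := by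
  cases P; cases Q; cases h; rfl

variable (P : Place k F)

theorem mem_ring_iff {f : F} : f ∈ P.ring ↔ P.valuation f ≤ 1 := by
  constructor
  · intro hf
    exact (IsDiscreteValuationRing.maximalIdeal P.ring).valuation_le_one (⟨f, hf⟩ : P.ring)
  · intro hf
    obtain ⟨a, rfl⟩ := IsDiscreteValuationRing.exists_lift_of_le_one hf
    exact a.2

theorem valuationSubring_valuation : P.valuation.valuationSubring = P.ring := by
  ext f
  rw [Valuation.mem_valuationSubring_iff, P.mem_ring_iff]

theorem exists_uniformizer : ∃ π : F, P.valuation π = exp (-1 : ℤ) :=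
  (IsDiscreteValuationRing.maximalIdeal P.ring).valuation_exists_uniformizer F

theorem exists_valuation_eq (n : ℤ) : ∃ f : F, P.valuation f = exp n := by
  obtain ⟨π, hπ⟩ := P.exists_uniformizer
  refine ⟨π ^ (-n), ?_⟩
  rw [map_zpow₀, hπ, ← exp_zsmul]
  simp

theorem exists_eq_exp {f : F} (hf : f ≠ 0) : ∃ n : ℤ, P.valuation f = exp n :=
  ⟨_, (exp_log ((map_ne_zero _).2 hf)).symm⟩

theorem mem_maximalIdeal_iff (f : P.ring) :
    f ∈ IsLocalRing.maximalIdeal P.ring ↔ P.valuation (f : F) < 1 :=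
  ((IsDiscreteValuationRing.maximalIdeal P.ring).valuation_lt_one_iff_mem (K := F) f).symm

theorem residue_eq_zero_iff (f : P.ring) :
    IsLocalRing.residue P.ring f = 0 ↔ P.valuation (f : F) < 1 := by
  rw [IsLocalRing.residue_eq_zero_iff, mem_maximalIdeal_iff]

theorem residue_eq_iff (f g : P.ring) :
    IsLocalRing.residue P.ring f = IsLocalRing.residue P.ring g ↔
      P.valuation ((f : F) - g) < 1 := by
  rw [← sub_eq_zero, ← map_sub, residue_eq_zero_iff]
  rfl

theorem valuation_algebraMap {c : k} (hc : c ≠ 0) : P.valuation (algebraMap k F c) = 1 := by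
  refine le_antisymm (P.valuation_algebraMap_le_one c) ?_
  have h := P.valuation_algebraMap_le_one c⁻¹
  rw [map_inv₀, map_inv₀] at h
  have h0 : P.valuation (algebraMap k F c) ≠ 0 := by simpa using hc
  exact (inv_le_one₀ (zero_lt_iff.2 h0)).1 h

theorem ring_ne_top : P.ring ≠ ⊤ := by
  intro h
  obtain ⟨f, hf⟩ := P.exists_valuation_eq 1
  have : f ∈ P.ring := h ▸ ValuationSubring.mem_top f
  rw [mem_ring_iff, hf, ← exp_zero, exp_le_exp] at this
  omega

theorem eq_of_ring_le {P Q : Place k F} (h : P.ring ≤ Q.ring) : P = Q := by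
  exact ext_ring (ValuationSubring.eq_of_le_of_ne_top _ h Q.ring_ne_top)

/-- A discrete valuation trivial on the constants defines a place. -/
def ofValuation (v : Valuation F (WithZero (Multiplicative ℤ))) (hv : v.IsNontrivial)
    (hk : ∀ c : k, v (algebraMap k F c) ≤ 1) : Place k F where
  ring := v.valuationSubring
  isDVR := inferInstance
  algebraMap_mem c := hk c

/-- Equal valuation rings give equivalent valuations; since both attain `exp (-1)`, a uniformizer
for one is a uniformizer for the other, which fixes the normalization. -/
theorem valuation_eq_of_valuationSubring_eq (v : Valuation F (WithZero (Multiplicative ℤ)))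
    (hs : ∃ π, v π = exp (-1 : ℤ)) (h : v.valuationSubring = P.ring) : P.valuation = v := by
  have hle : ∀ f, P.valuation f ≤ 1 ↔ v f ≤ 1 := fun f => by
    rw [← mem_ring_iff, ← h, Valuation.mem_valuationSubring_iff]
  have heq := (Valuation.isEquiv_iff_val_le_one (v := P.valuation) (v' := v)).2 (hle _)
  obtain ⟨π, hπ⟩ := P.exists_uniformizer
  obtain ⟨ρ, hρ⟩ := hs
  have lt_iff (z : WithZero (Multiplicative ℤ)) : z < 1 ↔ z ≤ exp (-1 : ℤ) := by
    rcases eq_or_ne z 0 with rfl | hz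
    · simp
    · rw [← exp_log hz, ← exp_zero, exp_lt_exp, exp_le_exp]; omega
  have hvπ : v π = exp (-1 : ℤ) := by
    apply le_antisymm
    · rw [← lt_iff, ← heq.lt_one_iff_lt_one, lt_iff, hπ]
    · rw [← hρ, ← heq.le_iff_le, hπ, ← lt_iff, heq.lt_one_iff_lt_one, lt_iff, hρ]
  ext f
  rcases eq_or_ne f 0 with rfl | hf
  · simp
  obtain ⟨n, hn⟩ := P.exists_eq_exp hf
  have h1 : P.valuation (f * π ^ n) = 1 := by
    rw [map_mul, map_zpow₀, hn, hπ, ← exp_zsmul, ← exp_add]; simp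
  have h2 : v (f * π ^ n) = 1 := heq.eq_one_iff_eq_one.1 h1
  rw [map_mul, map_zpow₀, hvπ, ← exp_zsmul] at h2
  have := eq_inv_of_mul_eq_one_left h2
  rw [hn, this, ← exp_neg]; simp

end Basic

section OfPrime

variable {k F B : Type*} [Field k] [Field F] [Algebra k F] [CommRing B] [IsDedekindDomain B]
  [Algebra B F] [IsFractionRing B F] [Algebra k B] [IsScalarTower k B F]

variable (k F) in
/-- The place defined by a nonzero prime ideal of a Dedekind domain. -/
def ofPrime (q : HeightOneSpectrum B) : Place k F :=
  ofValuation (q.valuation F) inferInstance fun c => by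
    rw [IsScalarTower.algebraMap_apply k B F]; exact q.valuation_le_one _

theorem ofPrime_valuation (q : HeightOneSpectrum B) :
    (ofPrime k F q).valuation = q.valuation F :=
  valuation_eq_of_valuationSubring_eq _ _ (q.valuation_exists_uniformizer F) rfl

theorem ofPrime_injective : Function.Injective (ofPrime k F : HeightOneSpectrum B → Place k F) := by
  intro p q h
  apply HeightOneSpectrum.eq_of_valuation_isEquiv_valuation (K := F)
  rw [← ofPrime_valuation (k := k), ← ofPrime_valuation (k := k), h]

/-- The prime is the centre of `P` on `B`. It is nonzero, as otherwise `P.ring` would be all of `F`;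
the local ring at the centre lies in `P.ring`, and a discrete valuation ring admits no larger proper
subring. -/
theorem exists_eq_ofPrime (P : Place k F) (h : ∀ b : B, algebraMap B F b ∈ P.ring) :
    ∃ q : HeightOneSpectrum B, P = ofPrime k F q := by
  let φ : B →+* P.ring := (algebraMap B F).codRestrict P.ring.toSubring h
  let I : Ideal B := (IsLocalRing.maximalIdeal P.ring).comap φ
  have memI (b : B) : b ∈ I ↔ P.valuation (algebraMap B F b) < 1 := by
    rw [Ideal.mem_comap, mem_maximalIdeal_iff]; rfl
  have hI : I ≠ ⊥ := by
    intro hI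
    apply P.ring_ne_top
    rw [eq_top_iff]
    intro f _
    obtain ⟨a, b, hb, rfl⟩ := IsFractionRing.div_surjective (A := B) f
    rw [mem_ring_iff, map_div₀]
    have hb0 : b ≠ 0 := nonZeroDivisors.ne_zero hb
    have : ¬ P.valuation (algebraMap B F b) < 1 := by
      rw [← memI, hI]; simpa using hb0
    have h1 : P.valuation (algebraMap B F b) = 1 :=
      le_antisymm (P.mem_ring_iff.1 (h b)) (not_lt.1 this)
    rw [h1, div_one]
    exact P.mem_ring_iff.1 (h a)
  let q : HeightOneSpectrum B := ⟨I, Ideal.comap_isPrime _ _, hI⟩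
  refine ⟨q, (eq_of_ring_le ?_).symm⟩
  intro f hf
  obtain ⟨n, d, hnd⟩ := q.exists_primeCompl_mul_eq_of_integer f hf
  rw [mem_ring_iff]
  have hd : P.valuation (algebraMap B F d) = 1 := by
    refine le_antisymm (P.mem_ring_iff.1 (h d)) (not_lt.1 fun hlt => d.2 ((memI _).2 hlt))
  have := congrArg P.valuation hnd
  rw [map_mul, hd, mul_one] at this
  rw [this]
  exact P.mem_ring_iff.1 (h n)

/-- `B` approximates every `q`-integral element modulo the maximal ideal, so `B` maps onto the
residue field with kernel `q`. -/
theorem ofPrime_degree (q : HeightOneSpectrum B) :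
    (ofPrime k F q).degree = Module.finrank k (B ⧸ q.asIdeal) := by
  set P := ofPrime k F q with hP
  have hv : P.valuation = q.valuation F := ofPrime_valuation q
  have hmem (b : B) : algebraMap B F b ∈ P.ring := by
    rw [mem_ring_iff, hv]; exact q.valuation_le_one b
  let φ : B →ₐ[k] P.ring :=
    { (algebraMap B F).codRestrict P.ring.toSubring hmem with
      commutes' := fun c => Subtype.ext (IsScalarTower.algebraMap_apply k B F c).symm }
  let ψ : B →ₐ[k] P.residueField := (IsScalarTower.toAlgHom k P.ring P.residueField).comp φ
  have hψ : Function.Surjective ψ := by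
    intro r
    obtain ⟨f, rfl⟩ := IsLocalRing.residue_surjective r
    have hf : q.valuation F (f : F) ≤ 1 := by rw [← hv]; exact P.mem_ring_iff.1 f.2
    obtain ⟨b, hb⟩ := q.exists_valuation_sub_lt_of_integer hf 1
    refine ⟨b, ?_⟩
    change IsLocalRing.residue P.ring (φ b) = _
    rw [residue_eq_iff, hv]
    exact (by simpa using hb : q.valuation F (algebraMap B F b - f) < 1)
  have hker : RingHom.ker ψ = q.asIdeal := by
    ext b
    rw [RingHom.mem_ker]
    change IsLocalRing.residue P.ring (φ b) = 0 ↔ _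
    rw [residue_eq_zero_iff, hv]
    exact q.valuation_lt_one_iff_mem b
  have e := Ideal.quotientKerAlgEquivOfSurjective hψ
  have e' : (B ⧸ q.asIdeal) ≃ₐ[k] P.residueField := (Ideal.quotientEquivAlgOfEq k hker.symm).trans e
  exact e'.toLinearEquiv.finrank_eq.symm

end OfPrime

/-! ### Places in finite extensions and the fundamental identity -/

section Extension

variable {k F F' : Type*} [Field k] [Field F] [Field F'] [Algebra k F] [Algebra k F']
  [Algebra F F'] [IsScalarTower k F F'] [FiniteDimensional F F']

omit [Algebra k F] [IsScalarTower k F F'] in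
-- If `F` lay inside the integrally closed ring of `P'`, so would `F'`, which is integral over `F`.
theorem comap_valuation_isNontrivial (P' : Place k F') :
    (P'.valuation.comap (algebraMap F F')).IsNontrivial := by
  by_contra hn
  have h1 : ∀ f : F, algebraMap F F' f ∈ P'.ring := by
    intro f
    rw [mem_ring_iff]
    by_contra hf
    exact hn ⟨f, fun h0 => hf (by rw [Valuation.comap_apply] at h0; rw [h0]; exact zero_le_one),
      fun h1 => hf (by rw [Valuation.comap_apply] at h1; exact h1.le)⟩
  apply P'.ring_ne_top
  rw [eq_top_iff]
  intro z _
  obtain ⟨p, hp, hz⟩ := Algebra.IsIntegral.isIntegral (R := F) z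
  rw [← valuationSubring_valuation]
  have : IsIntegral P'.valuation.valuationSubring z := by
    let φ : F →+* P'.valuation.valuationSubring :=
      (algebraMap F F').codRestrict P'.valuation.valuationSubring.toSubring
        fun f => by
          have := P'.mem_ring_iff.1 (h1 f)
          exact this
    refine ⟨p.map φ, hp.map φ, ?_⟩
    rw [Polynomial.eval₂_map]
    exact hz
  obtain ⟨y, rfl⟩ := IsIntegrallyClosed.isIntegral_iff.1 this
  exact y.2

variable (F) in
/-- The place of the subfield `F` below a place of a finite extension. -/
def restrict (P' : Place k F') : Place k F :=
  ofValuation (P'.valuation.comap (algebraMap F F')) P'.comap_valuation_isNontrivial fun c => by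
    rw [Valuation.comap_apply, ← IsScalarTower.algebraMap_apply]
    exact P'.valuation_algebraMap_le_one c

theorem mem_restrict_ring (P' : Place k F') (f : F) :
    f ∈ (P'.restrict F).ring ↔ algebraMap F F' f ∈ P'.ring := by
  rw [mem_ring_iff P']; rfl

theorem restrict_eq_iff (P : Place k F) (P' : Place k F') :
    P'.restrict F = P ↔ ∀ f ∈ P.ring, algebraMap F F' f ∈ P'.ring := by
  constructor
  · rintro rfl f hf
    exact (mem_restrict_ring P' f).1 hf
  · intro h
    exact (eq_of_ring_le fun f hf => (mem_restrict_ring P' f).2 (h f hf)).symm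

end Extension

end Place

namespace Place

section FundamentalIdentity

variable {k F F' B : Type*} [Field k] [Field F] [Field F'] [Algebra k F] [Algebra k F']
  [Algebra F F'] [IsScalarTower k F F'] [FiniteDimensional F F'] (P : Place k F)
  [CommRing B] [IsDedekindDomain B] [Algebra P.ring B]

theorem liesOver_maximalIdeal [FaithfulSMul P.ring B] [Module.Finite P.ring B]
    (q : HeightOneSpectrum B) : q.asIdeal.LiesOver (IsLocalRing.maximalIdeal P.ring) := by
  have h1 : (q.asIdeal.under P.ring).IsMaximal := by
    have := q.isMaximal
    exact Ideal.IsMaximal.under P.ring q.asIdeal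
  exact ⟨(IsLocalRing.eq_maximalIdeal h1).symm⟩

variable (B) in
-- Places above `P` are the primes of `B` over the maximal ideal of `P.ring`, and the sum formula is
-- `∑ e f = n` multiplied by `P.degree`. It is stated for any `e` satisfying the valuation identity,
-- because the ramification index is only chosen afterwards.
theorem exists_fiber_of_dedekind [Algebra B F'] [IsFractionRing B F']
    [Algebra P.ring F'] [IsScalarTower P.ring B F'] [IsScalarTower P.ring F F']
    [Algebra k B] [IsScalarTower k B F'] [IsScalarTower k P.ring B] [Module.Finite P.ring B] :
    (∀ P' : Place k F', P'.restrict F = P → P.degree ∣ P'.degree ∧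
      ∃ e : ℕ, 0 < e ∧ ∀ f : F, P'.valuation (algebraMap F F' f) = P.valuation f ^ e) ∧
    ∃ T : Finset (Place k F'), (∀ P' : Place k F', P' ∈ T ↔ P'.restrict F = P) ∧
      (∀ e : Place k F' → ℕ, (∀ P' ∈ T, ∀ f : F,
        P'.valuation (algebraMap F F' f) = P.valuation f ^ (e P')) →
        ∑ P' ∈ T, e P' * P'.degree = Module.finrank F F' * P.degree) ∧
      (0 < P.degree → ∀ P' ∈ T, 0 < P'.degree) := by
  classical
  set p := IsLocalRing.maximalIdeal P.ring with hp
  have hp0 : p ≠ ⊥ := IsDiscreteValuationRing.not_a_field P.ring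
  have hinj : Function.Injective (algebraMap P.ring B) := by
    have : Function.Injective (algebraMap P.ring F') := by
      rw [IsScalarTower.algebraMap_eq P.ring F F']
      exact (algebraMap F F').injective.comp Subtype.coe_injective
    rw [IsScalarTower.algebraMap_eq P.ring B F'] at this
    exact Function.Injective.of_comp this
  have : FaithfulSMul P.ring B := (faithfulSMul_iff_algebraMap_injective _ _).2 hinj
  have hlies (q : HeightOneSpectrum B) : q.asIdeal.LiesOver p := P.liesOver_maximalIdeal q
  have hres (q : HeightOneSpectrum B) : (ofPrime k F' q).restrict F = P := by
    rw [restrict_eq_iff]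
    intro f hf
    rw [mem_ring_iff, ofPrime_valuation]
    have : algebraMap F F' f = algebraMap B F' (algebraMap P.ring B ⟨f, hf⟩) := by
      rw [← IsScalarTower.algebraMap_apply P.ring B F',
        IsScalarTower.algebraMap_apply P.ring F F']; rfl
    rw [this]
    exact q.valuation_le_one _
  have hof (P' : Place k F') (h : P'.restrict F = P) : ∃ q, P' = ofPrime k F' (B := B) q := by
    apply exists_eq_ofPrime
    intro b
    rw [restrict_eq_iff] at h
    obtain ⟨g, hg, hb⟩ := Algebra.IsIntegral.isIntegral (R := P.ring) b
    let φ : P.ring →+* P'.valuation.valuationSubring :=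
      ((algebraMap F F').comp P.ring.subtype).codRestrict P'.valuation.valuationSubring.toSubring
        fun f => P'.mem_ring_iff.1 (h f f.2)
    rw [← valuationSubring_valuation]
    have : IsIntegral P'.valuation.valuationSubring (algebraMap B F' b) := by
      refine ⟨g.map φ, hg.map φ, ?_⟩
      rw [Polynomial.eval₂_map]
      have h2 : (algebraMap P'.valuation.valuationSubring F').comp φ =
          (algebraMap B F').comp (algebraMap P.ring B) := by
        rw [← IsScalarTower.algebraMap_eq P.ring B F', IsScalarTower.algebraMap_eq P.ring F F']
        rfl
      rw [h2, ← Polynomial.hom_eval₂, hb, map_zero]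
    obtain ⟨y, hy⟩ := IsIntegrallyClosed.isIntegral_iff.1 this
    rw [← hy]
    exact y.2
  have hdeg (q : HeightOneSpectrum B) :
      (ofPrime k F' q).degree = P.degree * p.inertiaDeg' q.asIdeal := by
    have := hlies q
    rw [ofPrime_degree, Ideal.inertiaDeg'_algebraMap]
    have : IsScalarTower k (P.ring ⧸ p) (B ⧸ q.asIdeal) := by
      refine IsScalarTower.of_algebraMap_eq (R := k) (S := P.ring ⧸ p) (A := B ⧸ q.asIdeal) fun c => ?_
      change Ideal.Quotient.mk q.asIdeal (algebraMap k B c) =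
        Ideal.Quotient.mk q.asIdeal (algebraMap P.ring B (algebraMap k P.ring c))
      rw [← IsScalarTower.algebraMap_apply k P.ring B]
    let _ : Field (P.ring ⧸ p) := Ideal.Quotient.field p
    exact (Module.finrank_mul_finrank k (P.ring ⧸ p) (B ⧸ q.asIdeal)).symm
  have hval (q : HeightOneSpectrum B) (f : F) : (ofPrime k F' q).valuation (algebraMap F F' f) =
      P.valuation f ^ (p.ramificationIdx' q.asIdeal) := by
    have h1 : q.asIdeal.LiesOver (IsDiscreteValuationRing.maximalIdeal P.ring).asIdeal := hlies q
    rw [ofPrime_valuation]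
    exact (HeightOneSpectrum.valuation_liesOver F'
      (IsDiscreteValuationRing.maximalIdeal P.ring) q f).symm
  have hepos (q : HeightOneSpectrum B) : 0 < p.ramificationIdx' q.asIdeal := by
    have := hlies q
    exact Nat.pos_of_ne_zero (Ideal.IsDedekindDomain.ramificationIdx'_ne_zero_of_liesOver _ hp0)
  refine ⟨fun P' hP' => ?_, ?_⟩
  · obtain ⟨q, rfl⟩ := hof P' hP'
    exact ⟨⟨_, hdeg q⟩, _, hepos q, hval q⟩
  have hprime (I : Ideal B) (hI : I ∈ IsDedekindDomain.primesOverFinset p B) : I.IsPrime ∧ I ≠ ⊥ := by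
    rw [IsDedekindDomain.mem_primesOverFinset_iff hp0] at hI
    obtain ⟨h1, h2⟩ := hI
    exact ⟨h1, Ideal.ne_bot_of_liesOver_of_ne_bot hp0 I⟩
  let ι : {I // I ∈ IsDedekindDomain.primesOverFinset p B} → HeightOneSpectrum B := fun I =>
    ⟨I.1, (hprime _ I.2).1, (hprime _ I.2).2⟩
  have hι : Function.Injective ι := fun I J h => Subtype.ext (congrArg HeightOneSpectrum.asIdeal h)
  have hinj2 : Function.Injective fun I => ofPrime k F' (ι I) := ofPrime_injective.comp hι
  refine ⟨(IsDedekindDomain.primesOverFinset p B).attach.map ⟨_, hinj2⟩, ?_, ?_, ?_⟩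
  · intro P'
    rw [Finset.mem_map]
    constructor
    · rintro ⟨I, -, rfl⟩
      exact hres _
    · intro h
      obtain ⟨q, rfl⟩ := hof P' h
      refine ⟨⟨q.asIdeal, ?_⟩, Finset.mem_attach _ _, rfl⟩
      rw [IsDedekindDomain.mem_primesOverFinset_iff hp0]
      exact ⟨q.isPrime, hlies q⟩
  · intro e he
    rw [Finset.sum_map, ← Ideal.sum_ramification_inertia B F F' hp0, Finset.sum_mul,
      ← Finset.sum_attach (IsDedekindDomain.primesOverFinset p B)]
    refine Finset.sum_congr rfl fun I hI => ?_
    have h1 := he _ (Finset.mem_map_of_mem ⟨_, hinj2⟩ hI)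
    have h2 : e (ofPrime k F' (ι I)) = p.ramificationIdx' (ι I).asIdeal := by
      -- An element with a simple pole at `P` already determines the exponent.
      obtain ⟨f, hf⟩ := P.exists_valuation_eq 1
      have h3 := h1 f
      have h4 := hval (ι I) f
      change (ofPrime k F' (ι I)).valuation _ = _ at h3
      rw [h4, hf, ← exp_nsmul, ← exp_nsmul, exp_inj] at h3
      simpa using h3.symm
    change e (ofPrime k F' (ι I)) * (ofPrime k F' (ι I)).degree = _
    rw [h2, hdeg]
    change _ = p.ramificationIdx' (ι I).asIdeal * p.inertiaDeg' (ι I).asIdeal * _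
    ring
  · intro hP P' hP'
    rw [Finset.mem_map] at hP'
    obtain ⟨I, -, rfl⟩ := hP'
    change 0 < (ofPrime k F' (ι I)).degree
    have := hlies (ι I)
    rw [hdeg]
    exact Nat.mul_pos hP (Ideal.inertiaDeg'_pos p (ι I).asIdeal)

end FundamentalIdentity

section Fiber

variable {k F F' : Type*} [Field k] [Field F] [Field F'] [Algebra k F] [Algebra k F']
  [Algebra F F'] [IsScalarTower k F F'] [FiniteDimensional F F'] [Algebra.IsSeparable F F']

/-- Separability makes the integral closure of `P.ring` in `F'` finite over `P.ring`, so it can play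
the role of `B`. -/
theorem exists_fiber (P : Place k F) :
    (∀ P' : Place k F', P'.restrict F = P → P.degree ∣ P'.degree ∧
      ∃ e : ℕ, 0 < e ∧ ∀ f : F, P'.valuation (algebraMap F F' f) = P.valuation f ^ e) ∧
    ∃ T : Finset (Place k F'), (∀ P' : Place k F', P' ∈ T ↔ P'.restrict F = P) ∧
      (∀ e : Place k F' → ℕ, (∀ P' ∈ T, ∀ f : F,
        P'.valuation (algebraMap F F' f) = P.valuation f ^ (e P')) →
        ∑ P' ∈ T, e P' * P'.degree = Module.finrank F F' * P.degree) ∧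
      (0 < P.degree → ∀ P' ∈ T, 0 < P'.degree) := by
  have : IsScalarTower P.ring F F' := inferInstance
  have : IsScalarTower k P.ring F' := IsScalarTower.of_algebraMap_eq fun c => by
    rw [IsScalarTower.algebraMap_apply k F F']; rfl
  have : IsDedekindDomain (integralClosure P.ring F') :=
    integralClosure.isDedekindDomain P.ring F F'
  have : IsFractionRing (integralClosure P.ring F') F' :=
    integralClosure.isFractionRing_of_finite_extension F F'
  have : Module.Finite P.ring (integralClosure P.ring F') := IsIntegralClosure.finite P.ring F F' _
  exact exists_fiber_of_dedekind (integralClosure P.ring F') P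

variable (F) in
/-- The ramification index of a place over its restriction. -/
def ramIdx (P' : Place k F') : ℕ := ((exists_fiber (P'.restrict F)).1 P' rfl).2.choose

theorem ramIdx_pos (P' : Place k F') : 0 < P'.ramIdx F :=
  ((exists_fiber (P'.restrict F)).1 P' rfl).2.choose_spec.1

theorem valuation_algebraMap_eq_pow (P' : Place k F') (f : F) :
    P'.valuation (algebraMap F F' f) = (P'.restrict F).valuation f ^ P'.ramIdx F :=
  ((exists_fiber (P'.restrict F)).1 P' rfl).2.choose_spec.2 f

theorem degree_restrict_dvd (P' : Place k F') : (P'.restrict F).degree ∣ P'.degree :=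
  ((exists_fiber (P'.restrict F)).1 P' rfl).1

variable (F') (P : Place k F) in
/-- The finite set of places above a given place. -/
def fiber : Finset (Place k F') := (exists_fiber P).2.choose

@[simp] theorem mem_fiber {P : Place k F} {P' : Place k F'} :
    P' ∈ P.fiber F' ↔ P'.restrict F = P := (exists_fiber P).2.choose_spec.1 P'

theorem sum_ramIdx_mul_degree (P : Place k F) :
    ∑ P' ∈ P.fiber F', P'.ramIdx F * P'.degree = Module.finrank F F' * P.degree :=
  (exists_fiber P).2.choose_spec.2.1 _ fun P' hP' f => by
    have h : P'.restrict F = P := mem_fiber.1 hP'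
    rw [valuation_algebraMap_eq_pow, h]

theorem degree_pos_of_restrict (P' : Place k F') (h : 0 < (P'.restrict F).degree) :
    0 < P'.degree :=
  (exists_fiber (P'.restrict F)).2.choose_spec.2.2 h P' (mem_fiber.2 rfl)

end Fiber

end Place

theorem WithZero.lt_exp_iff_le_exp_sub_one {z : WithZero (Multiplicative ℤ)} {n : ℤ} :
    z < exp n ↔ z ≤ exp (n - 1) := by
  rcases eq_or_ne z 0 with rfl | hz
  · simp
  · rw [← exp_log hz, exp_lt_exp, exp_le_exp]; omega

theorem WithZero.lt_one_iff_le_exp {z : WithZero (Multiplicative ℤ)} :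
    z < 1 ↔ z ≤ exp (-1 : ℤ) := by
  rw [← exp_zero, lt_exp_iff_le_exp_sub_one]; simp

theorem WithZero.mul_le_exp {z w : WithZero (Multiplicative ℤ)} {m n : ℤ} (hz : z ≤ exp m)
    (hw : w ≤ exp n) : z * w ≤ exp (m + n) := by
  rw [exp_add]; exact mul_le_mul' hz hw

theorem WithZero.mul_exp_le_iff {z : WithZero (Multiplicative ℤ)} {m n : ℤ} :
    z * exp m ≤ exp n ↔ z ≤ exp (n - m) := by
  rcases eq_or_ne z 0 with rfl | hz
  · simp
  · rw [← exp_log hz, ← exp_add, exp_le_exp, exp_le_exp]; omega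

/-! ### Divisors -/

namespace CurveDivisor

variable {k F : Type*} [Field k] [Field F] [Algebra k F]

theorem deg_add (D E : CurveDivisor k F) : deg (D + E) = deg D + deg E :=
  Finsupp.sum_add_index' (fun _ => by simp) fun _ _ _ => by ring

theorem deg_zero : deg (0 : CurveDivisor k F) = 0 := Finsupp.sum_zero_index

theorem deg_sub (D E : CurveDivisor k F) : deg (D - E) = deg D - deg E := by
  rw [eq_sub_iff_add_eq, ← deg_add, sub_add_cancel]

theorem deg_single (P : Place k F) (n : ℤ) :
    deg (Finsupp.single P n : CurveDivisor k F) = n * P.degree :=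
  Finsupp.sum_single_index (by simp)

theorem le_induction {D : CurveDivisor k F} {p : CurveDivisor k F → Prop} (h0 : p D)
    (hs : ∀ D₁ (P : Place k F), D ≤ D₁ → p D₁ → p (D₁ + Finsupp.single P 1)) :
    ∀ D₁, D ≤ D₁ → p D₁ := by
  classical
  have key : ∀ s : Multiset (Place k F),
      0 ≤ (Multiset.toFinsupp s).mapRange (Nat.cast : ℕ → ℤ) rfl ∧
        p (D + (Multiset.toFinsupp s).mapRange (Nat.cast : ℕ → ℤ) rfl) := by
    intro s
    refine ⟨fun P => by simp, ?_⟩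
    induction s using Multiset.induction with
    | empty => simpa using h0
    | cons a s ih =>
      have h1 : D + (Multiset.toFinsupp (a ::ₘ s)).mapRange (Nat.cast : ℕ → ℤ) rfl =
          D + (Multiset.toFinsupp s).mapRange (Nat.cast : ℕ → ℤ) rfl + Finsupp.single a 1 := by
        ext P
        by_cases h : P = a
        · subst h; simp [add_assoc]
        · simp [Multiset.count_cons_of_ne h, Ne.symm h]
      rw [h1]
      exact hs _ a (le_add_of_nonneg_right fun P => by simp) ih
  intro D₁ h
  have := (key (Finsupp.toMultiset ((D₁ - D).mapRange Int.toNat rfl))).2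
  convert this
  ext P
  have := h P
  simp only [Finsupp.add_apply, Finsupp.mapRange_apply, Multiset.toFinsupp_apply,
    Finsupp.count_toMultiset, Finsupp.sub_apply]
  omega

end CurveDivisor

/-! ### Riemann's theorem and strong approximation -/

section RiemannRoch

variable {k F : Type*} [Field k] [Field F] [Algebra k F]

theorem mem_riemannRochSpace {D : CurveDivisor k F} {f : F} :
    f ∈ riemannRochSpace D ↔ ∀ P : Place k F, P.valuation f ≤ exp (D P) := Iff.rfl

theorem riemannRochSpace_mono {D E : CurveDivisor k F} (h : D ≤ E) :
    riemannRochSpace D ≤ riemannRochSpace E := fun _ hf P =>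
  (hf P).trans (exp_le_exp.2 (h P))

/-- The map is `f ↦ (t f mod P)` with `t` of order `D(P) + 1`. The last two clauses say that its
value records the leading coefficient at `P`, which translates surjectivity into approximation and
back. -/
theorem exists_residueMap (D : CurveDivisor k F) (P : Place k F) :
    ∃ φ : riemannRochSpace (D + Finsupp.single P 1) →ₗ[k] P.residueField,
      (∀ f, φ f = 0 ↔ (f : F) ∈ riemannRochSpace D) ∧
      (∀ h : F, P.valuation h ≤ exp (D P + 1) → ∃ r : P.residueField, ∀ f, φ f = r →
        P.valuation ((f : F) - h) ≤ exp (D P)) ∧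
      ∀ r : P.residueField, ∃ h : F, P.valuation h ≤ exp (D P + 1) ∧
        ∀ f : riemannRochSpace (D + Finsupp.single P 1),
          P.valuation ((f : F) - h) ≤ exp (D P) → φ f = r := by
  obtain ⟨t, ht⟩ := P.exists_valuation_eq (-(D P + 1))
  have hmem (h : F) (hh : P.valuation h ≤ exp (D P + 1)) : t * h ∈ P.ring := by
    rw [P.mem_ring_iff, map_mul, ht, mul_comm, ← exp_zero, mul_exp_le_iff]
    simpa using hh
  have hfmem (f : riemannRochSpace (D + Finsupp.single P 1)) :
      P.valuation (f : F) ≤ exp (D P + 1) := by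
    simpa using f.2 P
  have hlt (h : F) : P.valuation (t * h) < 1 ↔ P.valuation h ≤ exp (D P) := by
    rw [lt_one_iff_le_exp, map_mul, ht, mul_comm, mul_exp_le_iff]
    rw [show (-1 : ℤ) - -(D P + 1) = D P by ring]
  let ψ : riemannRochSpace (D + Finsupp.single P 1) →ₗ[k] P.ring :=
    { toFun := fun f => ⟨t * f, hmem f (hfmem f)⟩
      map_add' := fun f g => Subtype.ext (by simp [mul_add])
      map_smul' := fun c f => by
        rw [RingHom.id_apply, Algebra.smul_def c (⟨t * f, _⟩ : P.ring)]
        refine Subtype.ext ?_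
        change t * (c • (f : F)) = algebraMap k F c * (t * f)
        rw [Algebra.smul_def]; ring }
  refine ⟨(IsScalarTower.toAlgHom k P.ring P.residueField).toLinearMap ∘ₗ ψ, ?_, ?_, ?_⟩
  · intro f
    change IsLocalRing.residue P.ring (ψ f) = 0 ↔ _
    rw [P.residue_eq_zero_iff]
    change P.valuation (t * f) < 1 ↔ _
    rw [hlt]
    constructor
    · intro h Q
      by_cases hQ : Q = P
      · rwa [hQ]
      · simpa [Finsupp.single_apply, Ne.symm hQ] using f.2 Q
    · exact fun h => h P
  · intro h hh
    refine ⟨IsLocalRing.residue P.ring ⟨t * h, hmem h hh⟩, fun f hf => ?_⟩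
    change IsLocalRing.residue P.ring (ψ f) = _ at hf
    rw [P.residue_eq_iff] at hf
    change P.valuation (t * f - t * h) < 1 at hf
    rwa [← mul_sub, hlt] at hf
  · intro r
    obtain ⟨s, rfl⟩ := IsLocalRing.residue_surjective r
    have ht0 : t ≠ 0 := by rintro rfl; simp at ht
    have hs : t * (t⁻¹ * s) = s := by field_simp
    refine ⟨t⁻¹ * s, ?_, fun f hf => ?_⟩
    · rw [map_mul, map_inv₀, ht, ← exp_neg, neg_neg]
      exact mul_le_of_le_one_right' (P.mem_ring_iff.1 s.2)
    · change IsLocalRing.residue P.ring (ψ f) = _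
      rw [P.residue_eq_iff]
      change P.valuation (t * f - s) < 1
      rwa [← hs, ← mul_sub, hlt]

theorem ker_eq_comap_riemannRochSpace {D : CurveDivisor k F} {P : Place k F}
    {φ : riemannRochSpace (D + Finsupp.single P 1) →ₗ[k] P.residueField}
    (hφ : ∀ f, φ f = 0 ↔ (f : F) ∈ riemannRochSpace D) :
    LinearMap.ker φ = (riemannRochSpace D).comap (riemannRochSpace _).subtype := by
  ext f
  rw [LinearMap.mem_ker, hφ]; rfl

theorem le_add_single (D : CurveDivisor k F) (P : Place k F) : D ≤ D + Finsupp.single P 1 :=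
  le_add_of_nonneg_right (Finsupp.single_nonneg.2 zero_le_one)

theorem finrank_range_add_finrank {D : CurveDivisor k F} {P : Place k F} (hP : 0 < P.degree)
    [FiniteDimensional k (riemannRochSpace D)]
    {φ : riemannRochSpace (D + Finsupp.single P 1) →ₗ[k] P.residueField}
    (hφ : ∀ f, φ f = 0 ↔ (f : F) ∈ riemannRochSpace D) :
    FiniteDimensional k (riemannRochSpace (D + Finsupp.single P 1)) ∧
    Module.finrank k (LinearMap.range φ) + Module.finrank k (riemannRochSpace D) =
      Module.finrank k (riemannRochSpace (D + Finsupp.single P 1)) := by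
  have e : LinearMap.ker φ ≃ₗ[k] riemannRochSpace D :=
    (LinearEquiv.ofEq _ _ (ker_eq_comap_riemannRochSpace hφ)).trans
      (Submodule.comapSubtypeEquivOfLe (riemannRochSpace_mono (le_add_single D P)))
  have h1 : FiniteDimensional k P.residueField := FiniteDimensional.of_finrank_pos hP
  have h2 : FiniteDimensional k (LinearMap.ker φ) := Module.Finite.equiv e.symm
  have : FiniteDimensional k (_ ⧸ LinearMap.ker φ) := Module.Finite.equiv φ.quotKerEquivRange.symm
  have h3 : FiniteDimensional k (riemannRochSpace (D + Finsupp.single P 1)) :=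
    Module.Finite.of_submodule_quotient (LinearMap.ker φ)
  refine ⟨h3, ?_⟩
  rw [← e.finrank_eq]
  exact φ.finrank_range_add_finrank_ker

theorem finiteDimensional_of_le (hdeg : ∀ P : Place k F, 0 < P.degree) {D E : CurveDivisor k F}
    (h : D ≤ E) [FiniteDimensional k (riemannRochSpace D)] :
    FiniteDimensional k (riemannRochSpace E) := by
  refine CurveDivisor.le_induction (p := fun E => FiniteDimensional k (riemannRochSpace E))
    inferInstance (fun D₁ P _ h1 => ?_) E h
  obtain ⟨φ, hφ, -⟩ := exists_residueMap D₁ P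
  exact (finrank_range_add_finrank (hdeg P) hφ).1

theorem finiteDimensional_of_ge {D E : CurveDivisor k F}
    (h : D ≤ E) [FiniteDimensional k (riemannRochSpace E)] :
    FiniteDimensional k (riemannRochSpace D) :=
  Submodule.finiteDimensional_of_le (riemannRochSpace_mono h)

/-- `deg D - dim L(D) + 1` is monotone in `D`. -/
theorem deg_sub_finrank_mono (hdeg : ∀ P : Place k F, 0 < P.degree) {D E : CurveDivisor k F}
    (h : D ≤ E) [FiniteDimensional k (riemannRochSpace D)] :
    D.deg - (Module.finrank k (riemannRochSpace D) : ℤ) + 1 ≤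
      E.deg - (Module.finrank k (riemannRochSpace E) : ℤ) + 1 := by
  refine CurveDivisor.le_induction (p := fun E =>
    D.deg - (Module.finrank k (riemannRochSpace D) : ℤ) + 1 ≤
      E.deg - (Module.finrank k (riemannRochSpace E) : ℤ) + 1)
    le_rfl (fun D₁ P hD₁ h1 => h1.trans ?_) E h
  have := finiteDimensional_of_le hdeg hD₁
  obtain ⟨φ, hφ, -⟩ := exists_residueMap D₁ P
  have h2 := (finrank_range_add_finrank (hdeg P) hφ).2
  have h3 : FiniteDimensional k P.residueField := FiniteDimensional.of_finrank_pos (hdeg P)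
  have h4 : Module.finrank k (LinearMap.range φ) ≤ P.degree := Submodule.finrank_le _
  rw [CurveDivisor.deg_add, CurveDivisor.deg_single]
  omega

variable (k F) in
/-- Riemann's theorem for `F` with genus `g`: the spaces `L(D)` are finite-dimensional and
`deg D - dim L(D) + 1` takes the constant value `g` for all large `D`. -/
structure HasGenus (g : ℤ) : Prop where
  degree_pos : ∀ P : Place k F, 0 < P.degree
  finite : ∀ D : CurveDivisor k F, FiniteDimensional k (riemannRochSpace D)
  exists_forall_ge : ∃ D₀ : CurveDivisor k F, ∀ D, D₀ ≤ D →
    D.deg - (Module.finrank k (riemannRochSpace D) : ℤ) + 1 = g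

theorem HasGenus.genus_eq {g : ℤ} (h : HasGenus k F g) : genus k F = g := by
  obtain ⟨D₀, hD₀⟩ := h.exists_forall_ge
  refine IsGreatest.csSup_eq ⟨⟨D₀, hD₀ D₀ le_rfl⟩, ?_⟩
  rintro _ ⟨D, rfl⟩
  have := h.finite D
  rw [← hD₀ (D ⊔ D₀) le_sup_right]
  exact deg_sub_finrank_mono h.degree_pos le_sup_left

/-- Strong approximation relative to the divisor `D`. -/
def StrongApprox (D : CurveDivisor k F) : Prop :=
  ∀ (P : Place k F) (h : F), ∃ f : F, P.valuation (f - h) ≤ exp (D P) ∧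
    ∀ Q, Q ≠ P → Q.valuation f ≤ exp (D Q)

theorem StrongApprox.mono {D E : CurveDivisor k F} (h : StrongApprox D) (hDE : D ≤ E) :
    StrongApprox E := by
  intro P g
  obtain ⟨f, hf, hf'⟩ := h P g
  exact ⟨f, hf.trans (exp_le_exp.2 (hDE P)), fun Q hQ => (hf' Q hQ).trans (exp_le_exp.2 (hDE Q))⟩

/-- Approximation makes every residue map above `D₀` surjective, so adding a place raises degree and
dimension by the same amount. -/
theorem hasGenus_of_strongApprox (hdeg : ∀ P : Place k F, 0 < P.degree) {D₀ : CurveDivisor k F}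
    [FiniteDimensional k (riemannRochSpace D₀)] (h : StrongApprox D₀) :
    HasGenus k F (D₀.deg - (Module.finrank k (riemannRochSpace D₀) : ℤ) + 1) where
  degree_pos := hdeg
  finite D := by
    have := finiteDimensional_of_le hdeg (le_sup_right : D₀ ≤ D ⊔ D₀)
    exact finiteDimensional_of_ge (le_sup_left : D ≤ D ⊔ D₀)
  exists_forall_ge := by
    refine ⟨D₀, CurveDivisor.le_induction rfl fun D P hD ih => ?_⟩
    rw [← ih]
    have := finiteDimensional_of_le hdeg hD
    obtain ⟨φ, hφ, -, hφ'⟩ := exists_residueMap D P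
    have h2 := (finrank_range_add_finrank (hdeg P) hφ).2
    have hsurj : LinearMap.range φ = ⊤ := by
      rw [eq_top_iff]
      rintro r -
      obtain ⟨b, hb, hr⟩ := hφ' r
      obtain ⟨f, hf, hf'⟩ := h.mono hD P b
      refine ⟨⟨f, fun Q => ?_⟩, hr _ hf⟩
      by_cases hQ : Q = P
      · subst hQ
        rw [← sub_add_cancel f b]
        refine (Q.valuation.map_add _ _).trans (max_le (hf.trans ?_) ?_)
        · simp [-exp_add]
        · simpa [-exp_add] using hb
      · simpa [Finsupp.single_apply, Ne.symm hQ] using hf' Q hQ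
    rw [hsurj, finrank_top] at h2
    rw [CurveDivisor.deg_add, CurveDivisor.deg_single]
    change P.degree + _ = _ at h2
    omega

/-- The converse direction: constancy of `deg D - dim L(D)` forces the residue maps to be
surjective, so the leading term of a pole at `P` can be removed by a function controlled everywhere
else. -/
theorem HasGenus.exists_strongApprox {g : ℤ} (h : HasGenus k F g) :
    ∃ D₀ : CurveDivisor k F, StrongApprox D₀ ∧ ∀ D, D₀ ≤ D →
      D.deg - (Module.finrank k (riemannRochSpace D) : ℤ) + 1 = g := by
  obtain ⟨D, hD⟩ := h.exists_forall_ge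
  refine ⟨D, ?_, hD⟩
  have step (E : CurveDivisor k F) (hE : D ≤ E) (P : Place k F) (b : F)
      (hb : P.valuation b ≤ exp (E P + 1)) :
      ∃ f ∈ riemannRochSpace (E + Finsupp.single P 1), P.valuation (f - b) ≤ exp (E P) := by
    obtain ⟨φ, hφ, hφ', -⟩ := exists_residueMap E P
    have := h.finite E
    have h1 : FiniteDimensional k P.residueField := FiniteDimensional.of_finrank_pos (h.degree_pos P)
    have h2 := (finrank_range_add_finrank (h.degree_pos P) hφ).2
    have h3 := hD E hE
    have h4 := hD _ (hE.trans (le_add_single E P))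
    rw [CurveDivisor.deg_add, CurveDivisor.deg_single] at h4
    have h5 : Module.finrank k (LinearMap.range φ) = Module.finrank k P.residueField := by
      change _ = P.degree
      omega
    have h6 := Submodule.eq_top_of_finrank_eq h5
    obtain ⟨r, hr⟩ := hφ' b hb
    obtain ⟨f, hf⟩ : r ∈ LinearMap.range φ := h6 ▸ Submodule.mem_top
    exact ⟨f, f.2, hr f hf⟩
  intro P b
  -- Here `m` bounds the excess of the pole order of `b` over `D P`; each step lowers it by one.
  have key : ∀ (m : ℕ) (b : F), P.valuation b ≤ exp (D P + m) → ∃ f : F,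
      P.valuation (f - b) ≤ exp (D P) ∧ ∀ Q, Q ≠ P → Q.valuation f ≤ exp (D Q) := by
    intro m
    induction m with
    | zero => exact fun b hb => ⟨0, by simpa using hb, by simp⟩
    | succ m ih =>
      intro b hb
      obtain ⟨f, hf, hfb⟩ := step (D + Finsupp.single P (m : ℤ))
        (le_add_of_nonneg_right (Finsupp.single_nonneg.2 (by positivity))) P b
        (by simpa [add_assoc] using hb)
      obtain ⟨f', hf', hf''⟩ := ih (b - f) (by
        rw [Valuation.map_sub_swap]; simpa using hfb)
      refine ⟨f + f', ?_, fun Q hQ => (Q.valuation.map_add _ _).trans (max_le ?_ (hf'' Q hQ))⟩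
      · rwa [show f + f' - b = f' - (b - f) by ring]
      · simpa [Finsupp.single_apply, Ne.symm hQ] using hf Q
  rcases eq_or_ne b 0 with rfl | hb
  · exact ⟨0, by simp, by simp⟩
  · obtain ⟨n, hn⟩ := P.exists_eq_exp hb
    exact key (n - D P).toNat b (by rw [hn, exp_le_exp]; omega)

end RiemannRoch

namespace Place

section Residue

variable {k F F' : Type*} [Field k] [Field F] [Field F'] [Algebra k F] [Algebra k F']
  [Algebra F F'] [IsScalarTower k F F'] [FiniteDimensional F F'] [Algebra.IsSeparable F F']

theorem degree_restrict_le (P' : Place k F') (h : 0 < (P'.restrict F).degree) :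
    (P'.restrict F).degree ≤ P'.degree :=
  Nat.le_of_dvd (P'.degree_pos_of_restrict h) P'.degree_restrict_dvd

theorem valuation_algebraMap_lt_one_iff (P' : Place k F') (f : F) :
    P'.valuation (algebraMap F F' f) < 1 ↔ (P'.restrict F).valuation f < 1 := by
  rw [valuation_algebraMap_eq_pow, pow_lt_one_iff_of_nonneg zero_le (P'.ramIdx_pos).ne']

theorem valuation_algebraMap_le_one_iff (P' : Place k F') (f : F) :
    P'.valuation (algebraMap F F' f) ≤ 1 ↔ (P'.restrict F).valuation f ≤ 1 := by
  rw [valuation_algebraMap_eq_pow, pow_le_one_iff_of_nonneg zero_le (P'.ramIdx_pos).ne']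

/-- With equal degrees the embedding of residue fields is an isomorphism by dimension. -/
theorem exists_residue_lift (P' : Place k F') (h0 : 0 < (P'.restrict F).degree)
    (hd : P'.degree = (P'.restrict F).degree) {z : F'} (hz : P'.valuation z ≤ 1) :
    ∃ c : F, (P'.restrict F).valuation c ≤ 1 ∧ P'.valuation (z - algebraMap F F' c) < 1 := by
  set P := P'.restrict F with hP
  have hmem (f : P.ring) : algebraMap F F' (f : F) ∈ P'.ring :=
    (mem_restrict_ring P' (f : F)).1 f.2
  let φ : P.ring →ₐ[k] P'.ring :=
    { ((algebraMap F F').comp P.ring.subtype).codRestrict P'.ring.toSubring hmem with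
      commutes' := fun c => Subtype.ext (IsScalarTower.algebraMap_apply k F F' c).symm }
  let ψ : P.ring →ₐ[k] P'.residueField := (IsScalarTower.toAlgHom k P'.ring P'.residueField).comp φ
  have hψ (f : P.ring) (hf : f ∈ IsLocalRing.maximalIdeal P.ring) : ψ f = 0 := by
    change IsLocalRing.residue P'.ring (φ f) = 0
    rw [residue_eq_zero_iff]
    exact (valuation_algebraMap_lt_one_iff P' (f : F)).2 ((mem_maximalIdeal_iff _ _).1 hf)
  let χ : P.residueField →ₐ[k] P'.residueField :=
    Ideal.Quotient.liftₐ (IsLocalRing.maximalIdeal P.ring) ψ hψ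
  have h1 : FiniteDimensional k P'.residueField := FiniteDimensional.of_finrank_pos (h0.trans_eq hd.symm)
  have h2 : FiniteDimensional k P.residueField := FiniteDimensional.of_finrank_pos h0
  have h3 : Function.Surjective χ.toLinearMap :=
    (LinearMap.injective_iff_surjective_of_finrank_eq_finrank hd.symm).1 χ.toRingHom.injective
  obtain ⟨r, hr⟩ := h3 (IsLocalRing.residue P'.ring ⟨z, P'.mem_ring_iff.2 hz⟩)
  obtain ⟨c, rfl⟩ := IsLocalRing.residue_surjective r
  have hc : IsLocalRing.residue P'.ring (φ c) =
    IsLocalRing.residue P'.ring ⟨z, P'.mem_ring_iff.2 hz⟩ := hr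
  refine ⟨c, P.mem_ring_iff.1 c.2, ?_⟩
  rw [residue_eq_iff] at hc
  rw [Valuation.map_sub_swap]
  exact hc

end Residue

end Place

/-! ### Quadratic Artin-Schreier extensions and their local behaviour -/

/-- `F'` is the quadratic extension of `F`, in characteristic two, generated by a root `y` of the
Artin-Schreier equation `y² + y = u`. -/
structure IsArtinSchreier {F F' : Type*} [Field F] [Field F'] [Algebra F F'] (y : F') (u : F) :
    Prop where
  two_eq_zero : (2 : F) = 0
  eq : y ^ 2 + y = algebraMap F F' u
  ne_algebraMap : ∀ a, y ≠ algebraMap F F' a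
  span : ∀ z, ∃ a b, z = algebraMap F F' a + algebraMap F F' b * y

namespace IsArtinSchreier

section Field

variable {F F' : Type*} [Field F] [Field F'] [Algebra F F'] {y : F'} {u : F}
  (h : IsArtinSchreier y u)
include h

theorem two_eq_zero' : (2 : F') = 0 := by
  rw [← map_ofNat (algebraMap F F') 2, h.two_eq_zero, map_zero]

theorem coeff_unique {a b a' b' : F} (he : algebraMap F F' a + algebraMap F F' b * y =
    algebraMap F F' a' + algebraMap F F' b' * y) : a = a' ∧ b = b' := by
  have hb : b = b' := by
    by_contra hb
    have hb' : algebraMap F F' b - algebraMap F F' b' ≠ 0 := by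
      rw [← map_sub]; simpa [sub_eq_zero] using hb
    refine h.ne_algebraMap ((a' - a) / (b - b')) ?_
    rw [map_div₀, map_sub, map_sub, eq_div_iff hb']
    linear_combination he
  subst hb
  exact ⟨(algebraMap F F').injective (by linear_combination he), rfl⟩

theorem finrank_eq : Module.finrank F F' = 2 := by
  have hli : LinearIndependent F ![(1 : F'), y] := by
    rw [LinearIndependent.pair_iff]
    intro s t hst
    apply h.coeff_unique
    simpa [Algebra.smul_def] using hst
  have hs : ⊤ ≤ Submodule.span F (Set.range ![(1 : F'), y]) := by
    rintro z -
    obtain ⟨a, b, rfl⟩ := h.span z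
    rw [Matrix.range_cons, Matrix.range_cons, Matrix.range_empty, Set.union_empty]
    refine Submodule.mem_span_pair.2 ⟨a, b, ?_⟩
    simp [Algebra.smul_def]
  simpa using Module.finrank_eq_card_basis (Module.Basis.mk hli hs)

theorem finiteDimensional : FiniteDimensional F F' :=
  FiniteDimensional.of_finrank_pos (by rw [h.finrank_eq]; norm_num)

theorem isSeparable : Algebra.IsSeparable F F' := by
  have := h.finiteDimensional
  have htop : IntermediateField.adjoin F {y} = ⊤ := by
    rw [eq_top_iff]
    rintro z -
    obtain ⟨a, b, rfl⟩ := h.span z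
    exact add_mem (IntermediateField.algebraMap_mem _ a) (mul_mem
      (IntermediateField.algebraMap_mem _ b) (IntermediateField.mem_adjoin_simple_self F y))
  have hsep : IsSeparable F y := by
    have hp : (Polynomial.X ^ 2 + Polynomial.X - Polynomial.C u : Polynomial F).Separable := by
      rw [Polynomial.separable_def]
      have : Polynomial.derivative (Polynomial.X ^ 2 + Polynomial.X - Polynomial.C u) =
          (1 : Polynomial F) := by
        simpa [one_add_one_eq_two] using h.two_eq_zero
      rw [this]
      exact isCoprime_one_right
    refine hp.of_dvd (minpoly.dvd F y ?_)
    simp [h.eq]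
  have := (IntermediateField.isSeparable_adjoin_simple_iff_isSeparable F F').2 hsep
  rw [htop] at this
  exact Algebra.IsSeparable.of_algHom F (⊤ : IntermediateField F F')
    (IntermediateField.topEquiv (F := F) (E := F')).symm.toAlgHom

theorem add (w : F) : IsArtinSchreier (y + algebraMap F F' w) (u + w ^ 2 + w) where
  two_eq_zero := h.two_eq_zero
  eq := by
    simp only [map_add, map_pow]
    linear_combination h.eq + y * algebraMap F F' w * h.two_eq_zero'
  ne_algebraMap a ha := h.ne_algebraMap (a - w) (by rw [map_sub, ← ha]; ring)
  span z := by
    obtain ⟨a, b, rfl⟩ := h.span z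
    exact ⟨a - b * w, b, by simp only [map_sub, map_mul]; ring⟩

/-- The nontrivial automorphism `y ↦ y + 1` as a ring homomorphism. -/
theorem exists_conj : ∃ σ : F' ≃+* F', ∀ a b : F,
    σ (algebraMap F F' a + algebraMap F F' b * y) =
      algebraMap F F' (a + b) + algebraMap F F' b * y := by
  choose a b hab using h.span
  have hb (c d : F) : b (algebraMap F F' c + algebraMap F F' d * y) = d :=
    (h.coeff_unique (hab (algebraMap F F' c + algebraMap F F' d * y))).2.symm
  have hadd (z w : F') : b (z + w) = b z + b w := by
    conv_lhs => rw [hab z, hab w]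
    rw [show algebraMap F F' (a z) + algebraMap F F' (b z) * y +
      (algebraMap F F' (a w) + algebraMap F F' (b w) * y) =
      algebraMap F F' (a z + a w) + algebraMap F F' (b z + b w) * y by simp only [map_add]; ring, hb]
  have hmul (z w : F') : b (z * w) = a z * b w + b z * a w + b z * b w := by
    conv_lhs => rw [hab z, hab w]
    rw [show (algebraMap F F' (a z) + algebraMap F F' (b z) * y) *
      (algebraMap F F' (a w) + algebraMap F F' (b w) * y) =
      algebraMap F F' (a z * a w + b z * b w * u) +
        algebraMap F F' (a z * b w + b z * a w + b z * b w) * y by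
          simp only [map_add, map_mul]
          linear_combination algebraMap F F' (b z) * algebraMap F F' (b w) *
            (h.eq - y * h.two_eq_zero'), hb]
  have hb0 (c : F) : b (algebraMap F F' c) = 0 := by
    simpa using hb c 0
  -- Here `b z` is the `y`-coordinate of `z`; adding it sends `y` to `y + 1`, and doing so twice is
  -- the identity because `2 = 0`.
  let σ : F' →+* F' :=
    { toFun := fun z => z + algebraMap F F' (b z)
      map_one' := by
        have := hb0 1
        rw [map_one] at this
        rw [this]; simp
      map_zero' := by
        have := hb0 0
        rw [map_zero] at this
        rw [this]; simp
      map_add' := fun z w => by rw [hadd, map_add]; ring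
      map_mul' := fun z w => by
        rw [hmul]
        simp only [map_add, map_mul]
        linear_combination (-algebraMap F F' (b w)) * hab z - algebraMap F F' (b z) * hab w
          - algebraMap F F' (b z) * algebraMap F F' (b w) * y * h.two_eq_zero' }
  have hσ (z : F') : σ z = z + algebraMap F F' (b z) := rfl
  have hinv (z : F') : σ (σ z) = z := by
    rw [hσ, hσ, hadd, hb0, add_zero]
    linear_combination algebraMap F F' (b z) * h.two_eq_zero'
  refine ⟨RingEquiv.ofRingHom σ σ (by ext z; exact hinv z) (by ext z; exact hinv z),
    fun c d => ?_⟩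
  change σ _ = _
  rw [hσ, hb, map_add]; ring

end Field

section Place

variable {k F F' : Type*} [Field k] [Field F] [Field F'] [Algebra k F] [Algebra k F']
  [Algebra F F'] [IsScalarTower k F F'] [FiniteDimensional F F']
  {y : F'} {u : F} (h : IsArtinSchreier y u)
include h

theorem exists_conj_place (P' : Place k F') : ∃ P'' : Place k F',
    P''.restrict F = P'.restrict F ∧ ∀ a b : F,
      P''.valuation (algebraMap F F' a + algebraMap F F' b * y) =
        P'.valuation (algebraMap F F' (a + b) + algebraMap F F' b * y) := by
  obtain ⟨σ, hσ⟩ := h.exists_conj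
  have hσF (a : F) : σ (algebraMap F F' a) = algebraMap F F' a := by simpa using hσ a 0
  let v := P'.valuation.comap (σ : F' →+* F')
  have hvapp (z : F') : v z = P'.valuation (σ z) := rfl
  obtain ⟨π, hπ⟩ := P'.exists_uniformizer
  have hu : v (σ.symm π) = exp (-1 : ℤ) := by rw [hvapp, σ.apply_symm_apply, hπ]
  have hv : v.IsNontrivial := ⟨σ.symm π, by rw [hu]; simp, by
    rw [hu]; simp [-exp_neg]⟩
  let P'' : Place k F' := Place.ofValuation v hv fun c => by
    rw [hvapp, IsScalarTower.algebraMap_apply k F F', hσF, ← IsScalarTower.algebraMap_apply]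
    exact P'.valuation_algebraMap_le_one c
  have hP'' : P''.valuation = v := P''.valuation_eq_of_valuationSubring_eq v ⟨_, hu⟩ rfl
  refine ⟨P'', ?_, fun a b => ?_⟩
  · rw [Place.restrict_eq_iff]
    intro f hf
    rw [P''.mem_ring_iff, hP'', hvapp, hσF, ← P'.mem_ring_iff]
    exact (Place.mem_restrict_ring P' f).1 hf
  · rw [hP'', hvapp, hσ]

end Place

end IsArtinSchreier

theorem Valuation.map_sq_add_self_of_one_lt {F Γ : Type*} [Field F]
    [LinearOrderedCommGroupWithZero Γ] (v : Valuation F Γ) {z : F} (hz : 1 < v z) :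
    v (z ^ 2 + z) = v z ^ 2 := by
  rw [Valuation.map_add_eq_of_lt_left, map_pow]
  rw [map_pow, sq]
  exact lt_mul_of_one_lt_left (zero_lt_one.trans hz) hz

theorem Valuation.map_sq_add_self_le_one_iff {F Γ : Type*} [Field F]
    [LinearOrderedCommGroupWithZero Γ] (v : Valuation F Γ) {z : F} :
    v (z ^ 2 + z) ≤ 1 ↔ v z ≤ 1 := by
  constructor
  · intro h
    by_contra hz
    rw [not_le] at hz
    rw [v.map_sq_add_self_of_one_lt hz] at h
    exact absurd h (not_le.2 (one_lt_pow₀ hz two_ne_zero))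
  · intro h
    refine (v.map_add _ _).trans (max_le ?_ h)
    rw [map_pow]
    exact pow_le_one₀ zero_le h

/-- The residue field is finite of characteristic two, hence perfect. -/
theorem Place.exists_sq_sub_lt_one {k F : Type*} [Field k] [Finite k] [Field F] [Algebra k F]
    (h2 : (2 : F) = 0) (P : Place k F) (hP : 0 < P.degree) {c : F} (hc : P.valuation c ≤ 1) :
    ∃ d : F, P.valuation d ≤ 1 ∧ P.valuation (c - d ^ 2) < 1 := by
  have : FiniteDimensional k P.residueField := FiniteDimensional.of_finrank_pos hP
  have : Finite P.residueField := Module.finite_of_finite k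
  have hchar : CharP P.residueField 2 := by
    refine CharTwo.of_one_ne_zero_of_two_eq_zero one_ne_zero ?_
    have h3 : (2 : P.ring) = 0 := Subtype.ext h2
    rw [← map_ofNat (IsLocalRing.residue P.ring) 2, h3, map_zero]
  obtain ⟨r, hr⟩ := (bijective_frobenius P.residueField 2).surjective
    (IsLocalRing.residue P.ring ⟨c, P.mem_ring_iff.2 hc⟩)
  obtain ⟨d, rfl⟩ := IsLocalRing.residue_surjective r
  refine ⟨d, P.mem_ring_iff.1 d.2, ?_⟩
  rw [frobenius_def, ← map_pow, eq_comm, P.residue_eq_iff] at hr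
  exact hr

/-- The Artin-Schreier class of `u` can be represented, locally at `P`, by an element with at most
a simple pole. -/
def Place.WeakAt {k F : Type*} [Field k] [Field F] [Algebra k F] (P : Place k F) (u : F) : Prop :=
  ∃ w : F, P.valuation (u + w ^ 2 + w) ≤ exp (1 : ℤ)

open Classical in
/-- The local conductor indicator: `0` if the Artin-Schreier class of `u` is represented by an
element integral at `P`, and `1` otherwise. -/
def Place.wild {k F : Type*} [Field k] [Field F] [Algebra k F] (P : Place k F) (u : F) : ℕ :=
  if ∃ w : F, P.valuation (u + w ^ 2 + w) ≤ 1 then 0 else 1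

theorem Place.WeakAt.exists_eq_wild {k F : Type*} [Field k] [Field F] [Algebra k F]
    {P : Place k F} {u : F} (h : P.WeakAt u) :
    (∃ w, P.wild u = 0 ∧ P.valuation (u + w ^ 2 + w) ≤ 1) ∨
    (∃ w, P.wild u = 1 ∧ P.valuation (u + w ^ 2 + w) = exp (1 : ℤ)) := by
  by_cases hu : ∃ w : F, P.valuation (u + w ^ 2 + w) ≤ 1
  · obtain ⟨w, hw⟩ := hu
    exact Or.inl ⟨w, if_pos ⟨w, hw⟩, hw⟩
  · obtain ⟨w, hw⟩ := h
    refine Or.inr ⟨w, if_neg hu, hw.antisymm ?_⟩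
    by_contra hlt
    refine hu ⟨w, ?_⟩
    rw [not_le, lt_exp_iff_le_exp_sub_one] at hlt
    simpa using hlt

namespace IsArtinSchreier

variable {k F F' : Type*} [Field k] [Field F] [Field F'] [Algebra k F] [Algebra k F']
  [Algebra F F'] [IsScalarTower k F F'] [FiniteDimensional F F'] [Algebra.IsSeparable F F']
  {y : F'} {u : F} (h : IsArtinSchreier y u) {P : Place k F} (hP : 0 < P.degree)
include h hP

theorem fiber_nonempty : (P.fiber F').Nonempty := by
  by_contra hne
  rw [Finset.not_nonempty_iff_eq_empty] at hne
  have := P.sum_ramIdx_mul_degree (F' := F')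
  rw [hne, h.finrank_eq, Finset.sum_empty] at this
  omega

/-- In characteristic two `u + c² + c = (y + c)(y + c + 1)`, so one factor vanishes at each place
above `P`. Conjugation exchanges the factors, giving two places, and `∑ e · deg = 2 · deg P` leaves
no room for more. -/
theorem split {c : F} (hc : P.valuation (u + c ^ 2 + c) < 1) :
    ∃ P₀ P₁ : Place k F', P₀ ≠ P₁ ∧ (∀ P', P' ∈ P.fiber F' ↔ P' = P₀ ∨ P' = P₁) ∧
      (∀ P' ∈ P.fiber F', P'.ramIdx F = 1 ∧ P'.degree = P.degree) ∧
      P₀.valuation (y + algebraMap F F' c) < 1 ∧ P₁.valuation (y + algebraMap F F' c + 1) < 1 := by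
  classical
  have h2 := h.two_eq_zero'
  have hor (P' : Place k F') (hP' : P' ∈ P.fiber F') :
      P'.valuation (y + algebraMap F F' c) < 1 ∨ P'.valuation (y + algebraMap F F' c + 1) < 1 := by
    by_contra hcon
    rw [not_or, not_lt, not_lt] at hcon
    have h3 : P'.valuation (algebraMap F F' (u + c ^ 2 + c)) < 1 := by
      rwa [P'.valuation_algebraMap_lt_one_iff, Place.mem_fiber.1 hP']
    rw [show algebraMap F F' (u + c ^ 2 + c) =
      (y + algebraMap F F' c) * (y + algebraMap F F' c + 1) by
        simp only [map_add, map_pow]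
        linear_combination -h.eq - y * algebraMap F F' c * h2, map_mul] at h3
    exact absurd h3 (not_lt.2 (one_le_mul hcon.1 hcon.2))
  obtain ⟨P₀, P₁, h0, h1, hv0, hv1⟩ : ∃ P₀ P₁ : Place k F', P₀ ∈ P.fiber F' ∧ P₁ ∈ P.fiber F' ∧
      P₀.valuation (y + algebraMap F F' c) < 1 ∧
      P₁.valuation (y + algebraMap F F' c + 1) < 1 := by
    obtain ⟨P', hP'⟩ := h.fiber_nonempty hP
    obtain ⟨P'', hr, hP''⟩ := h.exists_conj_place P'
    have hmem : P'' ∈ P.fiber F' := by rw [Place.mem_fiber, hr]; exact Place.mem_fiber.1 hP'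
    have e1 := hP'' c 1
    have e2 := hP'' (c + 1) 1
    simp only [map_add, map_one, one_mul] at e1 e2
    rcases hor P' hP' with hv | hv
    · refine ⟨P', P'', hP', hmem, hv, ?_⟩
      rw [show y + algebraMap F F' c + 1 = algebraMap F F' c + 1 + y by ring, e2]
      rwa [show algebraMap F F' c + 1 + 1 + y = y + algebraMap F F' c by linear_combination h2]
    · refine ⟨P'', P', hmem, hP', ?_, hv⟩
      rw [add_comm, e1]
      rwa [show algebraMap F F' c + 1 + y = y + algebraMap F F' c + 1 by ring]
  have hne : P₀ ≠ P₁ := by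
    rintro rfl
    have := P₀.valuation.map_sub_lt hv1 hv0
    rw [add_sub_cancel_left, map_one] at this
    exact lt_irrefl _ this
  have hsum := P.sum_ramIdx_mul_degree (F' := F')
  rw [h.finrank_eq] at hsum
  have hle (P' : Place k F') (hP' : P' ∈ P.fiber F') : P.degree ≤ P'.degree := by
    have := Place.mem_fiber.1 hP'
    have h5 := P'.degree_restrict_le (F := F) (by rwa [this])
    rwa [this] at h5
  have hle' (P' : Place k F') (hP' : P' ∈ P.fiber F') : P.degree ≤ P'.ramIdx F * P'.degree :=
    (hle P' hP').trans (Nat.le_mul_of_pos_left _ P'.ramIdx_pos)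
  have hfib : P.fiber F' = {P₀, P₁} := by
    symm
    apply Finset.eq_of_subset_of_card_le
    · intro Q hQ
      rw [Finset.mem_insert, Finset.mem_singleton] at hQ
      rcases hQ with rfl | rfl <;> assumption
    · rw [Finset.card_pair hne]
      have := Finset.card_nsmul_le_sum _ _ _ hle'
      rw [hsum, smul_eq_mul] at this
      exact Nat.le_of_mul_le_mul_right this hP
  refine ⟨P₀, P₁, hne, fun P' => by rw [hfib]; simp, ?_, hv0, hv1⟩
  rw [hfib, Finset.sum_pair hne] at hsum
  have a0 := hle P₀ h0
  have a1 := hle P₁ h1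
  have b0 := P₀.ramIdx_pos (F := F)
  have b1 := P₁.ramIdx_pos (F := F)
  have c0 := hle' P₀ h0
  have c1 := hle' P₁ h1
  have aux : ∀ e d : ℕ, 0 < e → P.degree ≤ d → e * d = P.degree → e = 1 ∧ d = P.degree := by
    intro e d he hd hed
    have : e = 1 := by
      by_contra hne
      have : 2 ≤ e := by omega
      have := Nat.mul_le_mul this hd
      omega
    subst this
    exact ⟨rfl, by omega⟩
  intro P' hP'
  rw [hfib, Finset.mem_insert, Finset.mem_singleton] at hP'
  rcases hP' with rfl | rfl
  · exact aux _ _ b0 a0 (by omega)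
  · exact aux _ _ b1 a1 (by omega)

theorem degree_le_of_mem_fiber {P' : Place k F'} (hP' : P' ∈ P.fiber F') :
    P.degree ≤ P'.degree ∧ P'.ramIdx F * P'.degree ≤ 2 * P.degree := by
  constructor
  · have := Place.mem_fiber.1 hP'
    have h5 := P'.degree_restrict_le (F := F) (by rwa [this])
    rwa [this] at h5
  · rw [← h.finrank_eq, ← P.sum_ramIdx_mul_degree (F' := F')]
    exact Finset.single_le_sum (f := fun Q : Place k F' => Q.ramIdx F * Q.degree)
      (fun _ _ => Nat.zero_le _) hP'

/-- If `e ≥ 2`, the degrees agree, so the integral element `y + w` is congruent to some `c` in `F`.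
Then `u + w² + w + c² + c` vanishes at `P`, so `P` splits, which contradicts `e ≥ 2`. -/
theorem ramIdx_eq_one {w : F} (hw : P.valuation (u + w ^ 2 + w) ≤ 1) {P' : Place k F'}
    (hP' : P' ∈ P.fiber F') : P'.ramIdx F = 1 := by
  by_contra hne
  have hr := Place.mem_fiber.1 hP'
  obtain ⟨h1, h2⟩ := h.degree_le_of_mem_fiber hP hP'
  have h3 := P'.ramIdx_pos (F := F)
  have hd : P'.degree = P.degree := by
    have : 2 ≤ P'.ramIdx F := by omega
    have := Nat.mul_le_mul_right P'.degree this
    omega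
  have hw' := h.add w
  have hy : P'.valuation (y + algebraMap F F' w) ≤ 1 := by
    rw [← Valuation.map_sq_add_self_le_one_iff, hw'.eq, P'.valuation_algebraMap_le_one_iff, hr]
    exact hw
  obtain ⟨c, hc, hc'⟩ := P'.exists_residue_lift (F := F) (by rwa [hr]) (by rw [hd, hr]) hy
  rw [hr] at hc
  have h4 : P.valuation (u + w ^ 2 + w + c ^ 2 + c) < 1 := by
    rw [← hr, ← P'.valuation_algebraMap_lt_one_iff]
    rw [show algebraMap F F' (u + w ^ 2 + w + c ^ 2 + c) =
      (y + algebraMap F F' w - algebraMap F F' c) * (y + algebraMap F F' w + algebraMap F F' c + 1)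
      by
        rw [add_assoc, map_add, ← hw'.eq, map_add, map_pow]
        linear_combination (algebraMap F F' c + algebraMap F F' c ^ 2) * h.two_eq_zero', map_mul]
    refine mul_lt_one_of_nonneg_of_lt_one_left zero_le hc' ?_
    refine (P'.valuation.map_add _ _).trans (max_le ((P'.valuation.map_add _ _).trans
      (max_le hy ?_)) (by simp))
    rwa [P'.valuation_algebraMap_le_one_iff, hr]
  obtain ⟨_, _, _, _, h5, _⟩ := hw'.split hP h4
  exact hne (h5 P' hP').1

/-- Comparing pole orders in `(y + w)² + (y + w)` gives `2n = e`, so `e` is even, hence `2`; nothing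
is left for another place, and `n = 1`. -/
theorem ramified {w : F} (hw : P.valuation (u + w ^ 2 + w) = exp (1 : ℤ)) :
    ∃ P' : Place k F', (∀ Q, Q ∈ P.fiber F' ↔ Q = P') ∧ P'.ramIdx F = 2 ∧
      P'.degree = P.degree ∧ P'.valuation (y + algebraMap F F' w) = exp (1 : ℤ) := by
  classical
  have key (P' : Place k F') (hP' : P' ∈ P.fiber F') : P'.ramIdx F = 2 ∧
      P'.degree = P.degree ∧ P'.valuation (y + algebraMap F F' w) = exp (1 : ℤ) := by
    have hr := Place.mem_fiber.1 hP'
    obtain ⟨h1, h2⟩ := h.degree_le_of_mem_fiber hP hP'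
    have h3 := P'.ramIdx_pos (F := F)
    have h4 := congrArg P'.valuation (h.add w).eq
    rw [P'.valuation_algebraMap_eq_pow, hr, hw, ← exp_nsmul] at h4
    have hgt : 1 < P'.valuation (y + algebraMap F F' w) := by
      rw [← not_le, ← Valuation.map_sq_add_self_le_one_iff, h4, ← exp_zero, exp_le_exp]
      simpa using h3.ne'
    rw [Valuation.map_sq_add_self_of_one_lt _ hgt] at h4
    have hne : y + algebraMap F F' w ≠ 0 := by rintro h0; simp [h0] at hgt
    obtain ⟨n, hn⟩ := P'.exists_eq_exp hne
    rw [hn, ← exp_nsmul, exp_inj] at h4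
    simp only [nsmul_eq_mul, Nat.cast_ofNat, mul_one] at h4
    have h5 : P'.ramIdx F = 2 := by
      by_contra hne
      have : 3 ≤ P'.ramIdx F := by omega
      have := Nat.mul_le_mul this h1
      omega
    rw [h5] at h2 h4
    exact ⟨h5, by omega, by rw [hn]; congr 1; omega⟩
  obtain ⟨P', hP'⟩ := h.fiber_nonempty hP
  refine ⟨P', fun Q => ⟨fun hQ => ?_, fun hQ => hQ ▸ hP'⟩, key P' hP'⟩
  by_contra hne
  have hsum := P.sum_ramIdx_mul_degree (F' := F')
  have hsub : ({Q, P'} : Finset (Place k F')) ⊆ P.fiber F' := by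
    intro R hR
    rw [Finset.mem_insert, Finset.mem_singleton] at hR
    rcases hR with rfl | rfl <;> assumption
  have := Finset.sum_le_sum_of_subset (f := fun Q : Place k F' => Q.ramIdx F * Q.degree) hsub
  rw [hsum, h.finrank_eq, Finset.sum_pair hne] at this
  obtain ⟨e1, d1, _⟩ := key Q hQ
  obtain ⟨e2, d2, _⟩ := key P' hP'
  simp only [e1, d1, e2, d2] at this
  omega

/-- The degree lost by the reduced fibre is exactly the term that `P` contributes to the genus in
`hasGenus`. -/
theorem sum_degree_fiber (hw : P.WeakAt u) :
    ∑ P' ∈ P.fiber F', P'.degree + P.wild u * P.degree = 2 * P.degree := by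
  classical
  rcases hw.exists_eq_wild with ⟨w, h0, hw⟩ | ⟨w, h1, hw⟩
  · rw [h0, zero_mul, add_zero, ← h.finrank_eq, ← P.sum_ramIdx_mul_degree (F' := F')]
    exact Finset.sum_congr rfl fun P' hP' => by rw [h.ramIdx_eq_one hP hw hP', one_mul]
  · obtain ⟨P', hf, -, hd, -⟩ := h.ramified hP hw
    have : P.fiber F' = {P'} := by ext Q; rw [hf, Finset.mem_singleton]
    rw [this, Finset.sum_singleton, h1, hd]
    ring

/-- The only difficulty is a simple pole of both classes: in the ramified extension the pole of `u₂`
becomes double, and an Artin-Schreier change has to remove its leading term. -/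
theorem weakAt_algebraMap [Finite k] {u₂ : F} (hu : P.WeakAt u) (hu₂ : P.WeakAt u₂)
    {P' : Place k F'} (hP' : P' ∈ P.fiber F') : P'.WeakAt (algebraMap F F' u₂) := by
  have hr := Place.mem_fiber.1 hP'
  rcases hu.exists_eq_wild with ⟨w, -, hw⟩ | ⟨w, -, hw⟩
  · obtain ⟨w₂, hw₂⟩ := hu₂
    refine ⟨algebraMap F F' w₂, ?_⟩
    rwa [← map_pow, ← map_add, ← map_add, P'.valuation_algebraMap_eq_pow,
      h.ramIdx_eq_one hP hw hP', pow_one, hr]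
  · obtain ⟨P'', hf, he, -, hy⟩ := h.ramified hP hw
    obtain rfl := (hf P').1 hP'
    rcases hu₂.exists_eq_wild with ⟨w₂, -, hw₂⟩ | ⟨w₂, -, hw₂⟩
    · refine ⟨algebraMap F F' w₂, ?_⟩
      rw [← map_pow, ← map_add, ← map_add]
      refine ((P'.valuation_algebraMap_le_one_iff _).2 (by rwa [hr])).trans ?_
      rw [← exp_zero, exp_le_exp]; norm_num
    · set a := u + w ^ 2 + w with ha
      set b := u₂ + w₂ ^ 2 + w₂ with hb
      have ha0 : a ≠ 0 := by intro h0; rw [h0, map_zero] at hw; exact exp_ne_zero hw.symm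
      have hc : P.valuation (b / a) ≤ 1 := by rw [map_div₀, hw, hw₂]; simp
      obtain ⟨d, hd, hd'⟩ := P.exists_sq_sub_lt_one h.two_eq_zero hP hc
      set Y := y + algebraMap F F' w with hY
      have hYe : Y ^ 2 + Y = algebraMap F F' a := (h.add w).eq
      -- Since `b = (b/a)(Y² + Y)` and `d² ≡ b/a` at `P`, adding `(dY)² + dY` turns the double pole
      -- into `(b/a - d²)Y²`, which is integral at `P'`; the remaining terms are integral multiples
      -- of `Y`, which has a simple pole.
      refine ⟨algebraMap F F' w₂ + algebraMap F F' d * Y, ?_⟩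
      have hba : algebraMap F F' b = algebraMap F F' (b / a) * (Y ^ 2 + Y) := by
        rw [hYe, ← map_mul, div_mul_cancel₀ _ ha0]
      have hb' : algebraMap F F' b = algebraMap F F' u₂ + algebraMap F F' w₂ ^ 2 +
          algebraMap F F' w₂ := by simp [hb]
      rw [show algebraMap F F' u₂ + (algebraMap F F' w₂ + algebraMap F F' d * Y) ^ 2 +
        (algebraMap F F' w₂ + algebraMap F F' d * Y) =
        algebraMap F F' (b / a - d ^ 2) * Y ^ 2 + (algebraMap F F' (b / a) * Y +
          algebraMap F F' d * Y) by
          rw [map_sub, map_pow]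
          linear_combination hba - hb' + (algebraMap F F' w₂ * algebraMap F F' d * Y +
            algebraMap F F' d ^ 2 * Y ^ 2) * h.two_eq_zero']
      refine (P'.valuation.map_add _ _).trans (max_le ?_
        ((P'.valuation.map_add _ _).trans (max_le ?_ ?_)))
      · rw [map_mul, map_pow, hy, P'.valuation_algebraMap_eq_pow, he, hr, ← mul_pow]
        rw [lt_one_iff_le_exp] at hd'
        have : P.valuation (b / a - d ^ 2) * exp (1 : ℤ) ≤ 1 := by
          simpa using mul_le_exp hd' (le_refl (exp (1 : ℤ)))
        exact (pow_le_one₀ zero_le this).trans (by rw [← exp_zero, exp_le_exp]; norm_num)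
      · rw [map_mul, hy]
        exact mul_le_of_le_one_left' ((P'.valuation_algebraMap_le_one_iff _).2 (by rwa [hr]))
      · rw [map_mul, hy]
        exact mul_le_of_le_one_left' ((P'.valuation_algebraMap_le_one_iff _).2 (by rwa [hr]))

end IsArtinSchreier

/-! ### Pullback of divisors -/

namespace CurveDivisor

variable {k F F' : Type*} [Field k] [Field F] [Field F'] [Algebra k F] [Algebra k F']
  [Algebra F F'] [IsScalarTower k F F'] [FiniteDimensional F F'] [Algebra.IsSeparable F F']

variable (F') in
open Classical in
/-- The conorm (pullback) of a divisor. -/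
def conorm (D : CurveDivisor k F) : CurveDivisor k F' :=
  Finsupp.onFinset (D.support.biUnion fun P => P.fiber F')
    (fun P' => (P'.ramIdx F : ℤ) * D (P'.restrict F)) fun P' hP' => by
      rw [Finset.mem_biUnion]
      exact ⟨P'.restrict F, Finsupp.mem_support_iff.2 (right_ne_zero_of_mul hP'),
        Place.mem_fiber.2 rfl⟩

theorem conorm_apply (D : CurveDivisor k F) (P' : Place k F') :
    D.conorm F' P' = (P'.ramIdx F : ℤ) * D (P'.restrict F) := rfl

theorem deg_conorm (D : CurveDivisor k F) :
    deg (D.conorm F') = Module.finrank F F' * deg D := by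
  classical
  unfold deg conorm
  rw [Finsupp.onFinset_sum _ (fun _ => by simp), Finset.sum_biUnion, Finsupp.sum, Finset.mul_sum]
  · refine Finset.sum_congr rfl fun P _ => ?_
    have := P.sum_ramIdx_mul_degree (F' := F')
    rw [show (Module.finrank F F' : ℤ) * (D P * P.degree) =
      D P * ((Module.finrank F F' * P.degree : ℕ) : ℤ) by push_cast; ring, ← this, Nat.cast_sum,
      Finset.mul_sum]
    refine Finset.sum_congr rfl fun P' hP' => ?_
    rw [Place.mem_fiber.1 hP']
    push_cast; ring
  · intro P _ Q _ hPQ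
    rw [Function.onFun, Finset.disjoint_left]
    intro P' h1 h2
    exact hPQ ((Place.mem_fiber.1 h1).symm.trans (Place.mem_fiber.1 h2))

/-- Pullbacks are cofinal among the divisors of `F'`, so the genus can be read off from them. -/
theorem exists_le_conorm (D₁ : CurveDivisor k F) (D' : CurveDivisor k F') :
    ∃ D, D₁ ≤ D ∧ D' ≤ D.conorm F' := by
  classical
  set G : CurveDivisor k F := D'.support.sum fun P' => Finsupp.single (P'.restrict F) |D' P'| with hG
  have hG0 : 0 ≤ G := Finset.sum_nonneg fun P' _ => Finsupp.single_nonneg.2 (abs_nonneg _)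
  refine ⟨(D₁ ⊔ 0) + G, le_sup_left.trans (le_add_of_nonneg_right hG0), fun P' => ?_⟩
  have h1 : D' P' ≤ G (P'.restrict F) := by
    by_cases hP' : P' ∈ D'.support
    · have h2 : Finsupp.single (P'.restrict F) |D' P'| ≤ G :=
        Finset.single_le_sum (f := fun P' : Place k F' =>
          (Finsupp.single (P'.restrict F) |D' P'| : CurveDivisor k F))
          (fun Q _ => Finsupp.single_nonneg.2 (abs_nonneg _)) hP'
      have h3 := h2 (P'.restrict F)
      rw [Finsupp.single_eq_same] at h3
      exact (le_abs_self _).trans h3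
    · rw [Finsupp.notMem_support_iff.1 hP']
      exact hG0 _
  have h2 : 0 ≤ (D₁ ⊔ 0) (P'.restrict F) := (le_sup_right : (0 : CurveDivisor k F) ≤ D₁ ⊔ 0) _
  have h3 := hG0 (P'.restrict F)
  have h4 := P'.ramIdx_pos (F := F)
  rw [conorm_apply, Finsupp.add_apply]
  rw [Finsupp.coe_zero, Pi.zero_apply] at h3
  have h5 : (1 : ℤ) ≤ P'.ramIdx F := by exact_mod_cast h4
  nlinarith

end CurveDivisor

/-! ### Riemann-Hurwitz for Artin-Schreier extensions -/

namespace IsArtinSchreier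

section Coeff

variable {F F' : Type*} [Field F] [Field F'] [Algebra F F'] {y : F'} {u : F}
  (h : IsArtinSchreier y u)
include h

theorem exists_coeff : ∃ β : F' →ₗ[F] F, ∀ a b : F,
    β (algebraMap F F' a + algebraMap F F' b * y) = b := by
  choose a b hab using h.span
  have hb (c d : F) : b (algebraMap F F' c + algebraMap F F' d * y) = d :=
    (h.coeff_unique (hab (algebraMap F F' c + algebraMap F F' d * y))).2.symm
  refine ⟨{ toFun := b, map_add' := fun z w => ?_, map_smul' := fun c z => ?_ }, hb⟩
  · conv_lhs => rw [hab z, hab w]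
    rw [show algebraMap F F' (a z) + algebraMap F F' (b z) * y +
      (algebraMap F F' (a w) + algebraMap F F' (b w) * y) =
      algebraMap F F' (a z + a w) + algebraMap F F' (b z + b w) * y by simp only [map_add]; ring, hb]
  · conv_lhs => rw [hab z]
    rw [show c • (algebraMap F F' (a z) + algebraMap F F' (b z) * y) =
      algebraMap F F' (c * a z) + algebraMap F F' (c * b z) * y by
        simp only [map_mul, Algebra.smul_def]; ring, hb]
    rfl

end Coeff

variable {k F F' : Type*} [Field k] [Field F] [Field F'] [Algebra k F] [Algebra k F']
  [Algebra F F'] [IsScalarTower k F F'] [FiniteDimensional F F'] [Algebra.IsSeparable F F']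
  {y : F'} {u : F} (h : IsArtinSchreier y u)
include h

/-- Here `1, y` is a local integral basis. The difference of the element and its conjugate bounds
`b`; the norm `a² + ab + b²u` bounds `a`, since a larger `a` would make `a²` dominate. -/
theorem forall_fiber_le_iff_of_le_one {P : Place k F} (hP : 0 < P.degree)
    (hu : P.valuation u ≤ 1) (a b : F) (n : ℤ) :
    (∀ P' ∈ P.fiber F', P'.valuation (algebraMap F F' a + algebraMap F F' b * y) ≤
      exp ((P'.ramIdx F : ℤ) * n)) ↔ P.valuation b ≤ exp n ∧ P.valuation a ≤ exp n := by
  have he (P' : Place k F') (hP' : P' ∈ P.fiber F') : P'.ramIdx F = 1 :=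
    h.ramIdx_eq_one hP (w := 0) (by simpa using hu) hP'
  have hv (P' : Place k F') (hP' : P' ∈ P.fiber F') (f : F) :
      P'.valuation (algebraMap F F' f) = P.valuation f := by
    rw [P'.valuation_algebraMap_eq_pow, he P' hP', pow_one, Place.mem_fiber.1 hP']
  constructor
  · intro H
    obtain ⟨P', hP'⟩ := h.fiber_nonempty hP
    obtain ⟨P'', hr, hc⟩ := h.exists_conj_place P'
    have hP'' : P'' ∈ P.fiber F' := by rw [Place.mem_fiber, hr]; exact Place.mem_fiber.1 hP'
    have h1 := H P' hP'
    have h2 := H P'' hP''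
    rw [he P' hP'] at h1
    rw [he P'' hP'', hc] at h2
    simp only [Nat.cast_one, one_mul] at h1 h2
    have hb : P.valuation b ≤ exp n := by
      rw [← hv P' hP', show algebraMap F F' b =
        (algebraMap F F' (a + b) + algebraMap F F' b * y) -
          (algebraMap F F' a + algebraMap F F' b * y) by rw [map_add]; ring]
      exact (P'.valuation.map_sub _ _).trans (max_le h2 h1)
    refine ⟨hb, ?_⟩
    by_contra ha
    rw [not_le] at ha
    have hN : P.valuation (a ^ 2 + (a * b + b ^ 2 * u)) ≤ exp (n + n) := by
      rw [← hv P' hP', show algebraMap F F' (a ^ 2 + (a * b + b ^ 2 * u)) =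
        (algebraMap F F' a + algebraMap F F' b * y) *
          (algebraMap F F' (a + b) + algebraMap F F' b * y) by
          simp only [map_add, map_mul, map_pow, ← h.eq]
          linear_combination (-algebraMap F F' a * algebraMap F F' b * y) * h.two_eq_zero', map_mul]
      exact mul_le_exp h1 h2
    have hlt : P.valuation (a * b + b ^ 2 * u) < P.valuation a ^ 2 := by
      refine P.valuation.map_add_lt ?_ ?_
      · rw [map_mul, sq]
        exact mul_lt_mul_of_pos_left (hb.trans_lt ha) (exp_pos.trans ha)
      · rw [map_mul, map_pow]
        calc _ ≤ P.valuation b ^ 2 := mul_le_of_le_one_right' hu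
          _ < _ := pow_lt_pow_left₀ (hb.trans_lt ha) zero_le two_ne_zero
    rw [← map_pow] at hlt
    rw [P.valuation.map_add_eq_of_lt_left hlt, map_pow] at hN
    have : exp n ^ 2 < P.valuation a ^ 2 := pow_lt_pow_left₀ ha zero_le two_ne_zero
    rw [sq, ← exp_add] at this
    exact absurd hN (not_le.2 this)
  · rintro ⟨hb, ha⟩ P' hP'
    have hy : P'.valuation y ≤ 1 := by
      rw [← Valuation.map_sq_add_self_le_one_iff, h.eq, hv P' hP']; exact hu
    rw [he P' hP', Nat.cast_one, one_mul]
    refine (P'.valuation.map_add _ _).trans (max_le (by rwa [hv P' hP']) ?_)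
    rw [map_mul, hv P' hP']
    exact (mul_le_of_le_one_right' hy).trans hb

/-- The orders of `a` and `by` at `P'` have opposite parity, so nothing cancels. The simple pole of
`y` is half an order at `P`, which rounds up to the bound `n - 1` for `b`. -/
theorem forall_fiber_le_iff_of_eq_exp_one {P : Place k F} (hP : 0 < P.degree)
    (hu : P.valuation u = exp (1 : ℤ)) (a b : F) (n : ℤ) :
    (∀ P' ∈ P.fiber F', P'.valuation (algebraMap F F' a + algebraMap F F' b * y) ≤
      exp ((P'.ramIdx F : ℤ) * n)) ↔ P.valuation b ≤ exp (n - 1) ∧ P.valuation a ≤ exp n := by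
  obtain ⟨P', hf, he, -, hy⟩ := h.ramified hP (w := 0) (by simpa using hu)
  rw [map_zero, add_zero] at hy
  have hP' := (hf P').2 rfl
  have hv (f : F) : P'.valuation (algebraMap F F' f) = P.valuation f ^ 2 := by
    rw [P'.valuation_algebraMap_eq_pow, he, Place.mem_fiber.1 hP']
  have hmax : P'.valuation (algebraMap F F' a + algebraMap F F' b * y) =
      max (P.valuation a ^ 2) (P.valuation b ^ 2 * exp (1 : ℤ)) := by
    rcases eq_or_ne b 0 with rfl | hb
    · simp [hv]
    obtain ⟨β, hβ⟩ := P.exists_eq_exp hb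
    rw [Valuation.map_add_of_distinct_val, map_mul, hv, hv, hy]
    rw [map_mul, hv, hv, hy]
    rcases eq_or_ne a 0 with rfl | ha
    · rw [hβ]; simp
    · obtain ⟨α, hα⟩ := P.exists_eq_exp ha
      rw [hα, hβ, ← exp_nsmul, ← exp_nsmul, ← exp_add]
      intro h0
      rw [exp_inj] at h0
      simp only [nsmul_eq_mul, Nat.cast_ofNat] at h0
      omega
  have aux (c : F) (m j : ℤ) (hj : 0 ≤ j) (hj' : j < 2) :
      P.valuation c ^ 2 ≤ exp (2 * m + j) ↔ P.valuation c ≤ exp m := by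
    rcases eq_or_ne c 0 with rfl | hc
    · simp
    · obtain ⟨γ, hγ⟩ := P.exists_eq_exp hc
      rw [hγ, ← exp_nsmul, exp_le_exp, exp_le_exp]
      simp only [nsmul_eq_mul, Nat.cast_ofNat]
      omega
  have e1 := aux a n 0 le_rfl (by norm_num)
  have e2 := aux b (n - 1) 1 zero_le_one (by norm_num)
  rw [add_zero] at e1
  rw [show 2 * (n - 1) + 1 = 2 * n - 1 by ring, ← mul_exp_le_iff] at e2
  rw [← e1, ← e2]
  constructor
  · intro H
    have := H P' hP'
    rw [hmax, he, Nat.cast_ofNat, max_le_iff] at this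
    exact this.symm
  · intro H Q hQ
    rw [(hf Q).1 hQ, hmax, he, Nat.cast_ofNat, max_le_iff]
    exact H.symm

theorem forall_fiber_le_iff {P : Place k F} (hP : 0 < P.degree) {w : F}
    (hw : P.wild u = 0 ∧ P.valuation (u + w ^ 2 + w) ≤ 1 ∨
      P.wild u = 1 ∧ P.valuation (u + w ^ 2 + w) = exp (1 : ℤ)) (a b : F) (n : ℤ) :
    (∀ P' ∈ P.fiber F', P'.valuation (algebraMap F F' a + algebraMap F F' b * y) ≤
      exp ((P'.ramIdx F : ℤ) * n)) ↔
      P.valuation b ≤ exp (n - P.wild u) ∧ P.valuation (a - b * w) ≤ exp n := by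
  have hz : algebraMap F F' a + algebraMap F F' b * y =
      algebraMap F F' (a - b * w) + algebraMap F F' b * (y + algebraMap F F' w) := by
    simp only [map_sub, map_mul]; ring
  rw [hz]
  rcases hw with ⟨h0, hw⟩ | ⟨h1, hw⟩
  · rw [(h.add w).forall_fiber_le_iff_of_le_one hP hw, h0]; simp
  · rw [(h.add w).forall_fiber_le_iff_of_eq_exp_one hP hw, h1]; simp

omit h in
theorem wild_eq_zero {P : Place k F} (hu : P.valuation u ≤ 1) : P.wild u = 0 :=
  if_pos ⟨0, by simpa using hu⟩

/-- The Riemann-Hurwitz formula for a quadratic Artin-Schreier extension all of whose local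
conductors are at most `2`. -/
theorem hasGenus {g : ℤ} (hg : HasGenus k F g) (hweak : ∀ P : Place k F, P.WeakAt u)
    (S : Finset (Place k F)) (hS : ∀ P ∉ S, P.valuation u ≤ 1) :
    HasGenus k F' (2 * g - 1 + ∑ P ∈ S, (P.wild u * P.degree : ℕ)) := by
  classical
  have hdeg' (P' : Place k F') : 0 < P'.degree := P'.degree_pos_of_restrict (hg.degree_pos _)
  -- Taking `w = 0` outside `S` leaves only finitely many local conditions that are not plain bounds
  -- on `a`.
  have hw (P : Place k F) : ∃ w : F, (P ∉ S → w = 0) ∧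
      (P.wild u = 0 ∧ P.valuation (u + w ^ 2 + w) ≤ 1 ∨
      P.wild u = 1 ∧ P.valuation (u + w ^ 2 + w) = exp (1 : ℤ)) := by
    by_cases hP : P ∈ S
    · rcases (hweak P).exists_eq_wild with ⟨w, hw⟩ | ⟨w, hw⟩
      · exact ⟨w, fun h => (h hP).elim, Or.inl hw⟩
      · exact ⟨w, fun h => (h hP).elim, Or.inr hw⟩
    · exact ⟨0, fun _ => rfl, Or.inl ⟨wild_eq_zero (hS P hP), by simpa using hS P hP⟩⟩
  choose w hw0 hw using hw
  let E : CurveDivisor k F := Finsupp.onFinset S (fun P => (P.wild u : ℤ)) fun P hP => by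
    by_contra hPS
    exact hP (by rw [wild_eq_zero (hS P hPS)]; rfl)
  have hE (P : Place k F) : E P = P.wild u := rfl
  have hE0 : 0 ≤ E := fun P => by rw [hE]; simp
  have hdegE : E.deg = ∑ P ∈ S, (P.wild u * P.degree : ℕ) := by
    unfold CurveDivisor.deg
    rw [Finsupp.onFinset_sum _ (fun _ => by simp), Nat.cast_sum]
    exact Finset.sum_congr rfl fun P _ => by push_cast; rfl
  obtain ⟨β, hβ⟩ := h.exists_coeff
  have hmem (D : CurveDivisor k F) (a b : F) :
      algebraMap F F' a + algebraMap F F' b * y ∈ riemannRochSpace (D.conorm F') ↔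
        ∀ P : Place k F, P.valuation b ≤ exp ((D - E) P) ∧
          P.valuation (a - b * w P) ≤ exp (D P) := by
    rw [mem_riemannRochSpace]
    have hiff (P : Place k F) := h.forall_fiber_le_iff (hg.degree_pos P) (hw P) a b (D P)
    constructor
    · intro H P
      refine (hiff P).1 fun P' hP' => ?_
      have := H P'
      rwa [CurveDivisor.conorm_apply, Place.mem_fiber.1 hP'] at this
    · intro H P'
      exact (hiff (P'.restrict F)).2 (H _) P' (Place.mem_fiber.2 rfl)
  have hmem0 (D : CurveDivisor k F) (a : F) :
      algebraMap F F' a ∈ riemannRochSpace (D.conorm F') ↔ a ∈ riemannRochSpace D := by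
    have := hmem D a 0
    rw [map_zero, zero_mul, add_zero] at this
    rw [this, mem_riemannRochSpace]
    simp
  let B (D : CurveDivisor k F) : riemannRochSpace (D.conorm F') →ₗ[k] riemannRochSpace (D - E) :=
    ((β.restrictScalars k).comp (riemannRochSpace (D.conorm F')).subtype).codRestrict _ fun z => by
      obtain ⟨a, b, hab⟩ := h.span (z : F')
      have hz := z.2
      rw [hab, hmem] at hz
      change β (z : F') ∈ _
      rw [hab, hβ]
      exact fun P => (hz P).1
  have hB (D : CurveDivisor k F) (z) : ((B D z : riemannRochSpace (D - E)) : F) = β z := rfl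
  let A (D : CurveDivisor k F) : riemannRochSpace D →ₗ[k] riemannRochSpace (D.conorm F') :=
    ((IsScalarTower.toAlgHom k F F').toLinearMap.comp (riemannRochSpace D).subtype).codRestrict _
      fun a => (hmem0 D a).2 a.2
  have hA (D : CurveDivisor k F) (a : riemannRochSpace D) :
      ((A D a : riemannRochSpace (D.conorm F')) : F') = algebraMap F F' (a : F) := rfl
  have hAinj (D : CurveDivisor k F) : Function.Injective (A D) := fun a a' haa => by
    have := congrArg (Subtype.val) haa
    rw [hA, hA] at this
    exact Subtype.ext ((algebraMap F F').injective this)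
  have hker (D : CurveDivisor k F) : LinearMap.ker (B D) = LinearMap.range (A D) := by
    ext z
    rw [LinearMap.mem_ker, LinearMap.mem_range]
    obtain ⟨a, b, hab⟩ := h.span (z : F')
    constructor
    · intro hz
      have hz' : β (z : F') = 0 := by rw [← hB, hz]; rfl
      rw [hab, hβ] at hz'
      rw [hz', map_zero, zero_mul, add_zero] at hab
      refine ⟨⟨a, (hmem0 D a).1 (hab ▸ z.2)⟩, Subtype.ext ?_⟩
      exact hab.symm
    · rintro ⟨c, rfl⟩
      refine Subtype.ext ?_
      rw [hB, hA]
      simpa using hβ (c : F) 0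
  have hfin (D : CurveDivisor k F) : FiniteDimensional k (riemannRochSpace (D.conorm F')) := by
    have h1 := hg.finite D
    have h2 := hg.finite (D - E)
    have h3 : FiniteDimensional k (LinearMap.ker (B D)) := by
      rw [hker]; infer_instance
    have : FiniteDimensional k (_ ⧸ LinearMap.ker (B D)) :=
      Module.Finite.equiv (B D).quotKerEquivRange.symm
    exact Module.Finite.of_submodule_quotient (LinearMap.ker (B D))
  obtain ⟨D₀, hsa, hD₀⟩ := hg.exists_strongApprox
  -- This completes the exact sequence `0 → L(D) → L(conorm D) → L(D - E) → 0`: given `b`, the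
  -- element `a` must approximate `b w P` at each `P ∈ S`, and a sum of strong approximants does
  -- this.
  have hBsurj (D : CurveDivisor k F) (hD : D₀ ≤ D) : LinearMap.range (B D) = ⊤ := by
    rw [eq_top_iff]
    rintro ⟨b, hb⟩ -
    choose f hf hf' using fun P : Place k F => hsa.mono hD P (b * w P)
    let a := ∑ P ∈ S, f P
    have hab : algebraMap F F' a + algebraMap F F' b * y ∈ riemannRochSpace (D.conorm F') := by
      rw [hmem]
      refine fun P => ⟨hb P, ?_⟩
      by_cases hP : P ∈ S
      · rw [show a - b * w P = (f P - b * w P) + ∑ Q ∈ S.erase P, f Q by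
          rw [sub_add_eq_add_sub, Finset.add_sum_erase S f hP]]
        refine (P.valuation.map_add _ _).trans (max_le (hf P) ?_)
        refine P.valuation.map_sum_le fun Q hQ => hf' Q P ?_
        exact (Finset.ne_of_mem_erase hQ).symm
      · rw [hw0 P hP, mul_zero, sub_zero]
        refine P.valuation.map_sum_le fun Q hQ => hf' Q P ?_
        rintro rfl
        exact hP hQ
    refine ⟨⟨_, hab⟩, Subtype.ext ?_⟩
    rw [hB]
    exact hβ a b
  -- With `d = deg D` the count is `2d - (d + 1 - g) - (d - deg E + 1 - g) + 1 = 2g - 1 + deg E`.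
  have hval (D : CurveDivisor k F) (hD : D₀ + E ≤ D) : (D.conorm F').deg -
      (Module.finrank k (riemannRochSpace (D.conorm F')) : ℤ) + 1 =
        2 * g - 1 + ∑ P ∈ S, (P.wild u * P.degree : ℕ) := by
    have hD1 : D₀ ≤ D := (le_add_of_nonneg_right hE0).trans hD
    have hD2 : D₀ ≤ D - E := le_sub_iff_add_le.2 hD
    have := hfin D
    have r := (B D).finrank_range_add_finrank_ker
    rw [hBsurj D hD1, finrank_top, hker, LinearMap.finrank_range_of_inj (hAinj D)] at r
    have e1 := hD₀ D hD1
    have e2 := hD₀ (D - E) hD2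
    rw [CurveDivisor.deg_sub, hdegE] at e2
    rw [CurveDivisor.deg_conorm, h.finrank_eq]
    push_cast at *
    omega
  refine ⟨hdeg', fun D' => ?_, (D₀ + E).conorm F', fun D' hD' => ?_⟩
  · obtain ⟨D, -, hD⟩ := CurveDivisor.exists_le_conorm (0 : CurveDivisor k F) D'
    have := hfin D
    exact finiteDimensional_of_ge hD
  · obtain ⟨D, hD1, hD⟩ := CurveDivisor.exists_le_conorm (D₀ + E) D'
    have := hfin D
    have h1 := finiteDimensional_of_ge hD
    have h2 := hfin (D₀ + E)
    -- `D'` lies between two pullbacks with the same value, and the quantity is monotone.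
    apply le_antisymm
    · rw [← hval D hD1]
      exact deg_sub_finrank_mono hdeg' hD
    · rw [← hval (D₀ + E) le_rfl]
      exact deg_sub_finrank_mono hdeg' hD'

end IsArtinSchreier

/-! ### The rational function field -/

open Polynomial in
/-- `x` is transcendental over `k` and `F = k(x)`. -/
structure IsRationalGenerator (k : Type*) {F : Type*} [Field k] [Field F] [Algebra k F] (x : F) :
    Prop where
  transcendental : Transcendental k x
  exists_div : ∀ f : F, ∃ p q : k[X], q ≠ 0 ∧ f = aeval x p / aeval x q

namespace IsRationalGenerator

open Polynomial

section Aux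

variable {k F : Type*} [Field k] [Field F] [Algebra k F] {x : F}

theorem valuation_aeval_le_one {P : Place k F} (hP : P.valuation x ≤ 1) (q : k[X]) :
    P.valuation (aeval x q) ≤ 1 := by
  rw [aeval_eq_sum_range]
  refine P.valuation.map_sum_le fun i _ => ?_
  rw [Algebra.smul_def, map_mul, map_pow]
  exact mul_le_one' (P.valuation_algebraMap_le_one _) (pow_le_one₀ zero_le hP)

theorem valuation_aeval_le_pow {P : Place k F} (hP : 1 < P.valuation x) (q : k[X]) {n : ℕ}
    (hn : q.natDegree ≤ n) : P.valuation (aeval x q) ≤ P.valuation x ^ n := by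
  rw [aeval_eq_sum_range]
  refine P.valuation.map_sum_le fun i hi => ?_
  rw [Algebra.smul_def, map_mul, map_pow]
  rw [Finset.mem_range] at hi
  exact (mul_le_of_le_one_left' (P.valuation_algebraMap_le_one _)).trans
    (pow_le_pow_right₀ hP.le (by omega))

theorem valuation_aeval_eq_pow {P : Place k F} (hP : 1 < P.valuation x) {q : k[X]} (hq : q ≠ 0) :
    P.valuation (aeval x q) = P.valuation x ^ q.natDegree := by
  have hlead : P.valuation (aeval x (C q.leadingCoeff * X ^ q.natDegree)) =
      P.valuation x ^ q.natDegree := by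
    rw [map_mul, aeval_C, map_mul, P.valuation_algebraMap (leadingCoeff_ne_zero.2 hq), one_mul]
    simp
  rw [← eraseLead_add_C_mul_X_pow q, map_add]
  rcases eraseLead_natDegree_lt_or_eraseLead_eq_zero q with hlt | h0
  · rw [P.valuation.map_add_eq_of_lt_right, hlead, eraseLead_add_C_mul_X_pow]
    rw [hlead]
    refine (valuation_aeval_le_pow hP _ le_rfl).trans_lt (pow_lt_pow_right₀ hP hlt)
  · rw [h0, map_zero, zero_add, hlead, zero_add]
    congr 1
    rw [natDegree_C_mul_X_pow _ _ (leadingCoeff_ne_zero.2 hq)]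

theorem valuation_aeval_eq_one_of_not_dvd {P : Place k F} (hP : P.valuation x ≤ 1) {p q : k[X]}
    (hp : Irreducible p) (hpv : P.valuation (aeval x p) < 1) (hpq : ¬ p ∣ q) :
    P.valuation (aeval x q) = 1 := by
  obtain ⟨a, b, hab⟩ := (hp.coprime_iff_not_dvd.2 hpq)
  refine (valuation_aeval_le_one hP q).antisymm (not_lt.1 fun hlt => ?_)
  have h1 := congrArg (fun r => P.valuation (aeval x r)) hab
  simp only [map_add, map_mul, map_one] at h1
  refine absurd h1 (ne_of_lt (P.valuation.map_add_lt ?_ ?_))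
  · rw [map_mul]
    exact mul_lt_one_of_nonneg_of_lt_one_right (valuation_aeval_le_one hP a) zero_le hpv
  · rw [map_mul]
    exact mul_lt_one_of_nonneg_of_lt_one_right (valuation_aeval_le_one hP b) zero_le hlt

end Aux

variable {k F : Type*} [Field k] [Field F] [Algebra k F] {x : F} (hx : IsRationalGenerator k x)
include hx

theorem ne_zero : x ≠ 0 := by
  rintro rfl
  exact hx.transcendental isAlgebraic_zero

theorem aeval_ne_zero {q : k[X]} (hq : q ≠ 0) : aeval x q ≠ 0 := fun h0 =>
  hx.transcendental ⟨q, hq, h0⟩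

theorem inv : IsRationalGenerator k x⁻¹ where
  transcendental h := hx.transcendental (by simpa using h.inv)
  exists_div f := by
    obtain ⟨p, q, hq, rfl⟩ := hx.exists_div f
    have hx0 := hx.ne_zero
    refine ⟨p.reverse * X ^ q.natDegree, q.reverse * X ^ p.natDegree,
      mul_ne_zero (by simpa using hq) (pow_ne_zero _ X_ne_zero), ?_⟩
    have key (r : k[X]) : aeval x⁻¹ r.reverse = aeval x r * x⁻¹ ^ r.natDegree := by
      let _ := invertibleOfNonzero hx0
      have := eval₂_reverse_mul_pow (algebraMap k F) x r
      rw [invOf_eq_inv] at this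
      rw [aeval_def, aeval_def, ← this, mul_assoc, ← mul_pow, mul_inv_cancel₀ hx0, one_pow, mul_one]
    simp only [map_mul, map_pow, aeval_X, key]
    have hq0 := hx.aeval_ne_zero hq
    field_simp

theorem exists_place {p : k[X]} (hp : Irreducible p) : ∃ P : Place k F,
    P.valuation x ≤ 1 ∧ P.valuation (aeval x p) = exp (-1 : ℤ) ∧ P.degree = p.natDegree ∧
      ∀ Q : Place k F, Q.valuation x ≤ 1 → Q.valuation (aeval x p) < 1 → Q = P := by
  let _ : Algebra k[X] F := (aeval x).toRingHom.toAlgebra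
  have hmap (q : k[X]) : algebraMap k[X] F q = aeval x q := rfl
  have : IsScalarTower k k[X] F := IsScalarTower.of_algebraMap_eq fun c => by
    rw [hmap, algebraMap_eq, aeval_C]
  have : FaithfulSMul k[X] F := (faithfulSMul_iff_algebraMap_injective _ _).2
    ((injective_iff_map_eq_zero _).2 fun q hq => by
      by_contra h0
      exact hx.aeval_ne_zero h0 hq)
  have : IsFractionRing k[X] F := IsFractionRing.of_field _ _ fun z => by
    obtain ⟨p, q, -, hz⟩ := hx.exists_div z
    exact ⟨p, q, hz⟩
  let q : HeightOneSpectrum k[X] := ⟨Ideal.span {p}, (Ideal.span_singleton_prime hp.ne_zero).2 hp.prime,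
    by simpa using hp.ne_zero⟩
  refine ⟨Place.ofPrime k F q, ?_, ?_, ?_, ?_⟩
  · rw [Place.ofPrime_valuation, ← aeval_X (R := k) x, ← hmap]
    exact q.valuation_le_one _
  · rw [Place.ofPrime_valuation, ← hmap, q.valuation_of_algebraMap]
    exact q.intValuation_singleton hp.ne_zero rfl
  · rw [Place.ofPrime_degree]
    exact finrank_quotient_span_eq_natDegree
  · intro Q hQ hQp
    obtain ⟨q', rfl⟩ := Place.exists_eq_ofPrime (B := k[X]) Q fun b => by
      rw [Q.mem_ring_iff, hmap]; exact valuation_aeval_le_one hQ b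
    rw [Place.ofPrime_valuation, ← hmap, q'.valuation_lt_one_iff_mem] at hQp
    congr 1
    have h1 : q.asIdeal ≤ q'.asIdeal := (Ideal.span_singleton_le_iff_mem _).2 hQp
    exact HeightOneSpectrum.ext (q.isMaximal.eq_of_le q'.isPrime.ne_top h1).symm

theorem exists_irreducible {P : Place k F} (hP : P.valuation x ≤ 1) :
    ∃ p : k[X], Irreducible p ∧ P.valuation (aeval x p) < 1 := by
  by_contra hcon
  have hone (q : k[X]) (hq : q ≠ 0) : P.valuation (aeval x q) = 1 := by
    induction q using WfDvdMonoid.induction_on_irreducible with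
    | zero => exact (hq rfl).elim
    | unit u hu =>
      obtain ⟨c, hc, rfl⟩ := Polynomial.isUnit_iff.1 hu
      rw [aeval_C, P.valuation_algebraMap hc.ne_zero]
    | mul a i ha hi ih =>
      rw [map_mul, map_mul, ih ha, mul_one]
      exact (valuation_aeval_le_one hP i).antisymm (not_lt.1 fun h => hcon ⟨i, hi, h⟩)
  obtain ⟨π, hπ⟩ := P.exists_uniformizer
  obtain ⟨p, q, hq, rfl⟩ := hx.exists_div π
  rw [map_div₀, hone q hq, div_one] at hπ
  rcases eq_or_ne p 0 with rfl | hp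
  · rw [map_zero, map_zero] at hπ
    exact exp_ne_zero hπ.symm
  · rw [hone p hp, ← exp_zero, exp_inj] at hπ
    omega

theorem exists_place_infty : ∃ P : Place k F, P.valuation x = exp (1 : ℤ) ∧ P.degree = 1 ∧
    ∀ Q : Place k F, 1 < Q.valuation x → Q = P := by
  obtain ⟨P, -, h1, h2, h3⟩ := hx.inv.exists_place irreducible_X
  rw [aeval_X, map_inv₀] at h1
  refine ⟨P, ?_, by rw [h2, natDegree_X], fun Q hQ => h3 Q ?_ ?_⟩
  · rw [← inv_inv (P.valuation x), h1, ← exp_neg, neg_neg]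
  · rw [map_inv₀]
    exact inv_le_one_of_one_le₀ hQ.le
  · rw [aeval_X, map_inv₀]
    exact inv_lt_one_of_one_lt₀ hQ

theorem degree_pos (P : Place k F) : 0 < P.degree := by
  rcases le_or_gt (P.valuation x) 1 with h | h
  · obtain ⟨p, hp, hpv⟩ := hx.exists_irreducible h
    obtain ⟨Q, -, -, hd, hQ⟩ := hx.exists_place hp
    rw [hQ P h hpv, hd]
    exact hp.natDegree_pos
  · obtain ⟨Q, -, hd, hQ⟩ := hx.exists_place_infty
    rw [hQ P h, hd]
    exact one_pos

/-- Partial fractions: the principal part of `h` at a finite place is integral at all other places,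
including infinity. At infinity the polynomial part of `h` is used instead. -/
theorem strongApprox : StrongApprox (0 : CurveDivisor k F) := by
  intro P h
  simp only [Finsupp.coe_zero, Pi.zero_apply, exp_zero]
  obtain ⟨a, b, hb, rfl⟩ := hx.exists_div h
  have hb0 := hx.aeval_ne_zero hb
  rcases le_or_gt (P.valuation x) 1 with hP | hP
  · obtain ⟨p, hp, hpv⟩ := hx.exists_irreducible hP
    obtain ⟨P₀, -, -, -, hQ⟩ := hx.exists_place hp
    obtain rfl := hQ P hP hpv
    obtain ⟨b', hbm, hpb'⟩ :=
      (FiniteMultiplicity.of_not_isUnit hp.not_isUnit hb).exists_eq_pow_mul_and_not_dvd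
    set m := multiplicity p b
    -- With `s pᵐ + t b' = 1` one has `a/b = as/b' + at/pᵐ`. Reducing `at` modulo `pᵐ` leaves a
    -- fraction without a pole at infinity.
    obtain ⟨s, t, hst⟩ := ((hp.coprime_iff_not_dvd.2 hpb').pow_left (m := m))
    have hpm : p ^ m ≠ 0 := pow_ne_zero _ hp.ne_zero
    have hb'0 : b' ≠ 0 := by rintro rfl; simp at hpb'
    have hpm0 := hx.aeval_ne_zero hpm
    have hb'00 := hx.aeval_ne_zero hb'0
    set c := (a * t) % (p ^ m) with hc
    set d := (a * t) / (p ^ m) with hd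
    have hdiv : p ^ m * d + c = a * t := EuclideanDomain.div_add_mod _ _
    have hdeg : c.natDegree ≤ (p ^ m).natDegree := 
      natDegree_le_natDegree (degree_mod_lt _ hpm).le
    refine ⟨aeval x c / aeval x (p ^ m), ?_, fun Q hQP => ?_⟩
    · have e : aeval x c / aeval x (p ^ m) - aeval x a / aeval x b =
          -(aeval x (a * s) / aeval x b' + aeval x d) := by
        have e1 := congrArg (aeval x) hdiv
        have e2 := congrArg (aeval x) hst
        have e3 := congrArg (aeval x) hbm
        simp only [map_add, map_mul, map_one] at e1 e2 e3
        rw [e3]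
        rw [map_mul]
        field_simp
        linear_combination aeval x b' * e1 + aeval x a * e2
      rw [e, Valuation.map_neg]
      refine (P.valuation.map_add _ _).trans (max_le ?_ (valuation_aeval_le_one hP d))
      rw [map_div₀, valuation_aeval_eq_one_of_not_dvd hP hp hpv hpb', div_one]
      exact valuation_aeval_le_one hP _
    · rw [map_div₀]
      rcases le_or_gt (Q.valuation x) 1 with hQx | hQx
      · have : Q.valuation (aeval x p) = 1 :=
          (valuation_aeval_le_one hQx p).antisymm (not_lt.1 fun h => hQP (hQ Q hQx h))
        rw [map_pow, map_pow, this, one_pow, div_one]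
        exact valuation_aeval_le_one hQx c
      · rw [valuation_aeval_eq_pow hQx hpm]
        exact div_le_one_of_le₀ (valuation_aeval_le_pow hQx c hdeg) zero_le
  · refine ⟨aeval x (a / b), ?_, fun Q hQ => ?_⟩
    · have e : aeval x (a / b) - aeval x a / aeval x b = -(aeval x (a % b) / aeval x b) := by
        have e1 := congrArg (aeval x) (EuclideanDomain.div_add_mod a b)
        simp only [map_add, map_mul] at e1
        field_simp
        linear_combination e1
      rw [e, Valuation.map_neg, map_div₀, valuation_aeval_eq_pow hP hb]
      exact div_le_one_of_le₀ (valuation_aeval_le_pow hP _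
        (natDegree_le_natDegree (degree_mod_lt _ hb).le)) zero_le
    · refine valuation_aeval_le_one (not_lt.1 fun h => hQ ?_) _
      obtain ⟨P₀, -, -, h0⟩ := hx.exists_place_infty
      rw [h0 Q h, h0 P hP]

/-- In lowest terms, an irreducible factor of the denominator would give a finite pole, and a
nonconstant numerator would give one at infinity. -/
theorem mem_range_of_mem_riemannRochSpace_zero {f : F}
    (hf : f ∈ riemannRochSpace (0 : CurveDivisor k F)) : ∃ c : k, f = algebraMap k F c := by
  obtain ⟨a, b, hb, rfl⟩ := hx.exists_div f
  rw [mem_riemannRochSpace] at hf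
  simp only [Finsupp.coe_zero, Pi.zero_apply, exp_zero] at hf
  obtain ⟨g, a', b', hcop, ha, hb'⟩ : ∃ g a' b' : k[X], IsCoprime a' b' ∧ a = g * a' ∧
      b = g * b' := by
    classical
    let _ := UniqueFactorizationMonoid.toGCDMonoid k[X]
    have hg : gcd a b ≠ 0 := gcd_ne_zero_of_right hb
    exact ⟨gcd a b, _, _, isCoprime_div_gcd_div_gcd hb,
      (EuclideanDomain.mul_div_cancel' hg (gcd_dvd_left a b)).symm,
      (EuclideanDomain.mul_div_cancel' hg (gcd_dvd_right a b)).symm⟩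
  have hg0 : g ≠ 0 := by rintro rfl; rw [zero_mul] at hb'; exact hb hb'
  have hb'0 : b' ≠ 0 := by rintro rfl; rw [mul_zero] at hb'; exact hb hb'
  have hfab : aeval x a / aeval x b = aeval x a' / aeval x b' := by
    rw [ha, hb', map_mul, map_mul, mul_div_mul_left _ _ (hx.aeval_ne_zero hg0)]
  rw [hfab] at hf ⊢
  have hunit : IsUnit b' := by
    by_contra hnu
    obtain ⟨p, hp, hpb⟩ := WfDvdMonoid.exists_irreducible_factor hnu hb'0
    obtain ⟨P, hP, hpv, -, -⟩ := hx.exists_place hp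
    have hpv' : P.valuation (aeval x p) < 1 := by rw [hpv, ← exp_zero, exp_lt_exp]; norm_num
    have hpa : ¬ p ∣ a' := fun hpa => hp.not_isUnit (hcop.isUnit_of_dvd' hpa hpb)
    have h1 := hf P
    rw [map_div₀, valuation_aeval_eq_one_of_not_dvd hP hp hpv' hpa] at h1
    obtain ⟨c, rfl⟩ := hpb
    have h2 : P.valuation (aeval x (p * c)) < 1 := by
      rw [map_mul, map_mul]
      exact mul_lt_one_of_nonneg_of_lt_one_left zero_le hpv' (valuation_aeval_le_one hP c)
    have h3 : 0 < P.valuation (aeval x (p * c)) :=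
      zero_lt_iff.2 ((_root_.map_ne_zero _).2 (hx.aeval_ne_zero hb'0))
    rw [div_le_one₀ h3] at h1
    exact absurd h1 (not_le.2 h2)
  obtain ⟨u, hu, rfl⟩ := Polynomial.isUnit_iff.1 hunit
  obtain ⟨P, hP, -, -⟩ := hx.exists_place_infty
  have hP1 : 1 < P.valuation x := by rw [hP, ← exp_zero, exp_lt_exp]; norm_num
  have hdeg : a'.natDegree = 0 := by
    by_contra hd
    have ha0 : a' ≠ 0 := by rintro rfl; simp at hd
    have h1 := hf P
    rw [map_div₀, aeval_C, P.valuation_algebraMap hu.ne_zero, div_one,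
      valuation_aeval_eq_pow hP1 ha0] at h1
    exact absurd h1 (not_le.2 (one_lt_pow₀ hP1 hd))
  rw [eq_C_of_natDegree_eq_zero hdeg, aeval_C, aeval_C, ← map_div₀]
  exact ⟨_, rfl⟩

theorem hasGenus_zero : HasGenus k F 0 := by
  have hL : riemannRochSpace (0 : CurveDivisor k F) = Submodule.span k {(1 : F)} := by
    ext f
    rw [Submodule.mem_span_singleton]
    constructor
    · intro hf
      obtain ⟨c, rfl⟩ := hx.mem_range_of_mem_riemannRochSpace_zero hf
      exact ⟨c, by rw [Algebra.smul_def, mul_one]⟩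
    · rintro ⟨c, rfl⟩
      intro P
      rw [Algebra.smul_def, mul_one]
      exact P.valuation_algebraMap_le_one c
  have hfin : FiniteDimensional k (riemannRochSpace (0 : CurveDivisor k F)) := by
    rw [hL]; infer_instance
  have := hasGenus_of_strongApprox hx.degree_pos hx.strongApprox
  rwa [hL, finrank_span_singleton one_ne_zero, CurveDivisor.deg_zero] at this

end IsRationalGenerator

/-! ### Arithmetic in the field with eight elements -/

section CardEight

variable {k : Type*} [Field k] (hk : Nat.card k = 8)
include hk

omit [Field k] in
theorem finite_of_card_eight : Finite k := Nat.finite_of_card_ne_zero (by omega)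

theorem two_eq_zero_of_card_eight : (2 : k) = 0 := by
  have := finite_of_card_eight hk
  have h : ((Nat.card k : ℕ) : k) = 0 := by
    have := Fintype.ofFinite k
    rw [Nat.card_eq_fintype_card, FiniteField.cast_card_eq_zero]
  rw [hk] at h
  have h8 : (2 : k) ^ 3 = 0 := by rw [← h]; norm_num
  exact pow_eq_zero_iff (by norm_num) |>.1 h8

theorem pow_seven_of_card_eight {a : k} (ha : a ≠ 0) : a ^ 7 = 1 := by
  have := finite_of_card_eight hk
  have := Fintype.ofFinite k
  have h := FiniteField.pow_card_sub_one_eq_one a ha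
  rwa [← Nat.card_eq_fintype_card, hk] at h

/-- A root satisfies `a³ = 1` and `a⁷ = 1`, so `a = 1`, which is not a root. -/
theorem sq_add_self_add_one_ne_zero (a : k) : a ^ 2 + a + 1 ≠ 0 := by
  intro h
  have h2 := two_eq_zero_of_card_eight hk
  have ha : a ≠ 0 := by rintro rfl; simp at h
  have h7 := pow_seven_of_card_eight hk ha
  have h3 : a ^ 3 = 1 := by linear_combination (a - 1) * h
  have h1 : a = 1 := by linear_combination h7 - (a ^ 4 + a) * h3
  rw [h1] at h
  exact one_ne_zero (α := k) (by linear_combination h - h2)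

/-- As `1/a = a⁶`, the trace `z + z² + z⁴` of the right side is `1 + a + ⋯ + a⁶`, which is `0`
because `a⁷ = 1` and `a ≠ 1`. -/
theorem exists_sq_add_self_eq {a : k} (ha : a ≠ 0) (ha1 : a ≠ 1) :
    ∃ c : k, c ^ 2 + c = a + 1 + 1 / a := by
  have h2 := two_eq_zero_of_card_eight hk
  have h7 := pow_seven_of_card_eight hk ha
  have hs : a ^ 6 + a ^ 5 + a ^ 4 + a ^ 3 + a ^ 2 + a + 1 = 0 := by
    refine (mul_eq_zero.1 (?_ : (a - 1) * _ = 0)).resolve_left (sub_ne_zero.2 ha1)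
    linear_combination h7
  obtain ⟨b, hb⟩ : ∃ b, a * b = 1 := ⟨a⁻¹, mul_inv_cancel₀ ha⟩
  have hb' : b = a ^ 6 := by linear_combination a ^ 6 * hb - b * h7
  have hdiv : 1 / a = a ^ 6 := by rw [← hb']; field_simp; linear_combination -hb
  set z := a + 1 + a ^ 6 with hz
  have hz8 : z ^ 8 = z := by
    have := finite_of_card_eight hk
    have := Fintype.ofFinite k
    have h := FiniteField.pow_card z
    rwa [← Nat.card_eq_fintype_card, hk] at h
  have htr : z ^ 4 + z ^ 2 + z = 0 := by
    have e2 : z ^ 2 = a ^ 2 + 1 + a ^ 5 := by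
      rw [hz]
      linear_combination (a + a ^ 6 + a ^ 7) * h2 + a ^ 5 * h7
    have e4 : z ^ 4 = a ^ 4 + 1 + a ^ 3 := by
      rw [show z ^ 4 = (z ^ 2) ^ 2 by ring, e2]
      linear_combination (a ^ 2 + a ^ 5 + a ^ 7) * h2 + a ^ 3 * h7
    rw [e2, e4, hz]
    linear_combination hs + h2
  refine ⟨z + z ^ 4, ?_⟩
  rw [hdiv]
  change _ = z
  -- The root `z + z⁴` works: its square plus itself is `z + z² + z⁴ + z⁸`, which is `z⁸ = z` by
  -- trace zero.
  linear_combination htr + hz8 + z ^ 5 * h2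

end CardEight

/-! ### Constants and bad places -/

namespace Place

variable {k F : Type*} [Field k] [Field F] [Algebra k F]

theorem exists_const {P : Place k F} (hd : P.degree = 1) {f : F} (hf : P.valuation f ≤ 1) :
    ∃ c : k, P.valuation (f - algebraMap k F c) < 1 := by
  obtain ⟨c, hc⟩ := (finrank_eq_one_iff_of_nonzero' (1 : P.residueField) one_ne_zero).1 hd
    (IsLocalRing.residue P.ring ⟨f, P.mem_ring_iff.2 hf⟩)
  refine ⟨c, ?_⟩
  rw [Algebra.smul_def, mul_one] at hc
  change IsLocalRing.residue P.ring (algebraMap k P.ring c) = _ at hc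
  rw [eq_comm, P.residue_eq_iff] at hc
  exact hc

theorem valuation_le_one_of_isAlgebraic (P : Place k F) {a : F} (ha : IsAlgebraic k a) :
    P.valuation a ≤ 1 := by
  rw [← P.mem_ring_iff]
  obtain ⟨p, hp, hz⟩ := ha.isIntegral
  rw [← valuationSubring_valuation]
  have : IsIntegral P.valuation.valuationSubring a := by
    let φ : k →+* P.valuation.valuationSubring :=
      (algebraMap k F).codRestrict P.valuation.valuationSubring.toSubring
        P.valuation_algebraMap_le_one
    refine ⟨p.map φ, hp.map φ, ?_⟩
    rw [Polynomial.eval₂_map]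
    exact hz
  obtain ⟨y, rfl⟩ := IsIntegrallyClosed.isIntegral_iff.1 this
  exact y.2

/-- A function field with a rational place has exact field of constants `k`. -/
theorem mem_range_of_isAlgebraic {P : Place k F} (hd : P.degree = 1) {a : F}
    (ha : IsAlgebraic k a) : a ∈ (algebraMap k F).range := by
  obtain ⟨c, hc⟩ := exists_const hd (P.valuation_le_one_of_isAlgebraic ha)
  have h1 : IsAlgebraic k (a - algebraMap k F c) := ha.sub (isAlgebraic_algebraMap c)
  have h2 : a - algebraMap k F c = 0 := by
    by_contra h0
    have h3 := P.valuation_le_one_of_isAlgebraic h1.inv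
    rw [map_inv₀] at h3
    have h4 := (inv_le_one₀ (zero_lt_iff.2 ((map_ne_zero _).2 h0))).1 h3
    exact absurd hc (not_lt.2 h4)
  exact ⟨c, (sub_eq_zero.1 h2).symm⟩

/-- The value of `x` at `P` lies in the finite forward-closed set `{∞, 0, 1, ω, ω²}`. -/
def Bad (P : Place k F) (x : F) : Prop :=
  1 < P.valuation x ∨ P.valuation x < 1 ∨ P.valuation (x + 1) < 1 ∨
    P.valuation (x ^ 2 + x + 1) < 1

end Place

/-! ### The bottom level of the tower -/

namespace IsRationalGenerator

open Polynomial

variable {k F : Type*} [Field k] [Field F] [Algebra k F] {x : F} (hx : IsRationalGenerator k x)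
  (hk : Nat.card k = 8)
include hx

theorem valuation_X_eq {P : Place k F} (h : P.valuation x < 1) : P.valuation x = exp (-1 : ℤ) := by
  obtain ⟨Q, h1, h2, -, h3⟩ := hx.exists_place irreducible_X
  rw [aeval_X] at h2 h3
  rw [h3 P h.le h, h2]

theorem weakAt_add_one_add_inv (P : Place k F) : P.WeakAt (x + 1 + 1 / x) := by
  refine ⟨0, ?_⟩
  have hexp : (1 : WithZero (Multiplicative ℤ)) ≤ exp (1 : ℤ) := by
    rw [← exp_zero, exp_le_exp]; norm_num
  rw [zero_pow two_ne_zero, add_zero, add_zero, one_div]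
  refine (P.valuation.map_add _ _).trans (max_le ((P.valuation.map_add _ _).trans
    (max_le ?_ (by simpa using hexp))) ?_)
  · rcases le_or_gt (P.valuation x) 1 with h | h
    · exact h.trans hexp
    · obtain ⟨Q, h1, -, h2⟩ := hx.exists_place_infty
      rw [h2 P h, h1]
  · rw [map_inv₀]
    rcases lt_or_ge (P.valuation x) 1 with h | h
    · rw [hx.valuation_X_eq h, ← exp_neg, neg_neg]
    · exact (inv_le_one_of_one_le₀ h).trans hexp

omit hx in
theorem natDegree_quadratic : (X ^ 2 + X + 1 : k[X]).natDegree = 2 := by compute_degree!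

include hk in
omit hx in
theorem irreducible_quadratic : Irreducible (X ^ 2 + X + 1 : k[X]) := by
  refine irreducible_of_degree_le_three_of_not_isRoot ?_ fun a ha => ?_
  · rw [natDegree_quadratic]; decide
  · exact sq_add_self_add_one_ne_zero hk a (by simpa using ha)

include hk in
theorem weakAt_inv_quadratic (P : Place k F) : P.WeakAt (1 / (x ^ 2 + x + 1)) := by
  refine ⟨0, ?_⟩
  have hexp : (1 : WithZero (Multiplicative ℤ)) ≤ exp (1 : ℤ) := by
    rw [← exp_zero, exp_le_exp]; norm_num
  rw [zero_pow two_ne_zero, add_zero, add_zero, one_div, map_inv₀]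
  rcases lt_or_ge (P.valuation (x ^ 2 + x + 1)) 1 with h | h
  · obtain ⟨Q, h1, h2, -, h3⟩ := hx.exists_place (irreducible_quadratic hk)
    simp only [map_add, map_pow, aeval_X, map_one] at h2 h3
    have hP : P.valuation x ≤ 1 := by
      rw [← Valuation.map_sq_add_self_le_one_iff, ← add_sub_cancel_right (x ^ 2 + x) 1]
      exact (P.valuation.map_sub _ _).trans (max_le h.le (by simp))
    rw [h3 P hP h, h2, ← exp_neg, neg_neg]
  · exact (inv_le_one_of_one_le₀ h).trans hexp

include hk in
-- The values `∞`, `0`, `1` give three rational places, and `ω`, `ω²` together one place of degree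
-- `2`, as `X² + X + 1` is irreducible over `k`.
theorem exists_bad_finset : ∃ S : Finset (Place k F), (∀ P, P ∈ S ↔ P.Bad x) ∧
    ∑ P ∈ S, P.degree = 5 := by
  classical
  obtain ⟨P₀, a1, a2, a3, a4⟩ := hx.exists_place irreducible_X
  obtain ⟨P₁, b1, b2, b3, b4⟩ := hx.exists_place (irreducible_X_sub_C (-1 : k))
  obtain ⟨Pω, c1, c2, c3, c4⟩ := hx.exists_place (irreducible_quadratic hk)
  obtain ⟨P₂, d1, d2, d3⟩ := hx.exists_place_infty
  simp only [map_add, map_pow, aeval_X, map_one, map_neg, sub_neg_eq_add] at *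
  rw [natDegree_X] at a3
  rw [natDegree_quadratic] at c3
  have b3' : P₁.degree = 1 := by rw [b3]; compute_degree!
  have hlt (n : ℤ) (hn : n < 0) : exp n < 1 := by rw [← exp_zero, exp_lt_exp]; exact hn
  have hgt : 1 < exp (1 : ℤ) := by rw [← exp_zero, exp_lt_exp]; norm_num
  have n01 : P₀ ≠ P₁ := by
    rintro rfl
    have := P₀.valuation.map_sub_lt (b2.trans_lt (hlt _ (by norm_num)))
      (a2.trans_lt (hlt _ (by norm_num)))
    rw [add_sub_cancel_left, map_one] at this
    exact lt_irrefl _ this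
  have n02 : P₀ ≠ P₂ := by rintro rfl; rw [d1] at a1; exact absurd a1 (not_le.2 hgt)
  have n12 : P₁ ≠ P₂ := by rintro rfl; rw [d1] at b1; exact absurd b1 (not_le.2 hgt)
  have n0ω : Pω ≠ P₀ := by rintro rfl; omega
  have n1ω : Pω ≠ P₁ := by rintro rfl; omega
  have n2ω : Pω ≠ P₂ := by rintro rfl; omega
  refine ⟨{Pω, P₀, P₁, P₂}, fun P => ?_, ?_⟩
  · simp only [Finset.mem_insert, Finset.mem_singleton]
    constructor
    · rintro (rfl | rfl | rfl | rfl)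
      · exact Or.inr (Or.inr (Or.inr (c2.trans_lt (hlt _ (by norm_num)))))
      · exact Or.inr (Or.inl (a2.trans_lt (hlt _ (by norm_num))))
      · exact Or.inr (Or.inr (Or.inl (b2.trans_lt (hlt _ (by norm_num)))))
      · exact Or.inl (by rw [d1]; exact hgt)
    · intro hb
      rcases lt_or_ge 1 (P.valuation x) with h | h
      · exact Or.inr (Or.inr (Or.inr (d3 P h)))
      · rcases hb with hb | hb | hb | hb
        · exact absurd hb (not_lt.2 h)
        · exact Or.inr (Or.inl (a4 P h hb))
        · exact Or.inr (Or.inr (Or.inl (b4 P h hb)))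
        · exact Or.inl (c4 P h hb)
  · rw [Finset.sum_insert (by simp [n0ω, n1ω, n2ω]), Finset.sum_insert (by simp [n01, n02]),
      Finset.sum_pair n12, a3, b3', c3, d2]
    norm_num

include hk in
theorem exists_rational_finset : ∃ R : Finset (Place k F),
    (∀ P, P ∈ R ↔ P.degree = 1 ∧ ¬ P.Bad x) ∧ R.card = 6 := by
  classical
  have := finite_of_card_eight hk
  have := Fintype.ofFinite k
  choose p h1 h2 h3 h4 using fun a : k => hx.exists_place (irreducible_X_sub_C a)
  have hlt (a : k) : (p a).valuation (aeval x (X - C a)) < 1 := by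
    rw [h2, ← exp_zero, exp_lt_exp]; norm_num
  have hinj : Function.Injective p := by
    intro a b hab
    by_contra hne
    have e1 := hlt a
    have e2 := hlt b
    rw [← hab] at e2
    have := (p a).valuation.map_sub_lt e2 e1
    rw [← map_sub, show (X - C b - (X - C a) : k[X]) = C (a - b) by rw [C_sub]; ring, aeval_C,
      (p a).valuation_algebraMap (sub_ne_zero.2 hne)] at this
    exact lt_irrefl _ this
  refine ⟨(Finset.univ.filter fun a : k => a ≠ 0 ∧ a ≠ 1).map ⟨p, hinj⟩, fun P => ?_, ?_⟩
  · rw [Finset.mem_map]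
    constructor
    · rintro ⟨a, ha, rfl⟩
      rw [Finset.mem_filter] at ha
      obtain ⟨-, ha0, ha1⟩ := ha
      change (p a).degree = 1 ∧ ¬ (p a).Bad x
      refine ⟨by rw [h3, natDegree_X_sub_C], ?_⟩
      have key (q : k[X]) (hq : q.eval a ≠ 0) : (p a).valuation (aeval x q) = 1 :=
        valuation_aeval_eq_one_of_not_dvd (h1 a) (irreducible_X_sub_C a) (hlt a)
          (fun hd => hq (dvd_iff_isRoot.1 hd))
      have k1 := key X (by simpa using ha0)
      have k2 := key (X + 1) (by
        have h2 := two_eq_zero_of_card_eight hk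
        simp only [eval_add, eval_X, eval_one]
        exact fun h => ha1 (by linear_combination h - h2))
      have k3 := key (X ^ 2 + X + 1) (by simpa using sq_add_self_add_one_ne_zero hk a)
      simp only [map_add, map_pow, aeval_X, map_one] at k1 k2 k3
      unfold Place.Bad
      rw [k1, k2, k3]
      simp
    · rintro ⟨hd, hb⟩
      unfold Place.Bad at hb
      push Not at hb
      obtain ⟨hb1, hb2, hb3, -⟩ := hb
      obtain ⟨a, ha⟩ := Place.exists_const hd hb1
      refine ⟨a, ?_, ?_⟩
      · rw [Finset.mem_filter]
        refine ⟨Finset.mem_univ _, ?_, ?_⟩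
        · rintro rfl
          rw [map_zero, sub_zero] at ha
          exact absurd ha (not_lt.2 hb2)
        · rintro rfl
          have h2 : (2 : F) = 0 := by
            rw [← map_ofNat (algebraMap k F) 2, two_eq_zero_of_card_eight hk, map_zero]
          rw [map_one, show x - 1 = x + 1 by linear_combination -h2] at ha
          exact absurd ha (not_lt.2 hb3)
      · refine (h4 a P hb1 ?_).symm
        simpa using ha
  · rw [Finset.card_map, ← Fintype.card_subtype]
    have h5 : (Finset.univ.filter fun a : k => a ≠ 0 ∧ a ≠ 1) = (Finset.univ.erase 0).erase 1 := by
      ext a; simp [and_comm]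
    rw [Fintype.card_subtype, h5, Finset.card_erase_of_mem (by simp),
      Finset.card_erase_of_mem (by simp), Finset.card_univ, ← Nat.card_eq_fintype_card, hk]

end IsRationalGenerator

/-! ### Propagation of bad values and weights -/

namespace Place

section Values

variable {k F : Type*} [Field k] [Field F] [Algebra k F] (P : Place k F)

theorem valuation_eq_one_of_add_lt {a b : F} (hb : P.valuation b = 1)
    (h : P.valuation (a + b) < 1) : P.valuation a = 1 := by
  have : P.valuation (-b + (a + b)) = P.valuation (-b) :=
    P.valuation.map_add_eq_of_lt_left (by rwa [Valuation.map_neg, hb])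
  rwa [show -b + (a + b) = a by ring, Valuation.map_neg, hb] at this

theorem valuation_eq_one_of_add_one_lt {a : F} (h : P.valuation (a + 1) < 1) :
    P.valuation a = 1 :=
  P.valuation_eq_one_of_add_lt (map_one _) h

theorem valuation_eq_one_of_quadratic_lt {a : F} (h : P.valuation (a ^ 2 + a + 1) < 1) :
    P.valuation a = 1 ∧ P.valuation (a + 1) = 1 := by
  have h1 : P.valuation (a ^ 2 + a) = 1 := P.valuation_eq_one_of_add_one_lt h
  have h2 : P.valuation a ≤ 1 := P.valuation.map_sq_add_self_le_one_iff.1 h1.le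
  have h3 : P.valuation (a + 1) ≤ 1 :=
    (P.valuation.map_add _ _).trans (max_le h2 (map_one _).le)
  rw [show a ^ 2 + a = a * (a + 1) by ring, map_mul] at h1
  constructor
  · refine h2.antisymm (not_lt.1 fun hlt => ?_)
    exact absurd h1 (mul_lt_one_of_nonneg_of_lt_one_left zero_le hlt h3).ne
  · refine h3.antisymm (not_lt.1 fun hlt => ?_)
    exact absurd h1 (mul_lt_one_of_nonneg_of_lt_one_right h2 zero_le hlt).ne

variable {X Y : F}

theorem valuation_rhs_of_one_lt (hX : 1 < P.valuation X) :
    P.valuation (X + 1 + 1 / X) = P.valuation X := by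
  rw [add_assoc, P.valuation.map_add_eq_of_lt_left]
  refine lt_of_le_of_lt ((P.valuation.map_add _ _).trans (max_le (map_one _).le ?_)) hX
  rw [one_div, map_inv₀]
  exact inv_le_one_of_one_le₀ hX.le

/-- The expression is invariant under `X ↦ 1/X`. -/
theorem valuation_rhs_of_lt_one (hX0 : X ≠ 0) (hX : P.valuation X < 1) :
    P.valuation (X + 1 + 1 / X) = (P.valuation X)⁻¹ := by
  have h := P.valuation_rhs_of_one_lt (X := X⁻¹) (by
    rw [map_inv₀]
    exact (one_lt_inv₀ (zero_lt_iff.2 ((map_ne_zero _).2 hX0))).2 hX)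
  rw [map_inv₀] at h
  rw [← h]
  congr 1
  field_simp
  ring

theorem valuation_rhs_le_one (hX : P.valuation X = 1) : P.valuation (X + 1 + 1 / X) ≤ 1 := by
  refine (P.valuation.map_add _ _).trans (max_le ((P.valuation.map_add _ _).trans
    (max_le hX.le (map_one _).le)) ?_)
  rw [one_div, map_inv₀, hX, inv_one]

theorem rhs_mul (hX0 : X ≠ 0) : (X + 1 + 1 / X) * X = X ^ 2 + X + 1 := by
  field_simp

theorem valuation_rhs_eq_quadratic (hX0 : X ≠ 0) (hX : P.valuation X = 1) :
    P.valuation (X + 1 + 1 / X) = P.valuation (X ^ 2 + X + 1) := by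
  rw [← rhs_mul hX0, map_mul, hX, mul_one]

theorem valuation_rhs_add_one (hX0 : X ≠ 0) (hX : P.valuation X = 1) :
    P.valuation (X + 1 + 1 / X + 1) = P.valuation (X + 1) ^ 2 := by
  rw [← map_pow, show (X + 1) ^ 2 = (X + 1 + 1 / X + 1) * X by
    field_simp; ring, map_mul, hX, mul_one]

/-- Poles of `Y` are the zeros and poles of `X`; elsewhere `Y(Y + 1) = (X² + X + 1)/X` and `Y² + Y +
1 = (X + 1)²/X` match the remaining cases. -/
theorem bad_iff_bad (hX0 : X ≠ 0) (hXY : Y ^ 2 + Y = X + 1 + 1 / X) :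
    P.Bad Y ↔ P.Bad X := by
  unfold Bad
  rcases lt_trichotomy (P.valuation X) 1 with hX | hX | hX
  · have : 1 < P.valuation Y := by
      rw [← not_le, ← P.valuation.map_sq_add_self_le_one_iff, hXY,
        P.valuation_rhs_of_lt_one hX0 hX, not_le]
      exact (one_lt_inv₀ (zero_lt_iff.2 ((map_ne_zero _).2 hX0))).2 hX
    simp [this, hX]
  · have hYle : P.valuation Y ≤ 1 := by
      rw [← P.valuation.map_sq_add_self_le_one_iff, hXY]
      exact P.valuation_rhs_le_one hX
    have hY1 : P.valuation (Y + 1) ≤ 1 :=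
      (P.valuation.map_add _ _).trans (max_le hYle (map_one _).le)
    have e1 : P.valuation Y * P.valuation (Y + 1) = P.valuation (X ^ 2 + X + 1) := by
      rw [← map_mul, ← P.valuation_rhs_eq_quadratic hX0 hX, ← hXY]; congr 1; ring
    have e2 : P.valuation (Y ^ 2 + Y + 1) = P.valuation (X + 1) ^ 2 := by
      rw [hXY, P.valuation_rhs_add_one hX0 hX]
    have e3 : P.valuation (Y ^ 2 + Y + 1) < 1 ↔ P.valuation (X + 1) < 1 := by
      rw [e2, pow_lt_one_iff_of_nonneg zero_le two_ne_zero]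
    have e4 : (P.valuation Y < 1 ∨ P.valuation (Y + 1) < 1) ↔ P.valuation (X ^ 2 + X + 1) < 1 := by
      rw [← e1]
      constructor
      · rintro (h | h)
        · exact mul_lt_one_of_nonneg_of_lt_one_left zero_le h hY1
        · exact mul_lt_one_of_nonneg_of_lt_one_right hYle zero_le h
      · intro h
        by_contra hcon
        rw [not_or, not_lt, not_lt] at hcon
        exact absurd h (not_lt.2 (one_le_mul hcon.1 hcon.2))
    rw [e3, ← or_assoc (a := P.valuation Y < 1), e4, hX]
    have := not_lt.2 hYle
    tauto
  · have : 1 < P.valuation Y := by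
      rw [← not_le, ← P.valuation.map_sq_add_self_le_one_iff, hXY,
        P.valuation_rhs_of_one_lt hX, not_le]
      exact hX
    simp [this, hX]

open Classical in
/-- The weight of a bad place. -/
def weight (x : F) : ℝ :=
  if P.valuation x ≠ 1 then √(|log (P.valuation x)| : ℤ)
  else if P.valuation (x + 1) < 1 then 15 / 4 * √(|log (P.valuation (x + 1))| : ℤ)
  else 5 / 2 * √(|log (P.valuation (x ^ 2 + x + 1))| : ℤ)

/-- This lets the total weight bound the total degree of the bad places: the order involved is a
nonzero integer, and all constants are at least `1`. -/
theorem one_le_weight {x : F} (hx : P.Bad x) (hx0 : x ≠ 0) (hx1 : x + 1 ≠ 0)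
    (hx2 : x ^ 2 + x + 1 ≠ 0) : 1 ≤ P.weight x := by
  have key (f : F) (hf : f ≠ 0) (h : P.valuation f ≠ 1) :
      (1 : ℝ) ≤ √(|log (P.valuation f)| : ℤ) := by
    rw [Real.one_le_sqrt]
    obtain ⟨n, hn⟩ := P.exists_eq_exp hf
    rw [hn, log_exp]
    rw [hn, Ne, exp_eq_one] at h
    exact_mod_cast Int.one_le_abs h
  unfold weight
  split_ifs with h1 h2
  · exact key x hx0 h1
  · have := key _ hx1 h2.ne
    linarith
  · have : P.valuation (x ^ 2 + x + 1) < 1 := by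
      rw [not_not] at h1
      rcases hx with h | h | h | h
      · exact absurd h1 h.ne'
      · exact absurd h1 h.ne
      · exact absurd h h2
      · exact h
    have := key _ hx2 this.ne
    linarith

theorem weight_eq_of_ne_one {x : F} {n : ℤ} (hn : n ≠ 0) (h : P.valuation x = exp n) :
    P.weight x = √(|n| : ℤ) := by
  unfold weight
  rw [if_pos (by rw [h]; simpa using hn), h, log_exp]

theorem weight_eq_of_add_one {x : F} {n : ℤ} (hn : n < 0) (h : P.valuation (x + 1) = exp n) :
    P.weight x = 15 / 4 * √(|n| : ℤ) := by
  have hlt : P.valuation (x + 1) < 1 := by rw [h, ← exp_zero, exp_lt_exp]; exact hn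
  unfold weight
  rw [if_neg (not_not.2 (P.valuation_eq_one_of_add_one_lt hlt)), if_pos hlt, h, log_exp]

theorem weight_eq_of_quadratic {x : F} {n : ℤ} (hn : n < 0)
    (h : P.valuation (x ^ 2 + x + 1) = exp n) : P.weight x = 5 / 2 * √(|n| : ℤ) := by
  have hlt : P.valuation (x ^ 2 + x + 1) < 1 := by rw [h, ← exp_zero, exp_lt_exp]; exact hn
  obtain ⟨h1, h2⟩ := P.valuation_eq_one_of_quadratic_lt hlt
  unfold weight
  rw [if_neg (not_not.2 h1), if_neg (by rw [h2]; exact lt_irrefl _), h, log_exp]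

end Values

end Place

namespace IsArtinSchreier

variable {k F F' : Type*} [Field k] [Field F] [Field F'] [Algebra k F] [Algebra k F']
  [Algebra F F'] [IsScalarTower k F F'] [FiniteDimensional F F'] [Algebra.IsSeparable F F']
  {y : F'} {x : F} (h : IsArtinSchreier y (x + 1 + 1 / x)) (hx0 : x ≠ 0)
include h hx0

omit hx0 [FiniteDimensional F F'] [Algebra.IsSeparable F F'] in
theorem eq_rhs : y ^ 2 + y = algebraMap F F' x + 1 + 1 / algebraMap F F' x := by
  rw [h.eq]; simp

theorem bad_iff (P' : Place k F') : P'.Bad y ↔ (P'.restrict F).Bad x := by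
  rw [P'.bad_iff_bad ((map_ne_zero _).2 hx0) h.eq_rhs]
  unfold Place.Bad
  rw [← not_le, ← not_le (a := (P'.restrict F).valuation x), P'.valuation_algebraMap_le_one_iff,
    P'.valuation_algebraMap_lt_one_iff, ← P'.valuation_algebraMap_lt_one_iff (x + 1),
    ← P'.valuation_algebraMap_lt_one_iff (x ^ 2 + x + 1)]
  simp only [map_add, map_pow, map_one]

omit hx0 in
-- A bound linear in the ramification index feeds directly into `∑ e · deg = 2 · deg P`, with no
-- case distinction on the splitting type.
theorem sum_weight_le_of_forall {P : Place k F} (c : ℝ)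
    (hc : ∀ P' ∈ P.fiber F', P'.weight y ≤ P'.ramIdx F * c) :
    ∑ P' ∈ P.fiber F', (P'.degree : ℝ) * P'.weight y ≤ 2 * P.degree * c := by
  have h1 : ((∑ P' ∈ P.fiber F', P'.ramIdx F * P'.degree : ℕ) : ℝ) = 2 * P.degree := by
    rw [P.sum_ramIdx_mul_degree, h.finrank_eq]; push_cast; ring
  rw [← h1, Nat.cast_sum, Finset.sum_mul]
  refine Finset.sum_le_sum fun P' hP' => ?_
  have := mul_le_mul_of_nonneg_left (hc P' hP') (Nat.cast_nonneg (α := ℝ) P'.degree)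
  push_cast
  linarith

omit hx0 in
-- The pole order of `y` is `em/2`, and `√(em/2) ≤ e √(m/2)` since `e ≥ 1`.
theorem weight_le_of_pole {P : Place k F} {m : ℤ} (hm : 0 < m)
    (hu : P.valuation (x + 1 + 1 / x) = exp m) {P' : Place k F'} (hP' : P' ∈ P.fiber F') :
    P'.weight y ≤ P'.ramIdx F * (√m / √2) := by
  have he := P'.ramIdx_pos (F := F)
  have h4 := congrArg P'.valuation h.eq
  rw [P'.valuation_algebraMap_eq_pow, Place.mem_fiber.1 hP', hu, ← exp_nsmul] at h4
  have hgt : 1 < P'.valuation y := by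
    rw [← not_le, ← Valuation.map_sq_add_self_le_one_iff, h4, ← exp_zero, exp_le_exp, not_le]
    simp only [nsmul_eq_mul]
    positivity
  rw [Valuation.map_sq_add_self_of_one_lt _ hgt] at h4
  have hne : y ≠ 0 := by rintro rfl; simp at hgt
  obtain ⟨n, hn⟩ := P'.exists_eq_exp hne
  rw [hn, ← exp_nsmul, exp_inj] at h4
  simp only [nsmul_eq_mul, Nat.cast_ofNat] at h4
  have hn0 : 0 < n := by
    have : 0 < (P'.ramIdx F : ℤ) * m := by positivity
    omega
  rw [P'.weight_eq_of_ne_one hn0.ne' hn, abs_of_pos hn0]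
  have h5 : (2 : ℝ) * n = P'.ramIdx F * m := by exact_mod_cast h4
  have he1 : (1 : ℝ) ≤ P'.ramIdx F := by exact_mod_cast he
  have hm' : (0 : ℝ) < m := by exact_mod_cast hm
  rw [Real.sqrt_le_left (by positivity), mul_pow, div_pow, Real.sq_sqrt hm'.le,
    Real.sq_sqrt (by norm_num)]
  have : (n : ℝ) = P'.ramIdx F * (m / 2) := by linarith
  rw [this]
  refine mul_le_mul_of_nonneg_right ?_ (by positivity)
  nlinarith

/-- The square root balances two effects: at `0, ∞` the pole order is halved relative to `e`, giving
the factor `√2`, while at `1` the order is doubled. The constants `1`, `15/4`, `5/2` are fitted to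
the transitions: `1 → ω` needs `2 · 5/2 · √2 ≤ 19/10 · 15/4`, and `ω → 0, 1` needs `1 + 15/4 ≤ 19/10
· 5/2`, which is an equality. -/
theorem sum_weight_le {P : Place k F} (hP : 0 < P.degree) (hbad : P.Bad x) (hx1 : x + 1 ≠ 0)
    (hx2 : x ^ 2 + x + 1 ≠ 0) :
    ∑ P' ∈ P.fiber F', (P'.degree : ℝ) * P'.weight y ≤ 19 / 10 * (P.degree * P.weight x) := by
  classical
  have hs2 : √2 ≤ (1.415 : ℝ) := by
    rw [Real.sqrt_le_left (by norm_num)]; norm_num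
  have hs2sq : √2 * √2 = (2 : ℝ) := Real.mul_self_sqrt (by norm_num)
  have hpole {m : ℤ} (hm : 0 < m) (hu : P.valuation (x + 1 + 1 / x) = exp m)
      (hw : P.weight x = √(|m| : ℤ)) :
      ∑ P' ∈ P.fiber F', (P'.degree : ℝ) * P'.weight y ≤ 19 / 10 * (P.degree * P.weight x) := by
    refine (h.sum_weight_le_of_forall _ fun P' hP' =>
      h.weight_le_of_pole hm hu hP').trans ?_
    rw [hw, abs_of_pos hm]
    have e : √(m : ℝ) / √2 = √m * √2 / 2 := by
      rw [div_eq_div_iff (by positivity) (by norm_num)]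
      rw [mul_assoc, hs2sq]
    rw [e]
    have : 0 ≤ (P.degree : ℝ) * √m := by positivity
    nlinarith
  rcases lt_trichotomy (P.valuation x) 1 with hx | hx | hx
  · obtain ⟨n, hn⟩ := P.exists_eq_exp hx0
    have hn0 : n < 0 := by rwa [hn, ← exp_zero, exp_lt_exp] at hx
    refine hpole (m := -n) (by omega) ?_ ?_
    · rw [P.valuation_rhs_of_lt_one hx0 hx, hn, exp_neg]
    · rw [P.weight_eq_of_ne_one hn0.ne hn, abs_neg]
  · rcases hbad with hb | hb | hb | hb
    · exact absurd hx hb.ne'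
    · exact absurd hx hb.ne
    · obtain ⟨n, hn⟩ := P.exists_eq_exp hx1
      have hn0 : n < 0 := by rwa [hn, ← exp_zero, exp_lt_exp] at hb
      have hnR : (n : ℝ) < 0 := by exact_mod_cast hn0
      rw [P.weight_eq_of_add_one hn0 hn, abs_of_neg hn0]
      refine (h.sum_weight_le_of_forall 
        (5 / 2 * (√2 * √((-n : ℤ) : ℝ))) fun P' hP' => ?_).trans ?_
      · have he := P'.ramIdx_pos (F := F)
        have he1 : (1 : ℝ) ≤ P'.ramIdx F := by exact_mod_cast he
        have hval : P'.valuation (y ^ 2 + y + 1) = exp ((P'.ramIdx F : ℤ) * (2 * n)) := by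
          rw [show y ^ 2 + y + 1 = algebraMap F F' (x + 1 + 1 / x + 1) by
            rw [h.eq]; simp only [map_add, map_one], P'.valuation_algebraMap_eq_pow,
            Place.mem_fiber.1 hP', P.valuation_rhs_add_one hx0 hx, hn, ← exp_nsmul,
            ← exp_nsmul]
          simp only [nsmul_eq_mul, Nat.cast_ofNat]
        have hneg : (P'.ramIdx F : ℤ) * (2 * n) < 0 :=
          mul_neg_of_pos_of_neg (by exact_mod_cast he) (by omega)
        rw [P'.weight_eq_of_quadratic hneg hval, abs_of_neg hneg]
        rw [mul_left_comm (P'.ramIdx F : ℝ) (5 / 2)]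
        refine mul_le_mul_of_nonneg_left ?_ (by norm_num)
        rw [← Real.sqrt_mul (show (0 : ℝ) ≤ 2 by norm_num), Real.sqrt_le_left (by positivity), mul_pow,
          Real.sq_sqrt (by push_cast; linarith)]
        push_cast
        have he2 : (P'.ramIdx F : ℝ) ≤ P'.ramIdx F ^ 2 := by nlinarith
        have := mul_le_mul_of_nonneg_right he2 (show (0 : ℝ) ≤ 2 * -n by linarith)
        linarith
      · have : 0 ≤ (P.degree : ℝ) * √((-n : ℤ) : ℝ) := by positivity
        nlinarith
    · obtain ⟨n, hn⟩ := P.exists_eq_exp hx2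
      have hn0 : n < 0 := by rwa [hn, ← exp_zero, exp_lt_exp] at hb
      rw [P.weight_eq_of_quadratic hn0 hn]
      have hu := (P.valuation_rhs_eq_quadratic hx0 hx).trans hn
      have hu1 : P.valuation (x + 1 + 1 / x + 0 ^ 2 + 0) < 1 := by
        rw [zero_pow two_ne_zero, add_zero, add_zero, P.valuation_rhs_eq_quadratic hx0 hx]
        exact hb
      obtain ⟨P₀, P₁, hne, hfib, hed, hv0, hv1⟩ := h.split hP hu1
      rw [map_zero, add_zero] at hv0 hv1
      have hfib' : P.fiber F' = {P₀, P₁} := by ext Q; rw [hfib]; simp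
      have hprod (P' : Place k F') (hP' : P' ∈ P.fiber F') :
          P'.valuation y * P'.valuation (y + 1) = exp n := by
        rw [← map_mul, show y * (y + 1) = y ^ 2 + y by ring, h.eq, P'.valuation_algebraMap_eq_pow,
          (hed P' hP').1, pow_one, Place.mem_fiber.1 hP', hu]
      have h0 : P₀ ∈ P.fiber F' := (hfib _).2 (Or.inl rfl)
      have h1 : P₁ ∈ P.fiber F' := (hfib _).2 (Or.inr rfl)
      have e0 : P₀.valuation y = exp n := by
        have := hprod P₀ h0
        have h01 : P₀.valuation (y + 1) = 1 := by
          rw [add_comm, P₀.valuation.map_add_eq_of_lt_left (by rwa [map_one]), map_one]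
        rwa [h01, mul_one] at this
      have e1 : P₁.valuation (y + 1) = exp n := by
        have := hprod P₁ h1
        rwa [P₁.valuation_eq_one_of_add_one_lt hv1, one_mul] at this
      rw [hfib', Finset.sum_pair hne, P₀.weight_eq_of_ne_one hn0.ne e0,
        P₁.weight_eq_of_add_one hn0 e1, (hed P₀ h0).2, (hed P₁ h1).2]
      linarith
  · obtain ⟨n, hn⟩ := P.exists_eq_exp hx0
    have hn0 : 0 < n := by rwa [hn, ← exp_zero, exp_lt_exp] at hx
    refine hpole (m := n) hn0 ?_ ?_
    · rw [P.valuation_rhs_of_one_lt hx, hn]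
    · rw [P.weight_eq_of_ne_one hn0.ne' hn]

/-- Good rational places split completely. -/
theorem rational_fiber (hk : Nat.card k = 8) {P : Place k F} (hd : P.degree = 1)
    (hgood : ¬ P.Bad x) : (P.fiber F').card = 2 ∧ ∀ P' ∈ P.fiber F', P'.degree = 1 := by
  classical
  have hP : 0 < P.degree := by omega
  unfold Place.Bad at hgood
  push Not at hgood
  obtain ⟨b1, b2, b3, -⟩ := hgood
  have hv1 : P.valuation x = 1 := b1.antisymm b2
  have h2F := h.two_eq_zero
  obtain ⟨a, ha⟩ := Place.exists_const hd b1
  have ha0 : a ≠ 0 := by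
    rintro rfl
    rw [map_zero, sub_zero] at ha
    exact absurd ha (not_lt.2 b2)
  have ha1 : a ≠ 1 := by
    rintro rfl
    rw [map_one, show x - 1 = x + 1 by linear_combination -h2F] at ha
    exact absurd ha (not_lt.2 b3)
  obtain ⟨c, hc⟩ := exists_sq_add_self_eq hk ha0 ha1
  have hA0 : algebraMap k F a ≠ 0 := (map_ne_zero _).2 ha0
  have hcF : algebraMap k F c ^ 2 + algebraMap k F c =
      algebraMap k F a + 1 + 1 / algebraMap k F a := by
    have := congrArg (algebraMap k F) hc
    simpa only [map_add, map_pow, map_one, map_div₀] using this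
  -- With `c² + c = a + 1 + 1/a` for the value `a` of `x`, the sum has the factor `x - a`, so
  -- `split` applies.
  have hsplit : P.valuation (x + 1 + 1 / x + algebraMap k F c ^ 2 + algebraMap k F c) < 1 := by
    rw [add_assoc, hcF, show x + 1 + 1 / x + (algebraMap k F a + 1 + 1 / algebraMap k F a) =
      (x - algebraMap k F a) * (1 - 1 / (x * algebraMap k F a)) by
        field_simp
        linear_combination
          (x * algebraMap k F a ^ 2 + x * algebraMap k F a + x) * h2F,
      map_mul]
    refine mul_lt_one_of_nonneg_of_lt_one_left zero_le ha
      ((P.valuation.map_sub _ _).trans (max_le (map_one _).le ?_))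
    rw [one_div, map_inv₀, map_mul, hv1, P.valuation_algebraMap ha0, mul_one, inv_one]
  obtain ⟨P₀, P₁, hne, hfib, hed, -, -⟩ := h.split hP hsplit
  have hfib' : P.fiber F' = {P₀, P₁} := by ext Q; rw [hfib]; simp
  refine ⟨by rw [hfib', Finset.card_pair hne], fun P' hP' => by rw [(hed P' hP').2, hd]⟩

end IsArtinSchreier

/-! ### Passing from one level to the next -/

theorem finiteDimensional_adjoin_algebraMap {k F F' : Type*} [Field k] [Field F] [Field F']
    [Algebra k F] [Algebra k F'] [Algebra F F'] [IsScalarTower k F F'] [FiniteDimensional F F']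
    (z : F) [FiniteDimensional (IntermediateField.adjoin k {z}) F] :
    FiniteDimensional (IntermediateField.adjoin k {algebraMap F F' z}) F' := by
  have hmem (a : IntermediateField.adjoin k {z}) :
      algebraMap F F' a ∈ IntermediateField.adjoin k {algebraMap F F' z} := by
    have h : (IntermediateField.adjoin k {z}).map (IsScalarTower.toAlgHom k F F') =
        IntermediateField.adjoin k {algebraMap F F' z} := by
      rw [IntermediateField.adjoin_map, Set.image_singleton]; rfl
    rw [← h]
    exact ⟨a, a.2, rfl⟩
  let φ : IntermediateField.adjoin k {z} →+* IntermediateField.adjoin k {algebraMap F F' z} :=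
    ((algebraMap F F').comp (algebraMap (IntermediateField.adjoin k {z}) F)).codRestrict _ hmem
  let _ : Algebra (IntermediateField.adjoin k {z})
    (IntermediateField.adjoin k {algebraMap F F' z}) := φ.toAlgebra
  have : IsScalarTower (IntermediateField.adjoin k {z})
      (IntermediateField.adjoin k {algebraMap F F' z}) F' :=
    IsScalarTower.of_algebraMap_eq fun _ => rfl
  have : Module.Finite (IntermediateField.adjoin k {z}) F' := Module.Finite.trans F F'
  exact Module.Finite.of_restrictScalars_finite (IntermediateField.adjoin k {z}) _ _

/-- The data of one level `F = k(x₀, …, xₙ)` of the tower, in terms of `x = xₙ` and `N = 2ⁿ`. -/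
structure TowerLevel (k : Type*) {F : Type*} [Field k] [Field F] [Algebra k F] (x : F) (N : ℕ)
    (B : ℝ) : Prop where
  exists_finite : ∃ z : F, Transcendental k z ∧
    FiniteDimensional (IntermediateField.adjoin k {z}) F
  exists_pole : ∃ P : Place k F, P.degree = 1 ∧ P.valuation x = exp (1 : ℤ)
  exists_bad : ∃ S : Finset (Place k F), (∀ P, P ∈ S ↔ P.Bad x) ∧
    HasGenus k F (4 * N + 1 - ∑ P ∈ S, (P.degree : ℤ)) ∧
    ∑ P ∈ S, (P.degree : ℝ) * P.weight x ≤ B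
  exists_rational : ∃ R : Finset (Place k F), (∀ P, P ∈ R ↔ P.degree = 1 ∧ ¬ P.Bad x) ∧
    R.card = 6 * N

theorem IsRationalGenerator.exists_towerLevel {k F : Type*} [Field k] [Field F] [Algebra k F]
    {x : F} (hx : IsRationalGenerator k x) (hk : Nat.card k = 8) : ∃ B, TowerLevel k x 1 B := by
  obtain ⟨S, hS, h5⟩ := hx.exists_bad_finset hk
  obtain ⟨R, hR, h6⟩ := hx.exists_rational_finset hk
  obtain ⟨P, h1, h2, -⟩ := hx.exists_place_infty
  refine ⟨_, ⟨⟨x, hx.transcendental, ?_⟩, ⟨P, h2, h1⟩, ⟨S, hS, ?_, le_rfl⟩, ⟨R, hR, h6⟩⟩⟩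
  · have htop : IntermediateField.adjoin k {x} = ⊤ := by
      rw [eq_top_iff]
      rintro f -
      obtain ⟨p, q, -, rfl⟩ := hx.exists_div f
      have hm (r : Polynomial k) : Polynomial.aeval x r ∈ IntermediateField.adjoin k {x} :=
        IntermediateField.algebra_adjoin_le_adjoin k _ (Polynomial.aeval_mem_adjoin_singleton k x)
      exact div_mem (hm p) (hm q)
    rw [htop]
    exact FiniteDimensional.of_finrank_pos (by rw [IntermediateField.finrank_top]; exact one_pos)
  · rw [← Nat.cast_sum, h5]
    exact hx.hasGenus_zero

/-- At the simple pole of `x` the right side has pole order `1`, whereas a pole of `z² + z` has even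
order. -/
theorem TowerLevel.not_exists_sq_add_self {k F : Type*} [Field k] [Field F] [Algebra k F] {x : F}
    {N : ℕ} {B : ℝ} (hl : TowerLevel k x N B) (z : F) : z ^ 2 + z ≠ x + 1 + 1 / x := by
  intro h
  obtain ⟨P, -, hP⟩ := hl.exists_pole
  have h1 : 1 < P.valuation x := by rw [hP, ← exp_zero, exp_lt_exp]; norm_num
  have h2 := P.valuation_rhs_of_one_lt h1
  rw [← h, hP] at h2
  have hz : 1 < P.valuation z := by
    rw [← not_le, ← P.valuation.map_sq_add_self_le_one_iff, h2, ← hP, not_le]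
    exact h1
  rw [P.valuation.map_sq_add_self_of_one_lt hz] at h2
  have hz0 : z ≠ 0 := by rintro rfl; simp at hz
  obtain ⟨n, hn⟩ := P.exists_eq_exp hz0
  rw [hn, ← exp_nsmul, exp_inj] at h2
  simp only [nsmul_eq_mul, Nat.cast_ofNat] at h2
  omega

/-- Everything is lifted along fibres: bad places lie exactly above bad ones, good rational places
double in number, and `g + ∑ deg - 1` over the bad places doubles. -/
theorem IsArtinSchreier.towerLevel {k F F' : Type*} [Field k] [Field F] [Field F'] [Algebra k F]
    [Algebra k F'] [Algebra F F'] [IsScalarTower k F F'] {y : F'} {x : F}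
    (h : IsArtinSchreier y (x + 1 + 1 / x)) (hx0 : x ≠ 0) (hx1 : x + 1 ≠ 0)
    (hx2 : x ^ 2 + x + 1 ≠ 0) (hk : Nat.card k = 8)
    (hweak : ∀ P : Place k F, P.WeakAt (x + 1 + 1 / x)) {N : ℕ} {B : ℝ}
    (hl : TowerLevel k x N B) : TowerLevel k y (2 * N) (19 / 10 * B) := by
  classical
  have := h.finiteDimensional
  have := h.isSeparable
  obtain ⟨S, hS, hg, hB⟩ := hl.exists_bad
  obtain ⟨R, hR, hRc⟩ := hl.exists_rational
  have hdisj (T : Finset (Place k F)) :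
      (T : Set (Place k F)).PairwiseDisjoint fun P => P.fiber F' := by
    intro P _ Q _ hPQ
    rw [Function.onFun, Finset.disjoint_left]
    intro P' h1 h2
    exact hPQ ((Place.mem_fiber.1 h1).symm.trans (Place.mem_fiber.1 h2))
  refine ⟨?_, ?_, ⟨S.biUnion fun P => P.fiber F', fun P' => ?_, ?_, ?_⟩,
    ⟨R.biUnion fun P => P.fiber F', fun P' => ?_, ?_⟩⟩
  · obtain ⟨z, hz, hf⟩ := hl.exists_finite
    exact ⟨algebraMap F F' z, (transcendental_algebraMap_iff (algebraMap F F').injective).2 hz,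
      finiteDimensional_adjoin_algebraMap z⟩
  · obtain ⟨P, hd, hP⟩ := hl.exists_pole
    have h1 : 1 < P.valuation x := by rw [hP, ← exp_zero, exp_lt_exp]; norm_num
    -- Total ramification keeps the pole rational and simple, so it remains available at the next
    -- level.
    obtain ⟨P', -, -, hd', hy⟩ := h.ramified (P := P) (by omega) (w := 0)
      (by simpa using (P.valuation_rhs_of_one_lt h1).trans hP)
    exact ⟨P', by rw [hd', hd], by simpa using hy⟩
  · rw [Finset.mem_biUnion, h.bad_iff hx0, ← hS]
    simp
  · have hgen := h.hasGenus hg hweak S fun P hP => by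
      rw [hS] at hP
      unfold Place.Bad at hP
      push Not at hP
      exact P.valuation_rhs_le_one (hP.1.antisymm hP.2.1)
    convert hgen using 1
    rw [Finset.sum_biUnion (hdisj S)]
    have hsum (P : Place k F) := h.sum_degree_fiber (hg.degree_pos P) (hweak P)
    -- The ramification term here cancels the one in the genus formula.
    have h3 : ∑ P ∈ S, ∑ P' ∈ P.fiber F', (P'.degree : ℤ) +
        ((∑ P ∈ S, P.wild (x + 1 + 1 / x) * P.degree : ℕ) : ℤ) = 2 * ∑ P ∈ S, (P.degree : ℤ) := by
      rw [Nat.cast_sum, ← Finset.sum_add_distrib, Finset.mul_sum]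
      exact Finset.sum_congr rfl fun P _ => by exact_mod_cast hsum P
    push_cast at h3 ⊢
    linarith
  · rw [Finset.sum_biUnion (hdisj S)]
    calc _ ≤ ∑ P ∈ S, 19 / 10 * (P.degree * P.weight x) :=
          Finset.sum_le_sum fun P hP =>
            h.sum_weight_le hx0 (hg.degree_pos P) ((hS P).1 hP) hx1 hx2
      _ ≤ _ := by rw [← Finset.mul_sum]; linarith
  · rw [Finset.mem_biUnion]
    constructor
    · rintro ⟨P, hP, hP'⟩
      obtain ⟨hd, hb⟩ := (hR P).1 hP
      refine ⟨(h.rational_fiber hx0 hk hd hb).2 P' hP', ?_⟩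
      rwa [h.bad_iff hx0, Place.mem_fiber.1 hP']
    · rintro ⟨hd, hb⟩
      refine ⟨P'.restrict F, (hR _).2 ⟨?_, by rwa [← h.bad_iff hx0]⟩, Place.mem_fiber.2 rfl⟩
      have := P'.degree_restrict_dvd (F := F)
      rw [hd] at this
      exact Nat.dvd_one.1 this
  · rw [Finset.card_biUnion fun P hP Q hQ hPQ => hdisj R hP hQ hPQ,
      Finset.sum_const_nat fun P hP => (h.rational_fiber hx0 hk ((hR P).1 hP).1 ((hR P).1 hP).2).1,
      hRc]
    ring

theorem TowerLevel.isCurveFunctionField {k F : Type*} [Field k] [Field F] [Algebra k F] {x : F}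
    {N : ℕ} {B : ℝ} (hl : TowerLevel k x N B) : IsCurveFunctionField k F where
  exists_finite := hl.exists_finite
  exact_constants a ha := by
    obtain ⟨P, hd, -⟩ := hl.exists_pole
    exact Place.mem_range_of_isAlgebraic hd ha

theorem TowerLevel.exists_counts {k F : Type*} [Field k] [Field F] [Algebra k F] {x : F}
    {N : ℕ} {B : ℝ} (hl : TowerLevel k x N B) (hx0 : x ≠ 0) (hx1 : x + 1 ≠ 0)
    (hx2 : x ^ 2 + x + 1 ≠ 0) : ∃ s m : ℕ, genus k F = 4 * N + 1 - s ∧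
      numRationalPoints k F = 6 * N + m ∧ m ≤ s ∧ (s : ℝ) ≤ B := by
  classical
  obtain ⟨S, hS, hg, hB⟩ := hl.exists_bad
  obtain ⟨R, hR, hRc⟩ := hl.exists_rational
  refine ⟨∑ P ∈ S, P.degree, (S.filter fun P => P.degree = 1).card, ?_, ?_, ?_, ?_⟩
  · rw [hg.genus_eq, Nat.cast_sum]
  · have hset : ∀ P : Place k F, P ∈ R ∪ S.filter (fun P => P.degree = 1) ↔ P.degree = 1 := by
      intro P
      rw [Finset.mem_union, hR, Finset.mem_filter, hS]
      by_cases P.Bad x <;> simp [*]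
    unfold numRationalPoints
    rw [Nat.subtype_card _ hset, Finset.card_union_of_disjoint, hRc]
    rw [Finset.disjoint_left]
    intro P h1 h2
    exact ((hR P).1 h1).2 ((hS P).1 (Finset.mem_filter.1 h2).1)
  · rw [Finset.card_eq_sum_ones]
    calc _ ≤ ∑ P ∈ S.filter (fun P => P.degree = 1), P.degree :=
          Finset.sum_le_sum fun P _ => hg.degree_pos P
      _ ≤ _ := Finset.sum_le_sum_of_subset (Finset.filter_subset _ _)
  · refine le_trans ?_ hB
    rw [Nat.cast_sum]
    refine Finset.sum_le_sum fun P hP => ?_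
    exact le_mul_of_one_le_right (Nat.cast_nonneg _)
      (P.one_le_weight ((hS P).1 hP) hx0 hx1 hx2)

/-! ### Artin-Schreier steps between intermediate fields -/

section Inclusion

open Polynomial IntermediateField

variable {k L : Type*} [Field k] [Field L] [Algebra k L] {K K' : IntermediateField k L}

theorem isArtinSchreier_inclusion (h2 : (2 : k) = 0) (hle : K ≤ K') (y : K') (u : K)
    (heq : (y : L) ^ 2 + y = u) (hy : (y : L) ∉ K)
    (hmin : K' ≤ (adjoin K {(y : L)}).restrictScalars k) :
    letI := (inclusion hle).toRingHom.toAlgebra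
    IsArtinSchreier y u := by
  let _ := (inclusion hle).toRingHom.toAlgebra
  refine ⟨?_, Subtype.ext heq, fun a ha => hy (by rw [ha]; exact a.2), fun z => ?_⟩
  · rw [← map_ofNat (algebraMap k K) 2, h2, map_zero]
  set q : K[X] := X ^ 2 + X - C u with hq
  have hmonic : q.Monic := by rw [hq]; monicity!
  have hdeg : q.natDegree = 2 := by rw [hq]; compute_degree!
  have hroot : aeval (y : L) q = 0 := by
    simp only [hq, map_sub, map_add, map_pow, aeval_X, aeval_C]
    exact sub_eq_zero.2 heq
  have hyint : IsIntegral K (y : L) := ⟨q, hmonic, hroot⟩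
  have hz : (z : L) ∈ adjoin K {(y : L)} := hmin z.2
  rw [← mem_toSubalgebra, adjoin_simple_toSubalgebra_of_isAlgebraic hyint.isAlgebraic,
    Algebra.adjoin_singleton_eq_range_aeval] at hz
  obtain ⟨p, hp⟩ := hz
  have hp' : aeval (y : L) p = z := hp
  obtain ⟨b, a, hab⟩ := exists_eq_X_add_C_of_natDegree_le_one (p := p %ₘ q) (by
    have := natDegree_modByMonic_lt p hmonic (by rintro h; rw [h] at hdeg; simp at hdeg)
    omega)
  refine ⟨a, b, Subtype.ext ?_⟩
  rw [← hp', ← aeval_modByMonic_eq_self_of_root hroot, hab]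
  simp only [map_add, map_mul, aeval_X, aeval_C]
  exact add_comm _ _

/-- The Artin-Schreier class of `u` has poles of order at most one at all places of `K`. -/
def WeakOn (K : IntermediateField k L) (u : L) : Prop :=
  ∀ (P : Place k K) (z : K), (z : L) = u → P.WeakAt z

/-- The degenerate case `y ∈ K`, where `K' = K`, is admitted so that the induction in `weakOn` need
not know the degrees of the steps. -/
theorem WeakOn.of_le [Finite k] (h2 : (2 : k) = 0) (hle : K ≤ K') {y u u₂ : L} (hy : y ∈ K')
    (hu : u ∈ K) (hu₂ : u₂ ∈ K) (heq : y ^ 2 + y = u)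
    (hmin : K' ≤ (adjoin K {y}).restrictScalars k) (hd : ∀ P : Place k K, 0 < P.degree)
    (hw : WeakOn K u) (hw₂ : WeakOn K u₂) :
    (∀ P : Place k K', 0 < P.degree) ∧ WeakOn K' u₂ := by
  by_cases hyK : y ∈ K
  · have : K' = K := by
      refine le_antisymm (hmin.trans ?_) hle
      intro z hz
      have hbot : adjoin K {y} = ⊥ := adjoin_simple_eq_bot_iff.2 ⟨⟨y, hyK⟩, rfl⟩
      rw [hbot] at hz
      obtain ⟨w, rfl⟩ := hz
      exact w.2
    subst this
    exact ⟨hd, hw₂⟩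
  let _ := (inclusion hle).toRingHom.toAlgebra
  have : IsScalarTower k K K' := IsScalarTower.of_algebraMap_eq fun _ => rfl
  have h : IsArtinSchreier (⟨y, hy⟩ : K') (⟨u, hu⟩ : K) :=
    isArtinSchreier_inclusion h2 hle ⟨y, hy⟩ ⟨u, hu⟩ heq hyK hmin
  have := h.finiteDimensional
  have := h.isSeparable
  refine ⟨fun P' => P'.degree_pos_of_restrict (F := K) (hd _), fun P' z hz => ?_⟩
  have hz' : z = algebraMap K K' ⟨u₂, hu₂⟩ := Subtype.ext hz
  rw [hz']
  exact h.weakAt_algebraMap (hd _) (hw _ _ rfl) (hw₂ _ _ rfl) (Place.mem_fiber.2 rfl)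

theorem isRationalGenerator_adjoin {x : L} (hx : Transcendental k x)
    (hK : K = adjoin k {x}) (z : K) (hz : (z : L) = x) : IsRationalGenerator k z := by
  subst hz
  refine ⟨fun h => hx ?_, fun f => ?_⟩
  · exact (isAlgebraic_algebraMap_iff (algebraMap K L).injective).2 h
  · have hf : (f : L) ∈ adjoin k {(z : L)} := hK.le f.2
    rw [mem_adjoin_simple_iff] at hf
    obtain ⟨p, q, hpq⟩ := hf
    have hc (r : k[X]) : ((aeval z r : K) : L) = aeval (z : L) r := by
      have := aeval_algebraMap_apply L z r
      exact this.symm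
    by_cases hq : q = 0
    · refine ⟨0, 1, one_ne_zero, Subtype.ext ?_⟩
      rw [hpq, hq]
      simp
    · refine ⟨p, q, hq, Subtype.ext ?_⟩
      rw [hpq, ← hc, ← hc]
      rfl

end Inclusion

/-! ### The tower and its limits -/

namespace IsTowerSequence

open IntermediateField

variable {k L : Type*} [Field k] [Field L] [Algebra k L] {x : ℕ → L}

/-- With `c = x₁² + x₁`, the element `x₀` is a root of `X² + (1 - c)X + 1`, so it would be algebraic
along with `x₁`. -/
theorem transcendental_succ (h : IsTowerSequence k x) : Transcendental k (x 1) := by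
  intro h1
  refine h.transcendental ?_
  have h0 : x 0 ≠ 0 := fun h0 => h.transcendental (by rw [h0]; exact isAlgebraic_zero)
  have hr := h.recursion 0
  rw [zero_add] at hr
  have hu : x 1 ^ 2 + x 1 ∈ algebraicClosure k L :=
    add_mem (pow_mem (mem_algebraicClosure_iff.2 h1) 2) (mem_algebraicClosure_iff.2 h1)
  set c : algebraicClosure k L := ⟨_, hu⟩ with hc
  have halg : IsAlgebraic (algebraicClosure k L) (x 0) := by
    refine ⟨Polynomial.X ^ 2 + (Polynomial.C (1 - c) * Polynomial.X + 1), ?_, ?_⟩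
    · refine Polynomial.Monic.ne_zero ?_
      monicity!
    · have hcc : algebraMap (algebraicClosure k L) L c = x 0 + 1 + 1 / x 0 := hr
      simp only [map_add, map_pow, map_mul, map_sub, map_one, Polynomial.aeval_X,
        Polynomial.aeval_C, hcc]
      field_simp
      ring
  have : Algebra.IsAlgebraic k (algebraicClosure k L) := inferInstance
  exact halg.restrictScalars k

theorem shift (h : IsTowerSequence k x) : IsTowerSequence k fun i => x (i + 1) :=
  ⟨h.transcendental_succ, fun i => h.recursion (i + 1)⟩

theorem transcendental_apply (h : IsTowerSequence k x) (i : ℕ) : Transcendental k (x i) := by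
  induction i generalizing x with
  | zero => exact h.transcendental
  | succ i ih => exact ih h.shift

theorem ne_zero (h : IsTowerSequence k x) (i : ℕ) : x i ≠ 0 :=
  fun h0 => h.transcendental_apply i (by rw [h0]; exact isAlgebraic_zero)

theorem add_one_ne_zero (h : IsTowerSequence k x) (i : ℕ) : x i + 1 ≠ 0 :=
  fun h0 => h.transcendental_apply i (by
    rw [eq_neg_of_add_eq_zero_left h0]; exact isAlgebraic_one.neg)

theorem quadratic_ne_zero (h : IsTowerSequence k x) (i : ℕ) : x i ^ 2 + x i + 1 ≠ 0 := by
  refine fun h0 => h.transcendental_apply i ⟨Polynomial.X ^ 2 + Polynomial.X + 1, ?_, ?_⟩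
  · exact Polynomial.Monic.ne_zero (by monicity!)
  · simpa using h0

theorem mem_towerField {i n : ℕ} (hi : i ≤ n) : x i ∈ towerField k x n :=
  subset_adjoin _ _ ⟨i, hi, rfl⟩

theorem towerField_le_iff {n : ℕ} {M : IntermediateField k L} :
    towerField k x n ≤ M ↔ ∀ i ≤ n, x i ∈ M := by
  simp [towerField, adjoin_le_iff, Set.subset_def]

theorem towerField_mono : Monotone (towerField k x) := fun _ _ hab =>
  towerField_le_iff.2 fun _ hi => mem_towerField (hi.trans hab)

theorem towerField_zero : towerField k x 0 = adjoin k {x 0} := by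
  unfold towerField
  congr 1
  ext
  simp [eq_comm]

theorem towerField_succ_le {n : ℕ} :
    towerField k x (n + 1) ≤
      (adjoin (towerField k x n) {x (n + 1)}).restrictScalars k := by
  refine towerField_le_iff.2 fun i hi => ?_
  rcases Nat.of_le_succ hi with hi | rfl
  · exact (adjoin (towerField k x n) {x (n + 1)}).algebraMap_mem ⟨x i, mem_towerField hi⟩
  · exact (mem_restrictScalars k).2 (mem_adjoin_simple_self (towerField k x n) (x (n + 1)))

theorem rhs_mem (i n : ℕ) (hi : i ≤ n) : x i + 1 + 1 / x i ∈ towerField k x n :=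
  add_mem (add_mem (mem_towerField hi) (one_mem _)) (div_mem (one_mem _) (mem_towerField hi))

theorem quadratic_mem (i n : ℕ) (hi : i ≤ n) : 1 / (x i ^ 2 + x i + 1) ∈ towerField k x n :=
  div_mem (one_mem _) (add_mem (add_mem (pow_mem (mem_towerField hi) 2) (mem_towerField hi))
    (one_mem _))

/-- The induction runs over all sequences at once. The class at the top is known on `k(x₁, …, xₙ₊₁)`
from the shifted sequence and is carried up by adjoining `x₀`; the class `1/(x₀² + x₀ + 1)` is
carried up by adjoining `xₙ₊₁`. The second class is included because, shifted, it is the one that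
governs the adjunction of `x₀`. -/
theorem weakOn (h : IsTowerSequence k x) (hk : Nat.card k = 8) (n : ℕ) :
    (∀ P : Place k (towerField k x n), 0 < P.degree) ∧
    WeakOn (towerField k x n) (x n + 1 + 1 / x n) ∧
    WeakOn (towerField k x n) (1 / (x 0 ^ 2 + x 0 + 1)) := by
  have := finite_of_card_eight hk
  have h2 := two_eq_zero_of_card_eight hk
  have h2' : (2 : L) = 0 := by rw [← map_ofNat (algebraMap k L) 2, h2, map_zero]
  induction n generalizing x with
  | zero =>
    have hg := isRationalGenerator_adjoin h.transcendental towerField_zero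
      ⟨x 0, mem_towerField le_rfl⟩ rfl
    refine ⟨hg.degree_pos, fun P z hz => ?_, fun P z hz => ?_⟩
    · convert hg.weakAt_add_one_add_inv P
      exact Subtype.ext hz
    · convert hg.weakAt_inv_quadratic hk P
      exact Subtype.ext hz
  | succ n ih =>
    obtain ⟨hd, hw, hw'⟩ := ih h
    obtain ⟨hd₁, hw₁, hw₁'⟩ := ih h.shift
    obtain ⟨hd₂, hw₂⟩ := WeakOn.of_le h2 (towerField_mono n.le_succ) (mem_towerField le_rfl)
      (rhs_mem n n le_rfl) (quadratic_mem 0 n n.zero_le) (h.recursion n) towerField_succ_le hd hw hw'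
    refine ⟨hd₂, ?_, hw₂⟩
    have hf := h.quadratic_ne_zero 1
    have hx0 := h.ne_zero 0
    have hr : x 1 ^ 2 + x 1 = x 0 + 1 + 1 / x 0 := h.recursion 0
    have hle : towerField k (fun i => x (i + 1)) n ≤ towerField k x (n + 1) :=
      towerField_le_iff.2 fun i hi => mem_towerField (Nat.succ_le_succ hi)
    have hf' : x 1 ^ 2 + x 1 + 1 ∈ towerField k (fun i => x (i + 1)) n := by
      have : x 1 ∈ towerField k (fun i => x (i + 1)) n :=
        mem_towerField (x := fun i => x (i + 1)) n.zero_le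
      exact add_mem (add_mem (pow_mem this 2) this) (one_mem _)
    -- Put `f = x₁² + x₁ + 1`. The recursion says `(x₀ + 1)² = f x₀`, so `v = (x₀ + 1)/f` satisfies
    -- `v² + v = 1/f`, and `x₀ = v f - 1` is recovered from `v`.
    refine (WeakOn.of_le h2 hle (y := (x 0 + 1) / (x 1 ^ 2 + x 1 + 1))
      (u := 1 / (x 1 ^ 2 + x 1 + 1)) (u₂ := x (n + 1) + 1 + 1 / x (n + 1)) ?_ ?_ ?_ ?_ ?_
      hd₁ hw₁' hw₁).2
    · exact div_mem (add_mem (mem_towerField (Nat.zero_le _)) (one_mem _)) (hle hf')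
    · exact div_mem (one_mem _) hf'
    · exact rhs_mem (x := fun i => x (i + 1)) n n le_rfl
    · have hfx : (x 1 ^ 2 + x 1 + 1) * x 0 = x 0 ^ 2 + 1 := by
        rw [hr]
        field_simp
        linear_combination x 0 * h2'
      have hsq : (x 0 + 1) ^ 2 = (x 1 ^ 2 + x 1 + 1) * x 0 := by
        linear_combination x 0 * h2' - hfx
      rw [div_pow, hsq, pow_two (_ + 1), mul_div_mul_left _ _ hf, ← add_div]
      congr 1
      linear_combination x 0 * h2'
    · refine towerField_le_iff.2 fun i hi => ?_
      set M := adjoin (towerField k (fun i => x (i + 1)) n) {(x 0 + 1) / (x 1 ^ 2 + x 1 + 1)}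
      have hb {z : L} (hz : z ∈ towerField k (fun i => x (i + 1)) n) : z ∈ M :=
        M.algebraMap_mem ⟨z, hz⟩
      refine (mem_restrictScalars k).2 ?_
      rcases i with _ | i
      · have h0 : x 0 = (x 0 + 1) / (x 1 ^ 2 + x 1 + 1) * (x 1 ^ 2 + x 1 + 1) - 1 := by
          rw [div_mul_cancel₀ _ hf, add_sub_cancel_right]
        rw [h0]
        exact sub_mem (mul_mem (mem_adjoin_simple_self _ _) (hb hf')) (one_mem _)
      · exact hb (mem_towerField (x := fun i => x (i + 1)) (Nat.le_of_succ_le_succ hi))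

theorem isArtinSchreier (h : IsTowerSequence k x) (h2 : (2 : k) = 0) (n : ℕ)
    (hn : x (n + 1) ∉ towerField k x n) :
    letI := (inclusion (towerField_mono (k := k) (x := x) n.le_succ)).toRingHom.toAlgebra
    IsArtinSchreier (⟨x (n + 1), mem_towerField le_rfl⟩ : towerField k x (n + 1))
      ((⟨x n, mem_towerField le_rfl⟩ : towerField k x n) + 1 + 1 / ⟨x n, mem_towerField le_rfl⟩) :=
  isArtinSchreier_inclusion h2 _ _ _ (h.recursion n) hn towerField_succ_le

theorem notMem_towerField (h : IsTowerSequence k x) {n N : ℕ} {B : ℝ}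
    (hl : TowerLevel k (⟨x n, mem_towerField le_rfl⟩ : towerField k x n) N B) :
    x (n + 1) ∉ towerField k x n := fun hn =>
  hl.not_exists_sq_add_self ⟨x (n + 1), hn⟩ (Subtype.ext (h.recursion n))

theorem exists_towerLevel (h : IsTowerSequence k x) (hk : Nat.card k = 8) : ∃ C : ℝ, ∀ n,
    TowerLevel k (⟨x n, mem_towerField le_rfl⟩ : towerField k x n) (2 ^ n)
      ((19 / 10) ^ n * C) := by
  have h2 := two_eq_zero_of_card_eight hk
  obtain ⟨C, hC⟩ := (isRationalGenerator_adjoin h.transcendental towerField_zero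
      ⟨x 0, mem_towerField le_rfl⟩ rfl).exists_towerLevel hk
  refine ⟨C, fun n => ?_⟩
  induction n with
  | zero => simpa using hC
  | succ n ih =>
    let _ := (inclusion (towerField_mono (k := k) (x := x) n.le_succ)).toRingHom.toAlgebra
    have : IsScalarTower k (towerField k x n) (towerField k x (n + 1)) :=
      IsScalarTower.of_algebraMap_eq fun _ => rfl
    have has := h.isArtinSchreier h2 n (h.notMem_towerField ih)
    rw [pow_succ', pow_succ', mul_assoc]
    exact has.towerLevel (fun h0 => h.ne_zero n (congrArg Subtype.val h0))
      (fun h0 => h.add_one_ne_zero n (congrArg Subtype.val h0))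
      (fun h0 => h.quadratic_ne_zero n (congrArg Subtype.val h0)) hk
      (fun P => (h.weakOn hk n).2.1 P _ rfl) ih

theorem relfinrank_succ (h : IsTowerSequence k x) (hk : Nat.card k = 8) (n : ℕ) :
    relfinrank (towerField k x n) (towerField k x (n + 1)) = 2 := by
  obtain ⟨C, hC⟩ := h.exists_towerLevel hk
  rw [relfinrank_eq_finrank_of_le (towerField_mono n.le_succ)]
  let _ := (inclusion (towerField_mono (k := k) (x := x) n.le_succ)).toRingHom.toAlgebra
  exact (h.isArtinSchreier (two_eq_zero_of_card_eight hk) n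
    (h.notMem_towerField (hC n))).finrank_eq

theorem tendsto (h : IsTowerSequence k x) (hk : Nat.card k = 8) :
    Tendsto (fun n => (genus k (towerField k x n) : ℝ) / 2 ^ n) atTop (𝓝 4) ∧
    Tendsto (fun n => (numRationalPoints k (towerField k x n) : ℝ) / 2 ^ n) atTop (𝓝 6) := by
  obtain ⟨C, hC⟩ := h.exists_towerLevel hk
  choose s m hs hm hms hsB using fun n => (hC n).exists_counts
    (fun h0 => h.ne_zero n (congrArg Subtype.val h0))
    (fun h0 => h.add_one_ne_zero n (congrArg Subtype.val h0))
    (fun h0 => h.quadratic_ne_zero n (congrArg Subtype.val h0))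
  have hlim : Tendsto (fun n : ℕ => (19 / 20 : ℝ) ^ n * C) atTop (𝓝 0) := by
    simpa using (tendsto_pow_atTop_nhds_zero_of_lt_one (r := (19 / 20 : ℝ)) (by norm_num)
      (by norm_num)).mul_const C
  -- The total bad degree is at most `C (19/10)ⁿ`, hence negligible against `2ⁿ`.
  have hs0 : Tendsto (fun n => (s n : ℝ) / 2 ^ n) atTop (𝓝 0) := by
    refine squeeze_zero (fun n => by positivity) (fun n => ?_) hlim
    rw [div_le_iff₀ (by positivity)]
    refine (hsB n).trans_eq ?_
    rw [mul_right_comm, ← mul_pow]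
    norm_num
  have hm0 : Tendsto (fun n => (m n : ℝ) / 2 ^ n) atTop (𝓝 0) := by
    refine squeeze_zero (fun n => by positivity) (fun n => ?_) hs0
    gcongr
    exact hms n
  have hp0 : Tendsto (fun n : ℕ => ((1 / 2 : ℝ)) ^ n) atTop (𝓝 0) :=
    tendsto_pow_atTop_nhds_zero_of_lt_one (by norm_num) (by norm_num)
  constructor
  · have := (hp0.const_add 4).sub hs0
    simp only [add_zero, sub_zero] at this
    refine this.congr fun n => ?_
    rw [hs, one_div, inv_pow]
    push_cast
    field_simp
  · have := hm0.const_add 6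
    simp only [add_zero] at this
    refine this.congr fun n => ?_
    rw [hm]
    push_cast
    field_simp

theorem tendsto_pointGenusRatio (h : IsTowerSequence k x) (hk : Nat.card k = 8) :
    Tendsto (pointGenusRatio k (towerField k x)) atTop (𝓝 (3 / 2)) := by
  obtain ⟨hg, hN⟩ := h.tendsto hk
  have := hN.div hg four_ne_zero
  rw [show (6 / 4 : ℝ) = 3 / 2 by norm_num] at this
  refine this.congr fun n => ?_
  exact div_div_div_cancel_right₀ (by positivity) _ _

theorem isAsymptoticallyGoodTower (h : IsTowerSequence k x) (hk : Nat.card k = 8) :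
    IsAsymptoticallyGoodTower k (towerField k x) where
  curve n := ((h.exists_towerLevel hk).choose_spec n).isCurveFunctionField
  mono := towerField_mono
  one_lt_genus := by
    obtain ⟨n, hn⟩ := ((h.tendsto hk).1.eventually (lt_mem_nhds (by norm_num : (1 : ℝ) < 4))).exists
    refine ⟨n, ?_⟩
    rw [lt_div_iff₀ (by positivity), one_mul] at hn
    exact_mod_cast (one_le_pow₀ one_le_two).trans_lt hn
  limit_pos := ⟨3 / 2, by norm_num, h.tendsto_pointGenusRatio hk⟩

end IsTowerSequence

/-! ### Existence of the sequence and conclusion -/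

theorem exists_isTowerSequence (k : Type*) {L : Type*} [Field k] [Field L] [Algebra k L]
    [IsAlgClosed L] {t : L} (ht : Transcendental k t) : ∃ x : ℕ → L, IsTowerSequence k x := by
  have hroot (c : L) : ∃ z : L, z ^ 2 + z = c := by
    obtain ⟨z, hz⟩ := IsAlgClosed.exists_root (Polynomial.X ^ 2 + Polynomial.X - Polynomial.C c)
      (by
        have : (Polynomial.X ^ 2 + Polynomial.X - Polynomial.C c).degree = 2 := by
          compute_degree!
        rw [this]
        norm_num)
    exact ⟨z, sub_eq_zero.1 (by simpa [Polynomial.IsRoot] using hz)⟩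
  choose f hf using hroot
  exact ⟨fun n => Nat.rec t (fun _ z => f (z + 1 + 1 / z)) n, ht, fun i => hf _⟩

end

theorem mainTheorem1 (k : Type*) [Field k] (hk : Nat.card k = 8) :
    (∃ x : ℕ → AlgebraicClosure (RatFunc k), IsTowerSequence k x) ∧
    ∀ (L : Type*) [Field L] [Algebra k L] (x : ℕ → L), IsTowerSequence k x →
      (∀ i, IntermediateField.relfinrank (towerField k x i) (towerField k x (i + 1)) = 2) ∧
      IsAsymptoticallyGoodTower k (towerField k x) ∧
      Tendsto (pointGenusRatio k (towerField k x)) atTop (𝓝 (3 / 2)) := by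
  refine ⟨exists_isTowerSequence k (t := algebraMap (RatFunc k) _ RatFunc.X) ?_, ?_⟩
  · rw [transcendental_algebraMap_iff (algebraMap (RatFunc k) _).injective]
    exact RatFunc.transcendental_X
  · exact fun L _ _ x h =>
      ⟨h.relfinrank_succ hk, h.isAsymptoticallyGoodTower hk, h.tendsto_pointGenusRatio hk⟩
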